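/- **Setting.** All data depend on a security parameter $\lambda$. "Efficient" means computed by circuits of polynomial size, whose gates are unitaries on at most three qubits. A QPT algorithm is non-uniform: a polynomial-size family of such quantum circuits. Let $\mathcal F=\{f_{k,b}:\mathcal X\to\mathcal D_{\mathcal Y}\}_{k\in\mathcal K,b\in\{0,1\}}$ be a noisy trapdoor claw-free (NTCF) family, where elements of $\mathcal X\subseteq\{0,1\}^n$, $\mathcal Y\subseteq\{0,1\}^m$ and $\mathcal K$ are identified with their bit decompositions, of polynomial length. That is: 1. A pair (key, trapdoor) $(k,t_k)$ is generated efficiently; $k\gets\mathcal F$ denotes the key. 2. With overwhelming probability over $(k,t_k)$, an efficient deterministic $\mathrm{Inv}$ satisfies $\mathrm{Inv}(t_k,b,y)=x$ for all $b$, $x$ and $y\in\mathrm{Supp}(f_{k,b}(x))$. For every $k$ there is a perfect matching $\mathcal R_k\subseteq\mathcal X\times\mathcal X$ with $f_{k,0}(x_0)=f_{k,1}(x_1)$ iff $(x_0,x_1)\in\mathcal R_k$. 3. There are $f'_{k,b}:\mathcal X\to\mathcal D_{\mathcal Y}$ such that: for generated $(k,t_k)$, all $(x_0,x_1)\in\mathcal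 R_k$, all $b$ and all $y\in\mathrm{Supp}(f'_{k,b}(x_b))$, $\mathrm{Inv}(t_k,b,y)=x_b$ and $\mathrm{Inv}(t_k,b\oplus1,y)=x_{b\oplus1}$; membership $y\in\mathrm{Supp}(f'_{k,b}(x))$ is efficiently decidable from $k,b,x,y$; $\mathbb E_{x\gets\mathcal X}H^2(f_{k,b}(x),f'_{k,b}(x))\le\mu(\lambda)$ for all $k,b$ and one negligible $\mu$, with $H^2$ the squared Hellinger distance; and $|\mathcal X|^{-1/2}\sum_{x,y}\sqrt{f'_{k,b}(x)(y)}\,|x\rangle|y\rangle$ is efficiently preparable from $k,b$. 4. (Claw-freeness) Every non-uniform QPT algorithm that is given $k\gets\mathcal F$ outputs a pair $(x_0,x_1)\in\mathcal R_k$ with negligible probability only. For a key $k$, the pre-images $x_0^y,x_1^y$ of $y$ are the pair $(x_0,x_1)\in\mathcal R_k$ with $x_0\ne x_1$ and $y\in\mathrm{Supp}(f'_{k,0}(x_0))\cup\mathrm{Supp}(f'_{k,1}(x_1))$, if there is one (for generated keys there is at most one). An equation $(z,d,y)$, $z\in\{0,1\}$, $d\in\{0,1\}^n$, $y\in\{0,1\}^m$,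 is *valid* for $k$ and $H:\{0,1\}^n\to\{0,1\}$ if $y$ has pre-images and $z=d\cdot(x_0^y\oplus x_1^y)\oplus H(x_0^y)\oplus H(x_1^y)$. **Compressed phase oracle.** A database $D$ is a partial function from $\{0,1\}^n$ to $\{0,1\}$, initially empty. $\mathsf{StdDecomp}_x$ acts on the value at $x$ by exchanging $|\bot\rangle$ with $|+\rangle$ and fixing $|-\rangle$. A query $|x,e\rangle|D\rangle$ applies $\mathsf{StdDecomp}_x$, then the phase $(-1)^{e\cdot D(x)}$, then $\mathsf{StdDecomp}_x$. For a set $S$ of points outside $D$ put $$|D\cup S\rangle=2^{-|S|/2}\sum_{w\in\{0,1\}^S}(-1)^{\sum_{x\in S} w_x}\,|D\cup\{(x,w_x):x\in S\}\rangle .$$ Let $P$ be a non-uniform QPT oracle algorithm that makes phase queries $|x,e\rangle\mapsto(-1)^{e\cdot H(x)}|x,e\rangle$, takes a key $k$ as input, and acts on registers $\mathsf{ZDYXEW}$, with query registers $\mathsf{X},\mathsf{E}$, and $\mathsf W$ holding everything else. **Lemma.** Let $\delta$ be a real function of $\lambda$ such that, for all $\lambda$, $$\Pr\big[(z,d,y)\text{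 is valid for }k,H:\ k\gets\mathcal F,\ H\text{ uniform},\ (z,d,y)\gets P^H(k)\big]\ \ge\ \tfrac12+\delta(\lambda).$$ Then, for every $k$, the state of $P^{\mathsf{CPhO}}(k)$ (the run of $P$ with the compressed phase oracle) just before the measurement of the output has the form $$\sum\sum_{b\in\{0,1\}}\alpha^k_{z,d,y,x,e,w,D,b}|z,d,y,x,e,w\rangle|D\cup \{x_b^y\}\rangle+\sum\beta^k_{z,d,y,x,e,w,D}|z,d,y,x,e,w\rangle|D\cup\{x_0^y,x_1^y\}\rangle+\sum\gamma^k_{z,d,y,x,e,w,D}|z,d,y,x,e,w\rangle|D\rangle ,$$ where the outer sums are over $z,d,y,x,e,w$ and over databases $D$ containing neither $x_0^y$ nor $x_1^y$ (if $y$ has no pre-images, only the $\gamma$-terms occur, for all $D$). Moreover there is a negligible function $\mathsf{negl}$ such that, for all $\lambda$ and all such coefficients $\alpha^k,\beta^k,\gamma^k$, with the same outer sums (over those $y$ that have pre-images): (i) $\displaystyle \mathbb E_{k\gets\mathcal F}\sum|\beta^k_{z,d,y,x,e,w,D}|^2\le\mathsf{negl}(\lambda)$; (ii) $\displaystyle \mathbb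 E_{k\gets\mathcal F}\sum\sum_{b\in\{0,1\}}|\alpha^k_{z,d,y,x,e,w,D,b}|^2\ge 2\delta(\lambda)-\mathsf{negl}(\lambda)$; (iii) $\displaystyle \mathbb E_{k\gets\mathcal F}\sum\big|\alpha^k_{z,d,y,x,e,w,D,0}-(-1)^{z+d\cdot(x_0^y\oplus x_1^y)}\alpha^k_{z,d,y,x,e,w,D,1}\big|^2\le \mathbb E_{k\gets\mathcal F}\sum\sum_{b\in\{0,1\}}|\alpha^k_{z,d,y,x,e,w,D,b}|^2-2\delta(\lambda)+\mathsf{negl}(\lambda)$. -/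

import Mathlib

open Filter
open scoped BigOperators

noncomputable section

namespace NTCFLemma

/-! ### Asymptotics -/

/-- Polynomially bounded. -/
def IsPoly (p : ℕ → ℕ) : Prop := ∃ q : Polynomial ℕ, ∀ l, p l ≤ q.eval l

/-- Negligible: smaller than every inverse polynomial in the security parameter. -/
def Negligible (f : ℕ → ℝ) : Prop :=
  Asymptotics.SuperpolynomialDecay atTop (fun l : ℕ => (l : ℝ)) f

/-! ### Qubits, gates, circuits -/

/-- Bit strings of length `n`. -/
abbrev Bits (n : ℕ) : Type := Fin n → Bool

/-- The sign `(-1)^b`. -/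
def sgn (b : Bool) : ℂ := if b then -1 else 1

/-- A gate on the wires `ι`: a unitary on at most three qubits, attached to distinct wires. -/
structure Gate (ι : Type) where
  arity : ℕ
  arity_le : arity ≤ 3
  wires : Fin arity ↪ ι
  mat : Matrix.unitaryGroup (Bits arity) ℂ

/-- The action of a gate on a state of the wires `ι`. A state is a function on computational basis
strings `s : ι → Bool`; its values are amplitudes (`V = ℂ`), or vectors of a further register that
the gate does not touch (`V` the state space of that register).
`Function.extend g.wires u s` is the string `s` overwritten by `u` on the wires of the gate. -/
def Gate.apply {ι V : Type} [AddCommMonoid V] [Module ℂ V] (g : Gate ι)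
    (ψ : (ι → Bool) → V) : (ι → Bool) → V :=
  fun s => ∑ u : Bits g.arity,
    (g.mat : Matrix (Bits g.arity) (Bits g.arity) ℂ) (s ∘ g.wires) u •
      ψ (Function.extend g.wires u s)

/-- A quantum circuit (without oracle) with input register `I`, output register `O` and `anc` work
qubits; the output and work qubits start in `|0⟩`. -/
structure QCircuit (I O : Type) where
  anc : ℕ
  gates : List (Gate (I ⊕ O ⊕ Fin anc))

namespace QCircuit

variable {I O : Type} [Fintype I] [DecidableEq I] [Fintype O] [DecidableEq O]

/-- Number of work qubits plus number of gates. -/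
def size (C : QCircuit I O) : ℕ := C.anc + C.gates.length

/-- The final state on the classical input `u`, before any measurement. -/
def run (C : QCircuit I O) (u : I → Bool) : (I ⊕ O ⊕ Fin C.anc → Bool) → ℂ :=
  C.gates.foldl (fun ψ g => g.apply ψ) (Pi.single (Sum.elim u fun _ => false) 1)

/-- The probability that on input `u` the measured output register is `v`. -/
def outProb (C : QCircuit I O) (u : I → Bool) (v : O → Bool) : ℝ :=
  ∑ s : I ⊕ O ⊕ Fin C.anc → Bool,
    if (fun o => s (Sum.inr (Sum.inl o))) = v then ‖C.run u s‖ ^ 2 else 0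

end QCircuit

/-! ### Noisy trapdoor claw-free families -/

/-- Squared Hellinger distance of two distributions on a finite set. -/
def hellingerSq {A : Type} [Fintype A] (p q : PMF A) : ℝ :=
  1 - ∑ a, Real.sqrt ((p a).toReal * (q a).toReal)

/-- Expectation over a distribution on a finite set. -/
def expect {A : Type} [Fintype A] (p : PMF A) (g : A → ℝ) : ℝ := ∑ a, (p a).toReal * g a

open Classical in
/-- Probability of an event under a distribution on a finite set. -/
def prob {A : Type} [Fintype A] (p : PMF A) (E : A → Prop) : ℝ :=
  expect p fun a => if E a then 1 else 0

/-- Encoding of `𝒳 ∪ {⊥}` by a flag bit and a bit string. -/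
def encOption {n : ℕ} {S : Finset (Bits n)} : Option S → (Unit ⊕ Fin n → Bool)
  | none => fun _ => false
  | some x => Sum.elim (fun _ => true) x.1

/-- The amplitudes of `|𝒳|^{-1/2} ∑_{x,y} √(h(x)(y)) |x⟩|y⟩`. -/
def sampState {n m : ℕ} {X : Finset (Bits n)} {Y : Finset (Bits m)} (h : X → PMF Y)
    (o : Fin n ⊕ Fin m → Bool) : ℂ :=
  if hx : (fun i => o (Sum.inl i)) ∈ X then
    if hy : (fun j => o (Sum.inr j)) ∈ Y then
      ((Real.sqrt ((h ⟨_, hx⟩ ⟨_, hy⟩).toReal) / Real.sqrt (X.card : ℝ) : ℝ) : ℂ)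
    else 0
  else 0

/-- A noisy trapdoor claw-free family. All data depend on the security parameter `l`. The finite
sets of keys, pre-images and images are sets of bit strings (their bit decompositions), and
trapdoors are bit strings. "Efficient" means computed by circuits of polynomial size; uniform
(probabilistic) polynomial-time algorithms are special cases. Claw-freeness is against
(non-uniform) quantum polynomial-time adversaries. -/
structure NTCF where
  /-- bit lengths of keys, trapdoors, pre-images, images -/
  keyLen : ℕ → ℕ
  tdLen : ℕ → ℕ
  n : ℕ → ℕ
  m : ℕ → ℕ
  keyLen_poly : IsPoly keyLen
  tdLen_poly : IsPoly tdLen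
  n_poly : IsPoly n
  m_poly : IsPoly m
  K : ∀ l, Finset (Bits (keyLen l))
  X : ∀ l, Finset (Bits (n l))
  Y : ∀ l, Finset (Bits (m l))
  X_nonempty : ∀ l, (X l).Nonempty
  /-- the functions `f_{k,b}` from `𝒳` to distributions on `𝒴` -/
  f : ∀ l, K l → Bool → X l → PMF (Y l)
  /-- efficient function generation: `gen l` is the distribution of `(k, t_k)` -/
  gen : ∀ l, PMF (K l × Bits (tdLen l))
  gen_efficient : ∃ C : ∀ l, QCircuit Empty (Fin (keyLen l) ⊕ Fin (tdLen l)),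
    IsPoly (fun l => (C l).size) ∧
    ∀ l (k : K l) (t : Bits (tdLen l)),
      (C l).outProb Empty.elim (Sum.elim k.1 t) = (gen l (k, t)).toReal
  /-- trapdoor inversion, with values in `𝒳 ∪ {⊥}` -/
  inv : ∀ l, Bits (tdLen l) → Bool → Y l → Option (X l)
  inv_efficient : ∃ C : ∀ l, QCircuit (Fin (tdLen l) ⊕ Unit ⊕ Fin (m l)) (Unit ⊕ Fin (n l)),
    IsPoly (fun l => (C l).size) ∧
    ∀ l (t : Bits (tdLen l)) (b : Bool) (y : Y l),
      (C l).outProb (Sum.elim t (Sum.elim (fun _ => b) y.1)) (encOption (inv l t b y)) = 1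
  trapdoor : Negligible fun l => prob (gen l) fun kt =>
    ¬ ∀ (b : Bool) (x : X l) (y : Y l), y ∈ (f l kt.1 b x).support → inv l kt.2 b y = some x
  /-- the perfect matching `ℛ_k` between two copies of `𝒳`, as the bijection `x₀ ↦ x₁` -/
  R : ∀ l, K l → Equiv.Perm (X l)
  injective_pair : ∀ l k (x₀ x₁ : X l), f l k false x₀ = f l k true x₁ ↔ R l k x₀ = x₁
  /-- the functions `f'_{k,b}` of the efficient range superposition property -/
  fPrime : ∀ l, K l → Bool → X l → PMF (Y l)
  range_inv : ∀ l, ∀ kt ∈ (gen l).support, ∀ x₀ x₁ : X l, R l kt.1 x₀ = x₁ →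
    ∀ (b : Bool) (y : Y l), y ∈ (fPrime l kt.1 b (bif b then x₁ else x₀)).support →
      inv l kt.2 b y = some (bif b then x₁ else x₀) ∧
      inv l kt.2 (!b) y = some (bif b then x₀ else x₁)
  chk_efficient : ∃ C : ∀ l, QCircuit (Fin (keyLen l) ⊕ Unit ⊕ Fin (n l) ⊕ Fin (m l)) Unit,
    IsPoly (fun l => (C l).size) ∧
    ∀ l (k : K l) (b : Bool) (x : X l) (y : Y l) (v : Bool),
      (v = true ↔ y ∈ (fPrime l k b x).support) →
      (C l).outProb (Sum.elim k.1 (Sum.elim (fun _ => b) (Sum.elim x.1 y.1))) (fun _ => v) = 1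
  hellinger : ∃ μ : ℕ → ℝ, Negligible μ ∧ ∀ l k b,
    (∑ x : X l, hellingerSq (f l k b x) (fPrime l k b x)) / ((X l).card : ℝ) ≤ μ l
  /-- the output register is left in the pure state above, in tensor product with some state
  `φ` of the input and work registers -/
  samp_efficient : ∃ C : ∀ l, QCircuit (Fin (keyLen l) ⊕ Unit) (Fin (n l) ⊕ Fin (m l)),
    IsPoly (fun l => (C l).size) ∧
    ∀ l (k : K l) (b : Bool),
      ∃ φ : (Fin (keyLen l) ⊕ Unit → Bool) → (Fin (C l).anc → Bool) → ℂ,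
      ∀ s, (C l).run (Sum.elim k.1 fun _ => b) s =
        φ (fun i => s (Sum.inl i)) (fun a => s (Sum.inr (Sum.inr a))) *
          sampState (fPrime l k b) (fun o => s (Sum.inr (Sum.inl o)))
  claw_free : ∀ A : ∀ l, QCircuit (Fin (keyLen l)) (Fin (n l) ⊕ Fin (n l)),
    IsPoly (fun l => (A l).size) →
    Negligible fun l => expect (gen l) fun kt =>
      ∑ x₀ : X l, (A l).outProb kt.1.1 (Sum.elim x₀.1 (R l kt.1 x₀).1)

namespace NTCF

/-- Expectation over `k ← ℱ(1^l)`, the first component of the generated pair. -/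
def keyExp (F : NTCF) (l : ℕ) (g : F.K l → ℝ) : ℝ := expect (F.gen l) fun kt => g kt.1

/-- `(x₀, x₁)` is the pair of pre-images of `y` under the key `k`: two distinct matched points,
with `y` in the range of `f'_{k,0}(x₀)` or `f'_{k,1}(x₁)`. (By `range_inv`, for generated keys there
is at most one such pair for each `y`, and it is the pair that the trapdoor recovers from `y`.) -/
def IsClaw (F : NTCF) (l : ℕ) (k : F.K l) (y : Bits (F.m l)) (x₀ x₁ : F.X l) : Prop :=
  F.R l k x₀ = x₁ ∧ x₀ ≠ x₁ ∧ ∃ y₁ : F.Y l, y₁.1 = y ∧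
    (y₁ ∈ (F.fPrime l k false x₀).support ∨ y₁ ∈ (F.fPrime l k true x₁).support)

open Classical in
/-- The pair `(x₀^y, x₁^y)`, as bit strings; `none` when the string `y` has no pre-images. -/
def claw (F : NTCF) (l : ℕ) (k : F.K l) (y : Bits (F.m l)) :
    Option (Bits (F.n l) × Bits (F.n l)) :=
  if h : ∃ p : F.X l × F.X l, F.IsClaw l k y p.1 p.2 then
    some (h.choose.1.1, h.choose.2.1)
  else none

end NTCF

/-! ### Databases and the compressed phase oracle -/

/-- A database: a partial function from `n`-bit strings to bits (`none` is `⊥`). -/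
abbrev DB (n : ℕ) : Type := Bits n → Option Bool

/-- The basis state `|D⟩` of the database register. -/
def ket {n : ℕ} (D : DB n) : DB n → ℂ := Pi.single D 1

/-- The normalized state `|D ∪ S⟩`: every point of `S` is added to `D` with value in the state
`|-⟩`, that is `2^{-|S|/2} ∑_w (-1)^{∑_{x ∈ S} w_x} |D ∪ {(x, w_x) : x ∈ S}⟩`. -/
def ketUnion {n : ℕ} (D : DB n) (S : Finset (Bits n)) : DB n → ℂ :=
  ∑ w : S → Bool, (∏ x : S, sgn (w x) / (Real.sqrt 2 : ℂ)) •
    ket (fun x => if h : x ∈ S then some (w ⟨x, h⟩) else D x)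

/-- The matrix (row, column) of the decompression map of a single point, on `|⊥⟩, |0⟩, |1⟩`:
it exchanges `|⊥⟩` with `|+⟩` and fixes `|-⟩`. -/
def decompMat : Option Bool → Option Bool → ℂ
  | none, none => 0
  | none, some _ => 1 / (Real.sqrt 2 : ℂ)
  | some _, none => 1 / (Real.sqrt 2 : ℂ)
  | some v, some w => sgn (xor v w) / 2

/-- `StdDecomp_x` on the database register. -/
def stdDecomp {n : ℕ} (x : Bits n) (φ : DB n → ℂ) : DB n → ℂ :=
  fun D => ∑ v : Option Bool, decompMat (D x) v * φ (Function.update D x v)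

/-- `CPhO'` with query `|x, e⟩`: the phase `(-1)^{e · D(x)}` (no phase if `D(x) = ⊥`). -/
def phaseDB {n : ℕ} (x : Bits n) (e : Bool) (φ : DB n → ℂ) : DB n → ℂ :=
  fun D => sgn (e && (D x).getD false) * φ D

/-- The compressed phase oracle on a query `|x, e⟩`. -/
def cpho {n : ℕ} (x : Bits n) (e : Bool) (φ : DB n → ℂ) : DB n → ℂ :=
  stdDecomp x (phaseDB x e (stdDecomp x φ))

/-! ### Provers -/

/-- The qubits of a prover: `Z` (one), `D` (`n`), `Y` (`m`), `X` (`n`), `E` (one), and `W`, which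
consists of the input register holding the key and `a` further qubits. -/
inductive PWire (n m κ a : ℕ) : Type
  | z : PWire n m κ a
  | d : Fin n → PWire n m κ a
  | y : Fin m → PWire n m κ a
  | x : Fin n → PWire n m κ a
  | e : PWire n m κ a
  | key : Fin κ → PWire n m κ a
  | work : Fin a → PWire n m κ a
  deriving DecidableEq, Fintype

/-- A step of an oracle circuit: a gate, or a query with query registers `X` and `E`. -/
inductive Step (ι : Type) : Type
  | gate : Gate ι → Step ι
  | query : Step ι

/-- A prover at one value of the security parameter: an oracle circuit. Measurements are deferred
to the end. -/
structure Prover (n m κ : ℕ) where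
  anc : ℕ
  steps : List (Step (PWire n m κ anc))

namespace Prover

variable {n m κ : ℕ}

/-- Number of work qubits plus number of gates and queries. -/
def size (P : Prover n m κ) : ℕ := P.anc + P.steps.length

/-- Computational basis strings of all registers of the prover. -/
abbrev Basis (P : Prover n m κ) : Type := PWire n m κ P.anc → Bool

/-- The contents of the registers `D`, `Y`, `X` in a basis string. -/
def dReg (P : Prover n m κ) (s : P.Basis) : Bits n := fun i => s (.d i)
def yReg (P : Prover n m κ) (s : P.Basis) : Bits m := fun i => s (.y i)
def xReg (P : Prover n m κ) (s : P.Basis) : Bits n := fun i => s (.x i)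

/-- The initial basis string: the key in its register, all other qubits `0`. -/
def startBasis (P : Prover n m κ) (k : Bits κ) : P.Basis
  | .key i => k i
  | _ => false

/-- Run the steps with a given action of a query on the vector attached to each basis string of the
prover; `v` is the initial vector. -/
def runWith {V : Type} [AddCommMonoid V] [Module ℂ V] (P : Prover n m κ)
    (q : Bits n → Bool → V → V) (k : Bits κ) (v : V) : P.Basis → V :=
  P.steps.foldl
    (fun ψ st => match st with
      | .gate g => g.apply ψ
      | .query => fun s => q (P.xReg s) (s .e) (ψ s))
    (Pi.single (P.startBasis k) v)

/-- The final state of `P^H(k)`, where a query is `|x, e⟩ ↦ (-1)^{e · H(x)} |x, e⟩`. -/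
def runPhase (P : Prover n m κ) (H : Bits n → Bool) (k : Bits κ) : P.Basis → ℂ :=
  P.runWith (fun x e c => sgn (e && H x) * c) k 1

/-- The final state of `P^CPhO(k)`, on the registers of the prover and the database register, which
initially holds the empty database. -/
def runCompressed (P : Prover n m κ) (k : Bits κ) : P.Basis → DB n → ℂ :=
  P.runWith cpho k (ket fun _ => none)

end Prover

/-- Inner product `d · u` modulo 2. -/
def dot {n : ℕ} (d u : Bits n) : Bool :=
  decide (Odd (Finset.univ.filter fun i => d i = true ∧ u i = true).card)

/-- The bit `z ⊕ d · (x₀ ⊕ x₁)`. -/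
def eqnBit {n : ℕ} (z : Bool) (d x₀ x₁ : Bits n) : Bool :=
  xor z (dot d fun i => xor (x₀ i) (x₁ i))

section Claim

variable {n m κ : ℕ} (P : Prover n m κ) (cl : Bits m → Option (Bits n × Bits n))

/-- The measured `(z, d, y)` is a valid equation: `y` has pre-images and
`z = d · (x₀^y ⊕ x₁^y) ⊕ H(x₀^y) ⊕ H(x₁^y)`. -/
def ValidEqn (H : Bits n → Bool) (s : P.Basis) : Prop :=
  ∃ x₀ x₁, cl (P.yReg s) = some (x₀, x₁) ∧
    s .z = xor (dot (P.dReg s) fun i => xor (x₀ i) (x₁ i)) (xor (H x₀) (H x₁))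

open Classical in
/-- The probability, over uniform `H : {0,1}ⁿ → {0,1}` and the measurement, that `P^H(k)` outputs
a valid equation. -/
def winProb (k : Bits κ) : ℝ :=
  (∑ H : Bits n → Bool, ∑ s : P.Basis,
      if ValidEqn P cl H s then ‖P.runPhase H k s‖ ^ 2 else 0) /
    (Fintype.card (Bits n → Bool) : ℝ)

/-- The databases that contain neither `x₀` nor `x₁`. -/
def avoiding (x₀ x₁ : Bits n) : Finset (DB n) :=
  Finset.univ.filter fun D => D x₀ = none ∧ D x₁ = none

/-- The state `ψ` has the coefficients `α` (exactly one pre-image, `b = false, true` for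
`x₀^y, x₁^y`), `β` (both), `γ` (none):
`ψ = ∑ α |s⟩|D ∪ x_b^y⟩ + ∑ β |s⟩|D ∪ {x₀^y, x₁^y}⟩ + ∑ γ |s⟩|D⟩`
over basis strings `s = (z,d,y,x,e,w)` and databases `D` without `x₀^y, x₁^y`. For a `y` without
pre-images no database contains one, and only the last sum remains. -/
def HasCoeffs (ψ : P.Basis → DB n → ℂ) (α : P.Basis → DB n → Bool → ℂ)
    (β γ : P.Basis → DB n → ℂ) : Prop :=
  ∀ s, ψ s = match cl (P.yReg s) with
    | none => ∑ D : DB n, γ s D • ket D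
    | some (x₀, x₁) => ∑ D ∈ avoiding x₀ x₁,
        ((α s D false • ketUnion D {x₀} + α s D true • ketUnion D {x₁}) +
          β s D • ketUnion D {x₀, x₁} + γ s D • ket D)

/-- The sum of `g s x₀^y x₁^y D` over all basis strings `s = (z,d,y,x,e,w)` for which `y` has
pre-images and over all databases `D` that contain neither. -/
def branchSum (g : P.Basis → Bits n → Bits n → DB n → ℝ) : ℝ :=
  ∑ s : P.Basis, match cl (P.yReg s) with
    | none => 0
    | some (x₀, x₁) => ∑ D ∈ avoiding x₀ x₁, g s x₀ x₁ D

/-- Weight on databases with both pre-images. -/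
def weightBoth (β : P.Basis → DB n → ℂ) : ℝ :=
  branchSum P cl fun s _ _ D => ‖β s D‖ ^ 2

/-- Weight on databases with exactly one pre-image. -/
def weightOne (α : P.Basis → DB n → Bool → ℂ) : ℝ :=
  branchSum P cl fun s _ _ D => ∑ b : Bool, ‖α s D b‖ ^ 2

/-- `∑ |α_0 - (-1)^{z + d·(x₀^y ⊕ x₁^y)} α_1|²`. -/
def misalignment (α : P.Basis → DB n → Bool → ℂ) : ℝ :=
  branchSum P cl fun s x₀ x₁ D =>
    ‖α s D false - sgn (eqnBit (s .z) (P.dReg s) x₀ x₁) * α s D true‖ ^ 2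

end Claim

end NTCFLemma

end

noncomputable section

namespace NTCFLemma

/-! ### The compressed oracle as a Fourier transform -/

/-! The compressed oracle is a Fourier transform of the ordinary one. The vectors `dbKer H`,
products over all points x of |⊥⟩ + (-1)^{H(x)}|-⟩, are orthogonal, of equal norm, and joint
eigenvectors of the compressed queries with the phases of H (`cpho_dbKer`); their average over H is
the empty database. So the compressed run is the transform `coef` of the family H ↦ P^H(k)
(`runCompressed_eq`), and `coef` is an isometry on the L² space of uniform H (`sum_norm_sq_coef`).
Each occupied point of its image is in the state |-⟩, which gives the form of the final state. For
fixed contents of the prover's registers, with f(H) the amplitude in P^H(k), the coefficients γ,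
α_b, β are the transforms of f, (-1)^{H(x_b)} f and (-1)^{H(x₀)+H(x₁)} f at databases avoiding both
pre-images.

Winning means H(x₀) ⊕ H(x₁) = c with c = z ⊕ d·(x₀ ⊕ x₁). Multiplication by 1 + (-1)^{c+H(x₀)+H(x₁)}
is twice the projection on this event, so twice the winning weight is the sum of |γ + (-1)^c β|² +
|α₀ + (-1)^c α₁|² (`branch_win`). If β vanished, total weight 1 and the parallelogram law would give
(iii) without error. A weight B of β costs ε + B/ε for every ε > 0, hence 2√B (`win_bound`,
`le_add_two_sqrt`). Then (ii) follows because the left side of (iii) is nonnegative.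

It remains to see that B is negligible. The weight of β is a mean square of mixed second differences
of the run in H(x₀) and H(x₁). Two nested hybrid arguments bound it by `hit` weights: the prover
queries one pre-image and then, with that value erased from the oracle, the other
(`sum_avg_norm_sq_le`). Measuring these two queries yields a claw. To do so without an oracle, note
that `hit` depends on H through functions of at most 4T values, T being the number of steps. Uniform
H can thus be replaced by a 4T-wise independent polynomial hash without changing the mean
(`polyHash_avg`), and the best coefficients are hardwired into the circuit. The hash is compiled to
three-qubit gates with uncomputation (`exists_claw_finder`), so claw-freeness applies
(`negligible_expBoth`). -/

@[simp] lemma sgn_false : sgn false = 1 := rfl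
@[simp] lemma sgn_true : sgn true = -1 := rfl

lemma sgn_mul_self (b : Bool) : sgn b * sgn b = 1 := by cases b <;> simp

@[simp] lemma norm_sgn (b : Bool) : ‖sgn b‖ = 1 := by cases b <;> simp

@[simp] lemma star_sgn (b : Bool) : (starRingEnd ℂ) (sgn b) = sgn b := by cases b <;> simp

lemma sqrtTwo_mul_self : ((Real.sqrt 2 : ℝ) : ℂ) * ((Real.sqrt 2 : ℝ) : ℂ) = 2 := by
  rw [← Complex.ofReal_mul, Real.mul_self_sqrt (by norm_num)]; norm_num

lemma sqrtTwo_sq : ((Real.sqrt 2 : ℝ) : ℂ) ^ 2 = 2 := by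
  rw [sq, sqrtTwo_mul_self]

lemma sqrtTwo_ne_zero : ((Real.sqrt 2 : ℝ) : ℂ) ≠ 0 := by
  intro h; have := sqrtTwo_mul_self; rw [h] at this; norm_num at this

/-- The vector `|⊥⟩ + (-1)^h |-⟩` of a single database point. -/
def siteKer (h : Bool) : Option Bool → ℂ
  | none => 1
  | some v => sgn h * sgn v / (Real.sqrt 2 : ℂ)

/-- The (unnormalised) database vector that corresponds to the function `H`. -/
def dbKer {n : ℕ} (H : Bits n → Bool) (D : DB n) : ℂ := ∏ x, siteKer (H x) (D x)

section Fourier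

variable {n : ℕ}

@[simp] lemma star_siteKer (h : Bool) (v : Option Bool) :
    (starRingEnd ℂ) (siteKer h v) = siteKer h v := by
  cases v <;> simp [siteKer]

@[simp] lemma star_dbKer (H : Bits n → Bool) (D : DB n) :
    (starRingEnd ℂ) (dbKer H D) = dbKer H D := by
  simp [dbKer]

/-- The product over all points but `x`. -/
def dbKerErase (x : Bits n) (H : Bits n → Bool) (D : DB n) : ℂ :=
  ∏ y ∈ Finset.univ.erase x, siteKer (H y) (D y)

lemma dbKer_eq_mul (x : Bits n) (H : Bits n → Bool) (D : DB n) :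
    dbKer H D = siteKer (H x) (D x) * dbKerErase x H D := by
  rw [dbKer, dbKerErase, Finset.mul_prod_erase _ (fun y => siteKer (H y) (D y)) (Finset.mem_univ x)]

@[simp] lemma dbKerErase_update_db (x : Bits n) (H : Bits n → Bool) (D : DB n) (v : Option Bool) :
    dbKerErase x H (Function.update D x v) = dbKerErase x H D := by
  refine Finset.prod_congr rfl fun y hy => ?_
  rw [Function.update_of_ne (Finset.ne_of_mem_erase hy)]

@[simp] lemma dbKerErase_update_fun (x : Bits n) (H : Bits n → Bool) (D : DB n) (v : Bool) :
    dbKerErase x (Function.update H x v) D = dbKerErase x H D := by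
  refine Finset.prod_congr rfl fun y hy => ?_
  rw [Function.update_of_ne (Finset.ne_of_mem_erase hy)]

lemma dbKer_update_db (x : Bits n) (H : Bits n → Bool) (D : DB n) (v : Option Bool) :
    dbKer H (Function.update D x v) = siteKer (H x) v * dbKerErase x H D := by
  simp [dbKer_eq_mul x]

lemma dbKer_update_fun (x : Bits n) (H : Bits n → Bool) (D : DB n) (a : Bool) :
    dbKer (Function.update H x a) D = siteKer a (D x) * dbKerErase x H D := by
  simp [dbKer_eq_mul x]

/-- On a product state the decompression at `x` touches only the factor at `x`. -/
lemma stdDecomp_site (x : Bits n) (g : Option Bool → ℂ) (r : DB n → ℂ)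
    (hr : ∀ D v, r (Function.update D x v) = r D) :
    stdDecomp x (fun D => g (D x) * r D) =
      fun D => (∑ v, decompMat (D x) v * g v) * r D := by
  funext D
  simp only [stdDecomp, hr, Finset.sum_mul, mul_assoc, Function.update_self]

/-- Decompression turns |⊥⟩ + (-1)^h|-⟩ into |+⟩ + (-1)^h|-⟩ = √2|h⟩, on which the query is the
scalar (-1)^{e·h}; the second decompression restores the vector. -/
lemma cpho_dbKer (x : Bits n) (e : Bool) (H : Bits n → Bool) :
    cpho x e (dbKer H) = sgn (e && H x) • dbKer H := by
  have h0 : dbKer H = fun D => siteKer (H x) (D x) * dbKerErase x H D :=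
    funext fun D => dbKer_eq_mul x H D
  have hr : ∀ (D : DB n) v, dbKerErase x H (Function.update D x v) = dbKerErase x H D := by simp
  unfold cpho
  rw [h0, stdDecomp_site x _ _ hr]
  have h1 : phaseDB x e (fun D => (∑ v, decompMat (D x) v * siteKer (H x) v) * dbKerErase x H D) =
      fun D => (fun u => sgn (e && u.getD false) *
        ∑ v, decompMat u v * siteKer (H x) v) (D x) * dbKerErase x H D := by
    funext D; simp [phaseDB, mul_assoc]
  rw [h1, stdDecomp_site x (fun u => sgn (e && u.getD false) *
    ∑ v, decompMat u v * siteKer (H x) v) _ hr]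
  funext D
  have h2 : ∀ u : Option Bool, (∑ v, decompMat u v * (sgn (e && v.getD false) *
      ∑ w, decompMat v w * siteKer (H x) w)) = sgn (e && H x) * siteKer (H x) u := by
    intro u
    have hs := sqrtTwo_ne_zero
    have hq := sqrtTwo_sq
    rcases u with _ | u <;> cases e <;> cases H x <;> try cases u
    all_goals
      simp [Fintype.sum_option, decompMat, siteKer]
      try field_simp
      try simp only [hq]
      try ring_nf
      try simp only [hq]
      try norm_num
  simp only [h2, Pi.smul_apply, smul_eq_mul, mul_assoc]

/-- At every point the two signs of |-⟩ cancel and |⊥⟩ survives with factor 2. -/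
lemma sum_dbKer (D : DB n) :
    ∑ H, dbKer H D = (Fintype.card (Bits n → Bool) : ℂ) * ket (fun _ => none) D := by
  have h1 : ∑ H : Bits n → Bool, dbKer H D = ∏ x, ∑ h, siteKer h (D x) := by
    rw [Finset.prod_univ_sum, Fintype.piFinset_univ]; rfl
  have h2 : ∀ v, ∑ h, siteKer h v = if v = none then 2 else 0 := by
    rintro (_ | v) <;> simp [siteKer] <;> ring
  rw [h1]; simp only [h2]
  by_cases h : D = fun _ => none
  · subst h; simp [ket]
  · obtain ⟨x, hx⟩ := Function.ne_iff.1 h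
    rw [Finset.prod_eq_zero (Finset.mem_univ x) (by simp [hx])]
    simp [ket, h]

lemma sum_dbKer_mul (H H' : Bits n → Bool) :
    ∑ D, dbKer H D * dbKer H' D = if H = H' then (Fintype.card (Bits n → Bool) : ℂ) else 0 := by
  have h1 : ∑ D : DB n, dbKer H D * dbKer H' D =
      ∏ x, ∑ v, siteKer (H x) v * siteKer (H' x) v := by
    rw [Finset.prod_univ_sum, Fintype.piFinset_univ]; simp [dbKer, Finset.prod_mul_distrib]
  have h2 : ∀ a b, ∑ v, siteKer a v * siteKer b v = if a = b then 2 else 0 := by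
    have hs := sqrtTwo_ne_zero
    have hq := sqrtTwo_sq
    intro a b
    cases a <;> cases b <;> simp [Fintype.sum_option, siteKer] <;> field_simp <;> rw [hq] <;>
      norm_num
  rw [h1]; simp only [h2]
  by_cases h : H = H'
  · subst h; simp
  · obtain ⟨x, hx⟩ := Function.ne_iff.1 h
    rw [Finset.prod_eq_zero (Finset.mem_univ x) (by simp [hx])]
    simp [h]

/-- The amplitudes of the database state that represents a function of the oracle. -/
def coef (f : (Bits n → Bool) → ℂ) (D : DB n) : ℂ :=
  (∑ H, f H * dbKer H D) / (Fintype.card (Bits n → Bool) : ℂ)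

lemma coef_add (f g : (Bits n → Bool) → ℂ) (D : DB n) :
    coef (fun H => f H + g H) D = coef f D + coef g D := by
  simp [coef, add_mul, Finset.sum_add_distrib, add_div]

lemma coef_smul (c : ℂ) (f : (Bits n → Bool) → ℂ) (D : DB n) :
    coef (fun H => c * f H) D = c * coef f D := by
  simp [coef, mul_assoc, ← Finset.mul_sum, mul_div_assoc]

/-- Parseval: the vectors `dbKer H` are orthogonal with squared norm equal to the number of
functions. -/
lemma sum_norm_sq_coef (f : (Bits n → Bool) → ℂ) :
    ∑ D, ‖coef f D‖ ^ 2 = (∑ H, ‖f H‖ ^ 2) / (Fintype.card (Bits n → Bool) : ℝ) := by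
  set M := Fintype.card (Bits n → Bool) with hM
  have hM0 : (M : ℂ) ≠ 0 := by exact_mod_cast Fintype.card_ne_zero
  apply Complex.ofReal_injective
  push_cast
  simp only [← Complex.mul_conj']
  have h1 : ∀ D, coef f D * (starRingEnd ℂ) (coef f D) =
      (∑ H, ∑ H', (f H * (starRingEnd ℂ) (f H')) * (dbKer H D * dbKer H' D)) / (M * M) := by
    intro D
    rw [coef, map_div₀, div_mul_div_comm, map_sum, Finset.sum_mul_sum]
    simp only [map_mul, star_dbKer, map_natCast]
    congr 1
    refine Finset.sum_congr rfl fun H _ => Finset.sum_congr rfl fun H' _ => by ring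
  simp only [h1, ← Finset.sum_div]
  rw [Finset.sum_comm]
  have h2 : ∀ H, (∑ D, ∑ H', (f H * (starRingEnd ℂ) (f H')) * (dbKer H D * dbKer H' D)) =
      (f H * (starRingEnd ℂ) (f H)) * M := by
    intro H
    rw [Finset.sum_comm]
    simp only [← Finset.mul_sum, sum_dbKer_mul]
    simp [hM]
  simp only [h2, ← Finset.sum_mul]
  field_simp

/-! ### Averaging over the values of an oracle at one or two points -/

lemma sum_update {A E : Type*} [Fintype A] [DecidableEq A] [AddCommMonoid E] (x : A)
    (g : (A → Bool) → E) : ∑ H, ∑ a, g (Function.update H x a) = 2 • ∑ H, g H := by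
  have : ∑ p : (A → Bool) × Bool, g (Function.update p.1 x p.2) =
      ∑ p : (A → Bool) × Bool, g p.1 := by
    refine Finset.sum_bij' (fun p _ => (Function.update p.1 x p.2, p.1 x))
      (fun p _ => (Function.update p.1 x p.2, p.1 x)) ?_ ?_ ?_ ?_ ?_ <;> simp
  rw [Fintype.sum_prod_type, Fintype.sum_prod_type] at this
  rw [this]; simp [Finset.smul_sum]

/-- `H` with its values at `x₀` and `x₁` replaced by `a` and `b`. -/
def set2 (x₀ x₁ : Bits n) (H : Bits n → Bool) (a b : Bool) : Bits n → Bool :=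
  Function.update (Function.update H x₀ a) x₁ b

lemma sum_set2 {E : Type*} [AddCommMonoid E] (x₀ x₁ : Bits n)
    (g : (Bits n → Bool) → E) : ∑ H, ∑ a, ∑ b, g (set2 x₀ x₁ H a b) = 4 • ∑ H, g H := by
  unfold set2
  rw [sum_update x₀ (fun H => ∑ b, g (Function.update H x₁ b)), sum_update x₁, smul_smul]; rfl

lemma set2_left {x₀ x₁ : Bits n} (h : x₀ ≠ x₁) (H : Bits n → Bool) (a b : Bool) :
    set2 x₀ x₁ H a b x₀ = a := by simp [set2, h]

lemma set2_right (x₀ x₁ : Bits n) (H : Bits n → Bool) (a b : Bool) :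
    set2 x₀ x₁ H a b x₁ = b := by simp [set2]

/-- The average over the values at two points. -/
def orbitAvg (x₀ x₁ : Bits n) (f : (Bits n → Bool) → ℂ) (H : Bits n → Bool) : ℂ :=
  (∑ a, ∑ b, f (set2 x₀ x₁ H a b)) / 4

lemma dbKer_set2_of_avoiding {x₀ x₁ : Bits n} {D : DB n} (hD : D ∈ avoiding x₀ x₁)
    (H : Bits n → Bool) (a b : Bool) : dbKer (set2 x₀ x₁ H a b) D = dbKer H D := by
  simp only [avoiding, Finset.mem_filter, Finset.mem_univ, true_and] at hD
  have key : ∀ (H : Bits n → Bool) (x : Bits n) (a : Bool), D x = none →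
      dbKer (Function.update H x a) D = dbKer H D := by
    intro H x a hx
    rw [dbKer_update_fun, dbKer_eq_mul x H, hx]; rfl
  rw [set2, key _ _ _ hD.2, key _ _ _ hD.1]

lemma coef_orbitAvg_of_avoiding {x₀ x₁ : Bits n} {D : DB n} (hD : D ∈ avoiding x₀ x₁)
    (f : (Bits n → Bool) → ℂ) : coef (orbitAvg x₀ x₁ f) D = coef f D := by
  have h := sum_set2 x₀ x₁ (fun H => f H * dbKer H D)
  simp only [dbKer_set2_of_avoiding hD, ← Finset.sum_mul] at h
  unfold coef orbitAvg
  congr 1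
  simp only [div_mul_eq_mul_div]
  rw [← Finset.sum_div, h]; simp

/-- An occupied point contributes the sign (-1)^{H(x)}, which sums to zero over the value at `x`
when `f` ignores that value. -/
lemma coef_eq_zero_of_invariant {x : Bits n} {f : (Bits n → Bool) → ℂ}
    (hf : ∀ H a, f (Function.update H x a) = f H) {D : DB n} (hD : D x ≠ none) :
    coef f D = 0 := by
  have h := sum_update x (fun H => f H * dbKer H D)
  obtain ⟨v, hv⟩ := Option.ne_none_iff_exists'.1 hD
  simp only [hf, dbKer_update_fun, hv] at h
  have h0 : ∀ H, ∑ a, f H * (siteKer a (some v) * dbKerErase x H D) = 0 := by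
    intro H; simp [siteKer]; ring
  simp only [h0, Finset.sum_const_zero] at h
  have : ∑ H, f H * dbKer H D = 0 := by
    have h2 : (0 : ℂ) = 2 * ∑ H, f H * dbKer H D := by simpa using h
    simpa using h2.symm
  simp [coef, this]

lemma coef_orbitAvg_of_not_avoiding {x₀ x₁ : Bits n} {D : DB n}
    (hD : D ∉ avoiding x₀ x₁) (f : (Bits n → Bool) → ℂ) : coef (orbitAvg x₀ x₁ f) D = 0 := by
  by_cases hne : x₀ = x₁
  · subst hne
    refine coef_eq_zero_of_invariant (x := x₀) (fun H a => ?_) (D := D) ?_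
    · simp [orbitAvg, set2]
    · simpa [avoiding] using hD
  by_cases h0 : D x₀ = none
  · refine coef_eq_zero_of_invariant (x := x₁) (fun H a => ?_) (D := D) ?_
    · simp [orbitAvg, set2, Function.update_comm hne]
    · simpa [avoiding, h0] using hD
  · refine coef_eq_zero_of_invariant (x := x₀) (fun H a => ?_) (D := D) h0
    simp [orbitAvg, set2]

/-- Averaging over the values at the two points is, on the transform side, restriction to databases
that contain neither; Parseval for the average then gives the weight of that part. -/
theorem sum_avoiding_norm_sq_coef (x₀ x₁ : Bits n)
    (f : (Bits n → Bool) → ℂ) :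
    ∑ D ∈ avoiding x₀ x₁, ‖coef f D‖ ^ 2 =
      (∑ H, ‖orbitAvg x₀ x₁ f H‖ ^ 2) / (Fintype.card (Bits n → Bool) : ℝ) := by
  rw [← sum_norm_sq_coef, ← Finset.sum_subset (Finset.subset_univ (avoiding x₀ x₁))]
  · refine Finset.sum_congr rfl fun D hD => by rw [coef_orbitAvg_of_avoiding hD]
  · intro D _ hD; simp [coef_orbitAvg_of_not_avoiding hD]

end Fourier

/-! ### Runs of a prover -/

section Evolve

variable {n m κ a : ℕ} {V W : Type} [AddCommMonoid V] [Module ℂ V] [AddCommMonoid W] [Module ℂ W]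

/-- The action of one step on the state of the prover, with a given action of a query. -/
def stepAct (q : Bits n → Bool → V → V) :
    Step (PWire n m κ a) → ((PWire n m κ a → Bool) → V) → (PWire n m κ a → Bool) → V
  | .gate g, ψ => g.apply ψ
  | .query, ψ => fun s => q (fun i => s (.x i)) (s .e) (ψ s)

/-- The action of a list of steps. -/
def evolve (q : Bits n → Bool → V → V) (L : List (Step (PWire n m κ a)))
    (ψ : (PWire n m κ a → Bool) → V) : (PWire n m κ a → Bool) → V :=
  L.foldl (fun ψ st => stepAct q st ψ) ψ

lemma runWith_eq_evolve (P : Prover n m κ) (q : Bits n → Bool → V → V) (k : Bits κ) (v : V) :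
    P.runWith q k v = evolve q P.steps (Pi.single (P.startBasis k) v) := by
  unfold Prover.runWith evolve
  congr 1
  funext ψ st
  cases st <;> rfl

@[simp] lemma evolve_nil (q : Bits n → Bool → V → V) (ψ : (PWire n m κ a → Bool) → V) :
    evolve q [] ψ = ψ := rfl

@[simp] lemma evolve_cons (q : Bits n → Bool → V → V) (st : Step (PWire n m κ a))
    (L : List (Step (PWire n m κ a))) (ψ : (PWire n m κ a → Bool) → V) :
    evolve q (st :: L) ψ = evolve q L (stepAct q st ψ) := rfl

lemma evolve_append (q : Bits n → Bool → V → V) (L L' : List (Step (PWire n m κ a)))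
    (ψ : (PWire n m κ a → Bool) → V) :
    evolve q (L ++ L') ψ = evolve q L' (evolve q L ψ) := by
  simp [evolve, List.foldl_append]

lemma Gate.apply_map {ι : Type} (g : Gate ι) (T : V →ₗ[ℂ] W) (ψ : (ι → Bool) → V) :
    g.apply (fun s => T (ψ s)) = fun s => T (g.apply ψ s) := by
  funext s; simp [Gate.apply]

/-- Gates act linearly and do not see the attached register, so a linear map intertwining the query
actions intertwines whole runs. -/
lemma evolve_map (q : Bits n → Bool → V → V) (q' : Bits n → Bool → W → W) (T : V →ₗ[ℂ] W)
    (hT : ∀ x e v, q' x e (T v) = T (q x e v)) (L : List (Step (PWire n m κ a)))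
    (ψ : (PWire n m κ a → Bool) → V) :
    evolve q' L (fun s => T (ψ s)) = fun s => T (evolve q L ψ s) := by
  induction L generalizing ψ with
  | nil => rfl
  | cons st L ih =>
    rw [evolve_cons, evolve_cons, ← ih]
    congr 1
    cases st with
    | gate g => exact g.apply_map T ψ
    | query => funext s; exact hT _ _ _

end Evolve

/-! ### The compressed run as the transform of the phase-oracle runs. -/

section Linear

variable {n : ℕ} {ι : Type*} [Fintype ι]

lemma stdDecomp_sum (x : Bits n) (c : ι → ℂ) (φ : ι → DB n → ℂ) :
    stdDecomp x (∑ i, c i • φ i) = ∑ i, c i • stdDecomp x (φ i) := by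
  funext D
  simp only [stdDecomp, Finset.sum_apply, Pi.smul_apply, smul_eq_mul, Finset.mul_sum]
  rw [Finset.sum_comm]
  exact Finset.sum_congr rfl fun i _ => Finset.sum_congr rfl fun v _ => by ring

lemma phaseDB_sum (x : Bits n) (e : Bool) (c : ι → ℂ) (φ : ι → DB n → ℂ) :
    phaseDB x e (∑ i, c i • φ i) = ∑ i, c i • phaseDB x e (φ i) := by
  funext D
  simp only [phaseDB, Finset.sum_apply, Pi.smul_apply, smul_eq_mul, Finset.mul_sum]
  exact Finset.sum_congr rfl fun i _ => by ring

lemma cpho_sum (x : Bits n) (e : Bool) (c : ι → ℂ) (φ : ι → DB n → ℂ) :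
    cpho x e (∑ i, c i • φ i) = ∑ i, c i • cpho x e (φ i) := by
  simp only [cpho, stdDecomp_sum, phaseDB_sum]

lemma coef_eq_sum (f : (Bits n → Bool) → ℂ) :
    coef f = ∑ H, (f H / (Fintype.card (Bits n → Bool) : ℂ)) • dbKer H := by
  funext D
  simp [coef, Finset.sum_div, div_mul_eq_mul_div]

lemma cpho_coef (x : Bits n) (e : Bool) (f : (Bits n → Bool) → ℂ) :
    cpho x e (coef f) = coef fun H => sgn (e && H x) * f H := by
  rw [coef_eq_sum, coef_eq_sum, cpho_sum]
  refine Finset.sum_congr rfl fun H _ => ?_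
  rw [cpho_dbKer, smul_smul]; congr 1; ring

lemma coef_one : coef (fun _ => 1) = ket (n := n) fun _ => none := by
  funext D
  have hM0 : (Fintype.card (Bits n → Bool) : ℂ) ≠ 0 := by exact_mod_cast Fintype.card_ne_zero
  simp only [coef, one_mul, sum_dbKer]
  field_simp

/-- `coef` as a linear map. -/
def coefLin (n : ℕ) : ((Bits n → Bool) → ℂ) →ₗ[ℂ] (DB n → ℂ) where
  toFun := coef
  map_add' f g := by funext D; exact coef_add f g D
  map_smul' c f := by funext D; exact coef_smul c f D

/-- Both runs are images of one run `q` whose attached register is the space of functions of H: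
`coefLin` carries it to the compressed run, evaluation at H to the phase run. -/
theorem runCompressed_eq {m κ : ℕ} (P : Prover n m κ) (k : Bits κ) (s : P.Basis) :
    P.runCompressed k s = coef fun H => P.runPhase H k s := by
  let q : Bits n → Bool → ((Bits n → Bool) → ℂ) → (Bits n → Bool) → ℂ :=
    fun x e f H => sgn (e && H x) * f H
  let ψ : P.Basis → (Bits n → Bool) → ℂ := Pi.single (P.startBasis k) fun _ => 1
  have h1 : P.runCompressed k = fun s => coefLin n (evolve q P.steps ψ s) := by
    rw [Prover.runCompressed, runWith_eq_evolve,
      ← evolve_map q cpho (coefLin n) (fun x e v => cpho_coef x e v)]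
    congr 1
    funext s
    rcases eq_or_ne s (P.startBasis k) with rfl | hs
    · simpa [ψ, coefLin] using coef_one.symm
    · simp [ψ, hs]
  have h2 : ∀ H, P.runPhase H k = fun s => evolve q P.steps ψ s H := by
    intro H
    have := evolve_map q (fun x e c => sgn (e && H x) * c)
      (LinearMap.proj (R := ℂ) (φ := fun _ : Bits n → Bool => ℂ) H) (fun x e v => rfl) P.steps ψ
    rw [Prover.runPhase, runWith_eq_evolve]
    simp only [LinearMap.proj_apply] at this
    rw [← this]
    congr 1
    funext s
    rcases eq_or_ne s (P.startBasis k) with rfl | hs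
    · simp [ψ]
    · simp [ψ, hs]
  rw [h1]
  simp only [h2]
  rfl

end Linear

/-! ### Coefficients with respect to two points -/

section Coeffs

variable {n : ℕ}

lemma ketUnion_apply (D : DB n) (S : Finset (Bits n)) (E : DB n) :
    ketUnion D S E = if (∀ x, x ∉ S → E x = D x) ∧ ∀ x ∈ S, E x ≠ none then
      ∏ x ∈ S, sgn ((E x).getD false) / (Real.sqrt 2 : ℂ) else 0 := by
  classical
  simp only [ketUnion, ket, Finset.sum_apply, Pi.smul_apply, smul_eq_mul]
  split_ifs with h
  · rw [Finset.sum_eq_single (fun x : S => (E x).getD false)]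
    · have : E = fun x => if h : x ∈ S then some ((E x).getD false) else D x := by
        funext x
        by_cases hx : x ∈ S
        · obtain ⟨v, hv⟩ := Option.ne_none_iff_exists'.1 (h.2 x hx)
          simp [hx, hv]
        · simp [hx, h.1 x hx]
      rw [← this, Pi.single_eq_same, mul_one,
        Finset.prod_coe_sort S fun x => sgn ((E x).getD false) / (Real.sqrt 2 : ℂ)]
    · intro w _ hw
      rw [Pi.single_eq_of_ne, mul_zero]
      rintro rfl
      exact hw (by funext x; simp)
    · simp
  · refine Finset.sum_eq_zero fun w _ => ?_
    rw [Pi.single_eq_of_ne, mul_zero]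
    rintro rfl
    exact h ⟨fun x hx => by simp [hx], fun x hx => by simp [hx]⟩

/-- The database `E` with the points `x₀` and `x₁` deleted. -/
def clear2 (x₀ x₁ : Bits n) (E : DB n) : DB n :=
  Function.update (Function.update E x₀ none) x₁ none

lemma clear2_mem (x₀ x₁ : Bits n) (E : DB n) : clear2 x₀ x₁ E ∈ avoiding x₀ x₁ := by
  simp [avoiding, clear2, Function.update_apply]

/-- The right hand side of the decomposition, evaluated at a database. -/
lemma decomposition_apply {x₀ x₁ : Bits n} (hne : x₀ ≠ x₁) (α : DB n → Bool → ℂ) (β γ : DB n → ℂ)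
    (E : DB n) :
    (∑ D ∈ avoiding x₀ x₁,
        ((α D false • ketUnion D {x₀} + α D true • ketUnion D {x₁}) +
          β D • ketUnion D {x₀, x₁} + γ D • ket D)) E =
      match E x₀, E x₁ with
      | none, none => γ (clear2 x₀ x₁ E)
      | some v, none => α (clear2 x₀ x₁ E) false * (sgn v / (Real.sqrt 2 : ℂ))
      | none, some w => α (clear2 x₀ x₁ E) true * (sgn w / (Real.sqrt 2 : ℂ))
      | some v, some w => β (clear2 x₀ x₁ E) * (sgn v / (Real.sqrt 2 : ℂ) * (sgn w / (Real.sqrt 2 : ℂ))) := by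
  have hD : ∀ D ∈ avoiding x₀ x₁, (∀ y, y ≠ x₀ → y ≠ x₁ → E y = D y) → D = clear2 x₀ x₁ E := by
    intro D hD h
    simp only [avoiding, Finset.mem_filter, Finset.mem_univ, true_and] at hD
    funext y
    rcases eq_or_ne y x₁ with rfl | h1
    · simp [clear2, hD.2]
    rcases eq_or_ne y x₀ with rfl | h0
    · simp [clear2, h1, hD.1]
    simp [clear2, h0, h1, (h y h0 h1).symm]
  -- Every ket in the sum agrees with its `D` away from the two points, so only `E` with these
  -- points cleared can contribute.
  rw [Finset.sum_apply, Finset.sum_eq_single (clear2 x₀ x₁ E)]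
  · have k1 : (∀ y, y ∉ ({x₀} : Finset (Bits n)) → E y = clear2 x₀ x₁ E y) ↔ E x₁ = none := by
      refine ⟨fun h => by simpa [clear2] using h x₁ (by simpa using hne.symm), fun h y hy => ?_⟩
      rcases eq_or_ne y x₁ with rfl | h1
      · simp [clear2, h]
      simp only [Finset.mem_singleton] at hy
      simp [clear2, hy, h1]
    have k2 : (∀ y, y ∉ ({x₁} : Finset (Bits n)) → E y = clear2 x₀ x₁ E y) ↔ E x₀ = none := by
      refine ⟨fun h => by simpa [clear2, hne] using h x₀ (by simpa using hne), fun h y hy => ?_⟩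
      simp only [Finset.mem_singleton] at hy
      rcases eq_or_ne y x₀ with rfl | h1
      · simp [clear2, h, hne]
      simp [clear2, hy, h1]
    have k3 : (∀ y, y ∉ ({x₀, x₁} : Finset (Bits n)) → E y = clear2 x₀ x₁ E y) := by
      intro y hy
      simp only [Finset.mem_insert, Finset.mem_singleton, not_or] at hy
      simp [clear2, hy.1, hy.2]
    have k4 : E = clear2 x₀ x₁ E ↔ E x₀ = none ∧ E x₁ = none := by
      constructor
      · intro h; rw [h]; simp [clear2, hne]
      · rintro ⟨h0, h1⟩
        funext y
        rcases eq_or_ne y x₁ with rfl | h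
        · simp [clear2, h1]
        rcases eq_or_ne y x₀ with rfl | h'
        · simp [clear2, h, h0]
        simp [clear2, h, h']
    simp only [Pi.add_apply, Pi.smul_apply, smul_eq_mul, ketUnion_apply, k1, k2,
      iff_true_intro k3, ket, Pi.single_apply, k4, Finset.prod_pair hne, Finset.prod_singleton]
    simp only [Finset.mem_singleton, Finset.mem_insert, forall_eq, forall_eq_or_imp]
    rcases h0 : E x₀ with _ | v <;> rcases h1 : E x₁ with _ | w <;> simp
  · intro D hDm hne'
    have key := fun h => hne' (hD D hDm h)
    simp only [Pi.add_apply, Pi.smul_apply, smul_eq_mul, ketUnion_apply]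
    rw [if_neg, if_neg, if_neg, ket, Pi.single_eq_of_ne]
    · simp
    · rintro rfl; exact key fun y _ _ => rfl
    · rintro ⟨h, -⟩; exact key fun y h0 h1 => h y (by simp [h0, h1])
    · rintro ⟨h, -⟩; exact key fun y h0 h1 => h y (by simp [h1])
    · rintro ⟨h, -⟩; exact key fun y h0 h1 => h y (by simp [h0])
  · intro h; exact absurd (clear2_mem x₀ x₁ E) h

/-- The coefficients of `coef f` with respect to `x₀` and `x₁`. -/
def coefOne (x₀ x₁ : Bits n) (f : (Bits n → Bool) → ℂ) (D : DB n) (b : Bool) : ℂ :=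
  coef (fun H => sgn (H (bif b then x₁ else x₀)) * f H) D

def coefBoth (x₀ x₁ : Bits n) (f : (Bits n → Bool) → ℂ) (D : DB n) : ℂ :=
  coef (fun H => sgn (H x₀) * sgn (H x₁) * f H) D

lemma dbKer_clear2 {x₀ x₁ : Bits n} (hne : x₀ ≠ x₁) (H : Bits n → Bool) (E : DB n) :
    dbKer H E = siteKer (H x₀) (E x₀) * siteKer (H x₁) (E x₁) * dbKer H (clear2 x₀ x₁ E) := by
  rw [clear2, dbKer_update_db, dbKer_eq_mul x₁ H E]
  have : dbKerErase x₁ H E = siteKer (H x₀) (E x₀) *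
      ∏ y ∈ (Finset.univ.erase x₁).erase x₀, siteKer (H y) (E y) := by
    rw [dbKerErase, Finset.mul_prod_erase _ (fun y => siteKer (H y) (E y))]
    simpa using hne
  have h2 : dbKerErase x₁ H (Function.update E x₀ none) =
      ∏ y ∈ (Finset.univ.erase x₁).erase x₀, siteKer (H y) (E y) := by
    rw [dbKerErase, ← Finset.mul_prod_erase _ _ (show x₀ ∈ Finset.univ.erase x₁ by simpa using hne)]
    simp only [Function.update_self, siteKer, one_mul]
    refine Finset.prod_congr rfl fun y hy => ?_
    rw [Function.update_of_ne (Finset.ne_of_mem_erase hy)]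
  rw [this, h2]
  simp only [siteKer, one_mul]
  ring

/-- The factors of `dbKer H E` at the two points split off; each occupied one supplies a sign
(-1)^{H(x_b)}, absorbed into `f`, and an amplitude of |-⟩. -/
lemma coef_apply {x₀ x₁ : Bits n} (hne : x₀ ≠ x₁) (f : (Bits n → Bool) → ℂ) (E : DB n) :
    coef f E = match E x₀, E x₁ with
      | none, none => coef f (clear2 x₀ x₁ E)
      | some v, none => coefOne x₀ x₁ f (clear2 x₀ x₁ E) false * (sgn v / (Real.sqrt 2 : ℂ))
      | none, some w => coefOne x₀ x₁ f (clear2 x₀ x₁ E) true * (sgn w / (Real.sqrt 2 : ℂ))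
      | some v, some w => coefBoth x₀ x₁ f (clear2 x₀ x₁ E) *
          (sgn v / (Real.sqrt 2 : ℂ) * (sgn w / (Real.sqrt 2 : ℂ))) := by
  have h0 : coef f E = (∑ H, f H * (siteKer (H x₀) (E x₀) * siteKer (H x₁) (E x₁) *
      dbKer H (clear2 x₀ x₁ E))) / (Fintype.card (Bits n → Bool) : ℂ) := by
    rw [coef]; congr 1
    exact Finset.sum_congr rfl fun H _ => by rw [← dbKer_clear2 hne]
  rw [h0]
  rcases h0 : E x₀ with _ | v <;> rcases h1 : E x₁ with _ | w <;>
    simp only [siteKer, coefOne, coefBoth, coef, cond_true, cond_false, one_mul, mul_one]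
  all_goals
    rw [div_mul_eq_mul_div, Finset.sum_mul]
    congr 1
    exact Finset.sum_congr rfl fun H _ => by ring

lemma coef_eq_decomposition {x₀ x₁ : Bits n} (hne : x₀ ≠ x₁) (f : (Bits n → Bool) → ℂ) :
    coef f = ∑ D ∈ avoiding x₀ x₁,
        ((coefOne x₀ x₁ f D false • ketUnion D {x₀} + coefOne x₀ x₁ f D true • ketUnion D {x₁}) +
          coefBoth x₀ x₁ f D • ketUnion D {x₀, x₁} + coef f D • ket D) := by
  funext E
  rw [decomposition_apply hne, coef_apply hne]

/-- Each coefficient is read off, up to a nonzero factor, from one amplitude: insert the value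
`false` at the points concerned. -/
lemma decomposition_unique {x₀ x₁ : Bits n} (hne : x₀ ≠ x₁) (f : (Bits n → Bool) → ℂ)
    (α : DB n → Bool → ℂ) (β γ : DB n → ℂ)
    (h : coef f = ∑ D ∈ avoiding x₀ x₁,
        ((α D false • ketUnion D {x₀} + α D true • ketUnion D {x₁}) +
          β D • ketUnion D {x₀, x₁} + γ D • ket D)) (D : DB n) (hD : D ∈ avoiding x₀ x₁) :
    (∀ b, α D b = coefOne x₀ x₁ f D b) ∧ β D = coefBoth x₀ x₁ f D := by
  have hs := sqrtTwo_ne_zero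
  simp only [avoiding, Finset.mem_filter, Finset.mem_univ, true_and] at hD
  have hE : ∀ u v, clear2 x₀ x₁ (Function.update (Function.update D x₀ u) x₁ v) = D := by
    intro u v
    have e0 : Function.update D x₀ none = D := by rw [← hD.1, Function.update_eq_self]
    have e1 : Function.update D x₁ none = D := by rw [← hD.2, Function.update_eq_self]
    unfold clear2
    rw [Function.update_comm (β := fun _ => Option Bool) hne.symm v none, Function.update_idem,
      Function.update_idem, e0, e1]
  have key := fun u v => congrFun h (Function.update (Function.update D x₀ u) x₁ v)
  have k0 : ∀ u v, Function.update (Function.update D x₀ u) x₁ v x₀ = u := by simp [hne]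
  have k1 : ∀ u v, Function.update (Function.update D x₀ u) x₁ v x₁ = v := by simp
  have key := fun u v => ((coef_apply hne f _).symm.trans (key u v)).trans
    (decomposition_apply hne α β γ _)
  simp only [hE, k0, k1] at key
  refine ⟨fun b => ?_, ?_⟩
  · cases b
    · have := key (some false) none
      simpa [hs] using this.symm
    · have := key none (some false)
      simpa [hs] using this.symm
  · have := key (some false) (some false)
    simpa [hs] using this.symm

end Coeffs

/-! ### Norm preservation -/

section Norm

lemma extend_extend {ι : Type} {r : ℕ} (w : Fin r ↪ ι) (u v : Bits r) (s : ι → Bool) :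
    Function.extend w u (Function.extend w v s) = Function.extend w u s := by
  classical
  funext i
  by_cases h : ∃ j, w j = i
  · obtain ⟨j, rfl⟩ := h; simp [w.injective.extend_apply]
  · simp [Function.extend_apply' _ _ _ h]

lemma extend_comp {ι : Type} {r : ℕ} (w : Fin r ↪ ι) (u : Bits r) (s : ι → Bool) :
    Function.extend w u s ∘ w = u := by
  funext j; simp [w.injective.extend_apply]

lemma extend_self {ι : Type} {r : ℕ} (w : Fin r ↪ ι) (s : ι → Bool) :
    Function.extend w (s ∘ w) s = s := by
  funext i
  by_cases h : ∃ j, w j = i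
  · obtain ⟨j, rfl⟩ := h; simp [w.injective.extend_apply]
  · simp [Function.extend_apply' _ _ _ h]

/-- Exchanging the contents of the wires `w` with the independent string `v` is an involution. After
this reindexing a gate is, for each fixed `s`, one matrix-vector product. -/
lemma sum_extend {ι E : Type} [Fintype ι] [DecidableEq ι] [AddCommMonoid E] {r : ℕ}
    (w : Fin r ↪ ι) (g : (ι → Bool) → Bits r → E) :
    ∑ s, ∑ v, g s v = ∑ s, ∑ v, g (Function.extend w v s) (s ∘ w) := by
  rw [← Fintype.sum_prod_type', ← Fintype.sum_prod_type']
  refine Finset.sum_bij' (fun p _ => (Function.extend w p.2 p.1, p.1 ∘ w))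
      (fun p _ => (Function.extend w p.2 p.1, p.1 ∘ w)) ?_ ?_ ?_ ?_ ?_ <;>
    simp [extend_extend, extend_comp, extend_self]

lemma unitary_norm_sq {r : ℕ} (U : Matrix.unitaryGroup (Bits r) ℂ) (x : Bits r → ℂ) :
    ∑ v, ‖∑ u, (U : Matrix (Bits r) (Bits r) ℂ) v u * x u‖ ^ 2 = ∑ u, ‖x u‖ ^ 2 := by
  have h : ∀ y : Bits r → ℂ, ((∑ u, ‖y u‖ ^ 2 : ℝ) : ℂ) = star y ⬝ᵥ y := by
    intro y
    simp [dotProduct, ← Complex.conj_mul']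
  apply Complex.ofReal_injective
  have h1 := h ((U : Matrix (Bits r) (Bits r) ℂ).mulVec x)
  rw [Matrix.star_mulVec, Matrix.dotProduct_mulVec, Matrix.vecMul_vecMul] at h1
  have hU : (U : Matrix (Bits r) (Bits r) ℂ).conjTranspose * (U : Matrix (Bits r) (Bits r) ℂ) = 1 :=
    Matrix.mem_unitaryGroup_iff'.1 U.2
  rw [hU, Matrix.vecMul_one, ← h] at h1
  exact h1

lemma Gate.norm_sq_apply {ι : Type} [Fintype ι] [DecidableEq ι] (g : Gate ι)
    (ψ : (ι → Bool) → ℂ) : ∑ s, ‖g.apply ψ s‖ ^ 2 = ∑ s, ‖ψ s‖ ^ 2 := by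
  have hc : (0 : ℝ) < Fintype.card (Bits g.arity) := by exact_mod_cast Fintype.card_pos
  have h1 : ∑ s : ι → Bool, ∑ _v : Bits g.arity, ‖g.apply ψ s‖ ^ 2 =
      ∑ s : ι → Bool, ∑ _v : Bits g.arity, ‖ψ s‖ ^ 2 := by
    rw [sum_extend g.wires]
    conv_rhs => rw [sum_extend g.wires]
    refine Finset.sum_congr rfl fun s _ => ?_
    simp only [Gate.apply, extend_comp, extend_extend, smul_eq_mul]
    exact unitary_norm_sq g.mat fun u => ψ (Function.extend g.wires u s)
  simp only [Finset.sum_const, nsmul_eq_mul, ← Finset.mul_sum] at h1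
  exact mul_left_cancel₀ (by simp) h1

variable {n m κ a : ℕ}

/-- The action of a phase query. -/
def phaseAct (H : Bits n → Bool) (x : Bits n) (e : Bool) (c : ℂ) : ℂ := sgn (e && H x) * c

lemma stepAct_norm_sq (H : Bits n → Bool) (st : Step (PWire n m κ a))
    (ψ : (PWire n m κ a → Bool) → ℂ) :
    ∑ s, ‖stepAct (phaseAct H) st ψ s‖ ^ 2 = ∑ s, ‖ψ s‖ ^ 2 := by
  cases st with
  | gate g => exact g.norm_sq_apply ψ
  | query => simp [stepAct, phaseAct]

lemma evolve_norm_sq (H : Bits n → Bool) (L : List (Step (PWire n m κ a)))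
    (ψ : (PWire n m κ a → Bool) → ℂ) :
    ∑ s, ‖evolve (phaseAct H) L ψ s‖ ^ 2 = ∑ s, ‖ψ s‖ ^ 2 := by
  induction L generalizing ψ with
  | nil => rfl
  | cons st L ih => rw [evolve_cons, ih, stepAct_norm_sq]

lemma runPhase_eq_evolve (P : Prover n m κ) (H : Bits n → Bool) (k : Bits κ) :
    P.runPhase H k = evolve (phaseAct H) P.steps (Pi.single (P.startBasis k) 1) :=
  runWith_eq_evolve P _ k 1

lemma runPhase_norm_sq (P : Prover n m κ) (H : Bits n → Bool) (k : Bits κ) :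
    ∑ s, ‖P.runPhase H k s‖ ^ 2 = 1 := by
  rw [runPhase_eq_evolve, evolve_norm_sq, Finset.sum_eq_single (P.startBasis k)]
  · simp
  · intro s _ hs; simp [hs]
  · simp

end Norm

/-! ### Winning probability in terms of the coefficients -/

section Branch

variable {n : ℕ}

lemma sum_div_card_set2 (x₀ x₁ : Bits n) (g : (Bits n → Bool) → ℝ) :
    (∑ H, g H) / (Fintype.card (Bits n → Bool) : ℝ) =
      (∑ H, (∑ a, ∑ b, g (set2 x₀ x₁ H a b)) / 4) / (Fintype.card (Bits n → Bool) : ℝ) := by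
  rw [← Finset.sum_div, sum_set2]; simp

lemma coef_combination (f : (Bits n → Bool) → ℂ) (x₀ x₁ : Bits n) (c₀ c₁ c₂ c₃ : ℂ) (D : DB n) :
    c₀ * coef f D + c₁ * coefOne x₀ x₁ f D false + c₂ * coefOne x₀ x₁ f D true +
      c₃ * coefBoth x₀ x₁ f D =
    coef (fun H => (c₀ + c₁ * sgn (H x₀) + c₂ * sgn (H x₁) + c₃ * (sgn (H x₀) * sgn (H x₁))) * f H)
      D := by
  simp only [coefOne, coefBoth, ← coef_smul, ← coef_add, cond_false, cond_true]
  congr 1; funext H; ring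

/-- A combination of the four coefficients is one transform, so its weight is a mean over orbits of
four functions H. This reduces the weight identities below to algebra with four complex numbers. -/
lemma sum_norm_sq_combination {x₀ x₁ : Bits n} (hne : x₀ ≠ x₁) (f : (Bits n → Bool) → ℂ)
    (c₀ c₁ c₂ c₃ : ℂ) :
    ∑ D ∈ avoiding x₀ x₁, ‖c₀ * coef f D + c₁ * coefOne x₀ x₁ f D false +
        c₂ * coefOne x₀ x₁ f D true + c₃ * coefBoth x₀ x₁ f D‖ ^ 2 =
      (∑ H, ‖(∑ a, ∑ b, (c₀ + c₁ * sgn a + c₂ * sgn b + c₃ * (sgn a * sgn b)) *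
        f (set2 x₀ x₁ H a b)) / 4‖ ^ 2) / (Fintype.card (Bits n → Bool) : ℝ) := by
  simp only [coef_combination, sum_avoiding_norm_sq_coef, orbitAvg, set2_left hne, set2_right]

lemma sum_norm_sq_coefBoth {x₀ x₁ : Bits n} (hne : x₀ ≠ x₁) (f : (Bits n → Bool) → ℂ) :
    ∑ D ∈ avoiding x₀ x₁, ‖coefBoth x₀ x₁ f D‖ ^ 2 =
      (∑ H, ‖(∑ a, ∑ b, (sgn a * sgn b) * f (set2 x₀ x₁ H a b)) / 4‖ ^ 2) /
        (Fintype.card (Bits n → Bool) : ℝ) := by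
  simpa using sum_norm_sq_combination hne f 0 0 0 1

/-- Parseval on the group (ℤ/2)² of values at the two points, orbit by orbit. -/
lemma branch_total {x₀ x₁ : Bits n} (hne : x₀ ≠ x₁) (f : (Bits n → Bool) → ℂ) :
    ∑ D ∈ avoiding x₀ x₁, (‖coef f D‖ ^ 2 + ∑ b, ‖coefOne x₀ x₁ f D b‖ ^ 2 +
      ‖coefBoth x₀ x₁ f D‖ ^ 2) = (∑ H, ‖f H‖ ^ 2) / (Fintype.card (Bits n → Bool) : ℝ) := by
  have h0 := sum_norm_sq_combination hne f 1 0 0 0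
  have h1 := sum_norm_sq_combination hne f 0 1 0 0
  have h2 := sum_norm_sq_combination hne f 0 0 1 0
  have h3 := sum_norm_sq_combination hne f 0 0 0 1
  simp only [zero_mul, one_mul, zero_add, add_zero] at h0 h1 h2 h3
  rw [sum_div_card_set2 x₀ x₁]
  simp only [Finset.sum_add_distrib, Fintype.sum_bool]
  rw [h0, h1, h2, h3, ← add_div, ← add_div, ← add_div, ← Finset.sum_add_distrib,
    ← Finset.sum_add_distrib, ← Finset.sum_add_distrib]
  congr 1
  refine Finset.sum_congr rfl fun H _ => ?_
  simp only [Complex.sq_norm, Complex.normSq_apply, Complex.add_re, Complex.add_im,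
    Complex.div_ofNat_re, Complex.div_ofNat_im, Complex.mul_re, Complex.mul_im, Fintype.sum_bool,
    sgn_true, sgn_false, Complex.neg_re, Complex.neg_im, Complex.one_re, Complex.one_im]
  ring

/-- The winning functions in an orbit are two points; the two combinations on the right are the
Fourier coefficients of `f` on this two-point set, whence the factor 2. -/
lemma branch_win {x₀ x₁ : Bits n} (hne : x₀ ≠ x₁) (f : (Bits n → Bool) → ℂ) (c : Bool) :
    2 * ((∑ H, if xor (H x₀) (H x₁) = c then ‖f H‖ ^ 2 else 0) /
      (Fintype.card (Bits n → Bool) : ℝ)) =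
    ∑ D ∈ avoiding x₀ x₁, (‖coef f D + sgn c * coefBoth x₀ x₁ f D‖ ^ 2 +
      ‖coefOne x₀ x₁ f D false + sgn c * coefOne x₀ x₁ f D true‖ ^ 2) := by
  have h0 := sum_norm_sq_combination hne f 1 0 0 (sgn c)
  have h1 := sum_norm_sq_combination hne f 0 1 (sgn c) 0
  simp only [zero_mul, one_mul, zero_add, add_zero] at h0 h1
  rw [sum_div_card_set2 x₀ x₁, Finset.sum_add_distrib, h0, h1, ← add_div,
    ← Finset.sum_add_distrib, ← mul_div_assoc, Finset.mul_sum]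
  congr 1
  refine Finset.sum_congr rfl fun H _ => ?_
  simp only [set2_left hne, set2_right]
  cases c <;>
  · simp only [Complex.sq_norm, Complex.normSq_apply, Complex.add_re, Complex.add_im,
      Complex.div_ofNat_re, Complex.div_ofNat_im, Complex.mul_re, Complex.mul_im, Fintype.sum_bool,
      sgn_true, sgn_false, Complex.neg_re, Complex.neg_im, Complex.one_re, Complex.one_im]
    simp
    ring

lemma norm_sq_add_le {ε : ℝ} (hε : 0 < ε) (p q : ℂ) (c : Bool) :
    ‖p + sgn c * q‖ ^ 2 ≤ (1 + ε) * ‖p‖ ^ 2 + (1 + 1 / ε) * ‖q‖ ^ 2 := by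
  have h1 : ‖p + sgn c * q‖ ≤ ‖p‖ + ‖q‖ := (norm_add_le _ _).trans (by simp)
  have h2 : ‖p + sgn c * q‖ ^ 2 ≤ (‖p‖ + ‖q‖) ^ 2 := by gcongr
  have h3 : 2 * (‖p‖ * ‖q‖) ≤ ε * ‖p‖ ^ 2 + 1 / ε * ‖q‖ ^ 2 := by
    have h4 : 0 ≤ 1 / ε * (ε * ‖p‖ - ‖q‖) ^ 2 := by positivity
    have h5 : 1 / ε * (ε * ‖p‖ - ‖q‖) ^ 2 =
        ε * ‖p‖ ^ 2 + 1 / ε * ‖q‖ ^ 2 - 2 * (‖p‖ * ‖q‖) := by field_simp; ring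
    linarith
  nlinarith

lemma norm_sq_add_sub (p q : ℂ) (c : Bool) :
    ‖p + sgn c * q‖ ^ 2 + ‖p - sgn c * q‖ ^ 2 = 2 * (‖p‖ ^ 2 + ‖q‖ ^ 2) := by
  cases c <;> simp [Complex.sq_norm, Complex.normSq_apply] <;> ring

/-- The parallelogram law turns the two α-terms into 2(|α₀|² + |α₁|²). One copy stays on the right,
the other joins |γ|² and |β|² in the total weight; the cross term of γ and β is split with the
parameter ε. -/
lemma branch_bound {x₀ x₁ : Bits n} (hne : x₀ ≠ x₁) (f : (Bits n → Bool) → ℂ) (c : Bool) {ε : ℝ}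
    (hε : 0 < ε) :
    2 * ((∑ H, if xor (H x₀) (H x₁) = c then ‖f H‖ ^ 2 else 0) /
      (Fintype.card (Bits n → Bool) : ℝ)) +
      ∑ D ∈ avoiding x₀ x₁, ‖coefOne x₀ x₁ f D false - sgn c * coefOne x₀ x₁ f D true‖ ^ 2 ≤
    ∑ D ∈ avoiding x₀ x₁, ∑ b, ‖coefOne x₀ x₁ f D b‖ ^ 2 +
      (1 + ε) * ((∑ H, ‖f H‖ ^ 2) / (Fintype.card (Bits n → Bool) : ℝ)) +
      (∑ D ∈ avoiding x₀ x₁, ‖coefBoth x₀ x₁ f D‖ ^ 2) / ε := by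
  rw [branch_win hne, ← branch_total hne, Finset.mul_sum, Finset.sum_div, ← Finset.sum_add_distrib,
    ← Finset.sum_add_distrib, ← Finset.sum_add_distrib]
  refine Finset.sum_le_sum fun D _ => ?_
  have h1 := norm_sq_add_le hε (coef f D) (coefBoth x₀ x₁ f D) c
  have h2 := norm_sq_add_sub (coefOne x₀ x₁ f D false) (coefOne x₀ x₁ f D true) c
  simp only [Fintype.sum_bool]
  have h3 : 0 ≤ ε * (‖coefOne x₀ x₁ f D true‖ ^ 2 + ‖coefOne x₀ x₁ f D false‖ ^ 2 +
    ‖coefBoth x₀ x₁ f D‖ ^ 2) := by positivity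
  have h4 : ‖coefBoth x₀ x₁ f D‖ ^ 2 / ε = 1 / ε * ‖coefBoth x₀ x₁ f D‖ ^ 2 := by ring
  nlinarith

end Branch

/-! ### Summation over the prover's basis strings; canonical coefficients and their uniqueness. -/

section Total

variable {n m κ : ℕ} (P : Prover n m κ) (cl : Bits m → Option (Bits n × Bits n))

lemma branchSum_congr {g g' : P.Basis → Bits n → Bits n → DB n → ℝ}
    (h : ∀ s x₀ x₁, cl (P.yReg s) = some (x₀, x₁) → ∀ D ∈ avoiding x₀ x₁,
      g s x₀ x₁ D = g' s x₀ x₁ D) : branchSum P cl g = branchSum P cl g' := by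
  refine Finset.sum_congr rfl fun s _ => ?_
  rcases hs : cl (P.yReg s) with _ | ⟨x₀, x₁⟩
  · rfl
  · exact Finset.sum_congr rfl fun D hD => h s x₀ x₁ hs D hD

/-- The canonical coefficients of the compressed run. -/
def alphaOf (k : Bits κ) (s : P.Basis) (D : DB n) (b : Bool) : ℂ :=
  match cl (P.yReg s) with
  | none => 0
  | some (x₀, x₁) => coefOne x₀ x₁ (fun H => P.runPhase H k s) D b

def betaOf (k : Bits κ) (s : P.Basis) (D : DB n) : ℂ :=
  match cl (P.yReg s) with
  | none => 0
  | some (x₀, x₁) => coefBoth x₀ x₁ (fun H => P.runPhase H k s) D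

lemma eq_sum_ket (ψ : DB n → ℂ) : ψ = ∑ D, ψ D • ket D := by
  funext E
  simp [ket, Finset.sum_apply, Pi.single_apply]

/-- The state itself serves as γ, since on databases avoiding both points the coefficient of |D⟩ is
the amplitude at D. -/
theorem hasCoeffs_canonical (hcl : ∀ y x₀ x₁, cl y = some (x₀, x₁) → x₀ ≠ x₁) (k : Bits κ) :
    HasCoeffs P cl (P.runCompressed k) (alphaOf P cl k) (betaOf P cl k) (P.runCompressed k) := by
  intro s
  rcases hs : cl (P.yReg s) with _ | ⟨x₀, x₁⟩
  · exact eq_sum_ket _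
  · simp only [runCompressed_eq, alphaOf, betaOf, hs]
    exact coef_eq_decomposition (hcl _ _ _ hs) _

theorem hasCoeffs_unique (hcl : ∀ y x₀ x₁, cl y = some (x₀, x₁) → x₀ ≠ x₁) (k : Bits κ)
    {α : P.Basis → DB n → Bool → ℂ} {β γ : P.Basis → DB n → ℂ}
    (h : HasCoeffs P cl (P.runCompressed k) α β γ) {s : P.Basis} {x₀ x₁ : Bits n}
    (hs : cl (P.yReg s) = some (x₀, x₁)) {D : DB n} (hD : D ∈ avoiding x₀ x₁) :
    (∀ b, α s D b = alphaOf P cl k s D b) ∧ β s D = betaOf P cl k s D := by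
  have h1 := h s
  rw [hs, runCompressed_eq] at h1
  simp only [alphaOf, betaOf, hs]
  exact decomposition_unique (hcl _ _ _ hs) _ (α s) (β s) (γ s) h1 D hD

lemma validEqn_iff {H : Bits n → Bool} {s : P.Basis} {x₀ x₁ : Bits n}
    (hs : cl (P.yReg s) = some (x₀, x₁)) :
    ValidEqn P cl H s ↔ xor (H x₀) (H x₁) = eqnBit (s .z) (P.dReg s) x₀ x₁ := by
  unfold ValidEqn eqnBit
  constructor
  · rintro ⟨a, b, hab, h⟩
    rw [hs] at hab
    simp only [Option.some.injEq, Prod.mk.injEq] at hab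
    obtain ⟨rfl, rfl⟩ := hab
    rw [h]; cases (dot (P.dReg s) fun i => xor (x₀ i) (x₁ i)) <;> simp
  · intro h
    refine ⟨x₀, x₁, hs, ?_⟩
    rw [h]
    cases s .z <;> cases (dot (P.dReg s) fun i => xor (x₀ i) (x₁ i)) <;> rfl

theorem win_bound (hcl : ∀ y x₀ x₁, cl y = some (x₀, x₁) → x₀ ≠ x₁) (k : Bits κ) {ε : ℝ}
    (hε : 0 < ε) :
    2 * winProb P cl k + misalignment P cl (alphaOf P cl k) ≤
      weightOne P cl (alphaOf P cl k) + (1 + ε) + weightBoth P cl (betaOf P cl k) / ε := by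
  classical
  have hM : (0 : ℝ) < Fintype.card (Bits n → Bool) := by exact_mod_cast Fintype.card_pos
  have h1 : ∑ s, (∑ H, ‖P.runPhase H k s‖ ^ 2) / (Fintype.card (Bits n → Bool) : ℝ) = 1 := by
    rw [← Finset.sum_div, Finset.sum_comm]
    simp only [runPhase_norm_sq]
    rw [div_eq_one_iff_eq hM.ne']; simp
  have h2 : winProb P cl k = ∑ s, (∑ H, if ValidEqn P cl H s then ‖P.runPhase H k s‖ ^ 2 else 0) /
      (Fintype.card (Bits n → Bool) : ℝ) := by
    rw [← Finset.sum_div, Finset.sum_comm, winProb]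
  have h3 : (1 + ε) = ∑ s, (1 + ε) *
      ((∑ H, ‖P.runPhase H k s‖ ^ 2) / (Fintype.card (Bits n → Bool) : ℝ)) := by
    rw [← Finset.mul_sum, h1, mul_one]
  rw [h2, h3, misalignment, weightOne, weightBoth, branchSum, branchSum, branchSum,
    Finset.sum_div, Finset.mul_sum, ← Finset.sum_add_distrib, ← Finset.sum_add_distrib,
    ← Finset.sum_add_distrib]
  refine Finset.sum_le_sum fun s _ => ?_
  rcases hs : cl (P.yReg s) with _ | ⟨x₀, x₁⟩
  -- Without pre-images the prover never wins, and this string only adds a nonnegative share of the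
  -- total weight on the right.
  · have : ∀ H, ¬ ValidEqn P cl H s := by
      rintro H ⟨a, b, h, -⟩; rw [hs] at h; cases h
    simp only [this, if_false, Finset.sum_const_zero, zero_div, mul_zero, zero_add, add_zero]
    positivity
  · simp only [validEqn_iff P cl hs, alphaOf, betaOf, hs]
    exact branch_bound (hcl _ _ _ hs) _ _ hε

end Total

/-! ### Hybrid argument: both points must have been queried -/

section Hybrid

variable {n m κ a : ℕ}

lemma stepAct_add (H : Bits n → Bool) (st : Step (PWire n m κ a))
    (ψ φ : (PWire n m κ a → Bool) → ℂ) :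
    stepAct (phaseAct H) st (ψ + φ) = stepAct (phaseAct H) st ψ + stepAct (phaseAct H) st φ := by
  funext s
  cases st <;> simp [stepAct, phaseAct, Gate.apply, mul_add, Finset.sum_add_distrib]

lemma stepAct_smul (H : Bits n → Bool) (st : Step (PWire n m κ a)) (c : ℂ)
    (ψ : (PWire n m κ a → Bool) → ℂ) :
    stepAct (phaseAct H) st (c • ψ) = c • stepAct (phaseAct H) st ψ := by
  funext s
  cases st <;> simp [stepAct, phaseAct, Gate.apply, mul_left_comm, Finset.mul_sum]

/-- The evolution as a linear map. -/
def evolveLin (H : Bits n → Bool) (L : List (Step (PWire n m κ a))) :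
    ((PWire n m κ a → Bool) → ℂ) →ₗ[ℂ] (PWire n m κ a → Bool) → ℂ where
  toFun := evolve (phaseAct H) L
  map_add' ψ φ := by
    induction L generalizing ψ φ with
    | nil => rfl
    | cons st L ih => rw [evolve_cons, stepAct_add, ih]; rfl
  map_smul' c ψ := by
    induction L generalizing ψ with
    | nil => rfl
    | cons st L ih => rw [evolve_cons, stepAct_smul, ih]; rfl

@[simp] lemma evolveLin_nil (H : Bits n → Bool) (ψ : (PWire n m κ a → Bool) → ℂ) :
    evolveLin H [] ψ = ψ := rfl

lemma evolveLin_cons (H : Bits n → Bool) (st : Step (PWire n m κ a))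
    (L : List (Step (PWire n m κ a))) (ψ : (PWire n m κ a → Bool) → ℂ) :
    evolveLin H (st :: L) ψ = evolveLin H L (stepAct (phaseAct H) st ψ) := rfl

lemma evolveLin_append_singleton (H : Bits n → Bool) (st : Step (PWire n m κ a))
    (L : List (Step (PWire n m κ a))) (ψ : (PWire n m κ a → Bool) → ℂ) :
    evolveLin H (L ++ [st]) ψ = stepAct (phaseAct H) st (evolveLin H L ψ) := by
  show evolve _ _ _ = _
  rw [evolve_append]; rfl

/-- The projection on the event that the prover is about to query `x` with `e = 1`. -/
def projQ (x : Bits n) (ψ : (PWire n m κ a → Bool) → ℂ) : (PWire n m κ a → Bool) → ℂ :=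
  fun s => if (fun i => s (.x i)) = x ∧ s .e = true then ψ s else 0

lemma projQ_sum {ι : Type*} (S : Finset ι) (x : Bits n) (ψ : ι → (PWire n m κ a → Bool) → ℂ) :
    projQ x (∑ i ∈ S, ψ i) = ∑ i ∈ S, projQ x (ψ i) := by
  funext s
  simp only [projQ, Finset.sum_apply]
  split_ifs <;> simp

lemma projQ_smul (x : Bits n) (c : ℂ) (ψ : (PWire n m κ a → Bool) → ℂ) :
    projQ x (c • ψ) = c • projQ x ψ := by
  funext s
  simp [projQ]

/-- The Hilbert space norm of a state. -/
def stNorm {ι : Type*} [Fintype ι] (ψ : ι → ℂ) : ℝ := ‖WithLp.toLp 2 ψ‖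

section stNorm
variable {ι : Type*} [Fintype ι]

lemma stNorm_nonneg (ψ : ι → ℂ) : 0 ≤ stNorm ψ := norm_nonneg _

lemma stNorm_sq (ψ : ι → ℂ) : stNorm ψ ^ 2 = ∑ s, ‖ψ s‖ ^ 2 := by
  simp [stNorm, EuclideanSpace.norm_sq_eq]

lemma stNorm_add_le (ψ φ : ι → ℂ) : stNorm (ψ + φ) ≤ stNorm ψ + stNorm φ := by
  unfold stNorm; rw [WithLp.toLp_add]; exact norm_add_le _ _

lemma stNorm_smul (c : ℂ) (ψ : ι → ℂ) : stNorm (c • ψ) = ‖c‖ * stNorm ψ := by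
  unfold stNorm; rw [WithLp.toLp_smul]; exact norm_smul _ _

lemma stNorm_zero : stNorm (0 : ι → ℂ) = 0 := by simp [stNorm]

lemma stNorm_sum_le {J : Type*} (S : Finset J) (ψ : J → ι → ℂ) :
    stNorm (∑ j ∈ S, ψ j) ≤ ∑ j ∈ S, stNorm (ψ j) :=
  Finset.le_sum_of_subadditive _ stNorm_zero.le stNorm_add_le S ψ

lemma stNorm_congr {φ ψ : ι → ℂ} (h : ∑ s, ‖φ s‖ ^ 2 = ∑ s, ‖ψ s‖ ^ 2) :
    stNorm φ = stNorm ψ := by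
  rw [← stNorm_sq, ← stNorm_sq] at h
  exact (sq_eq_sq₀ (stNorm_nonneg _) (stNorm_nonneg _)).1 h

end stNorm

/-- Telescoping over the step at which the two oracles are exchanged. They differ only on queries of
`x` with e = 1, where the phases -1 and 1 give the coefficient -2; gates get coefficient 0. -/
lemma exists_evolve_sub_eq {x : Bits n} {H : Bits n → Bool} (hx : H x = true)
    (L : List (Step (PWire n m κ a))) (ψ : (PWire n m κ a → Bool) → ℂ) :
    ∃ c : ℕ → ℂ, (∀ j, ‖c j‖ ≤ 2) ∧
      evolveLin H L ψ - evolveLin (Function.update H x false) L ψ =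
        ∑ j ∈ Finset.range L.length, c j •
          evolveLin (Function.update H x false) (L.drop j) (projQ x (evolveLin H (L.take j) ψ)) := by
  induction L generalizing ψ with
  | nil => exact ⟨0, by simp, by simp⟩
  | cons st L ih =>
    obtain ⟨c, hc, h⟩ := ih (stepAct (phaseAct H) st ψ)
    obtain ⟨c0, hc0, h0⟩ : ∃ c0 : ℂ, ‖c0‖ ≤ 2 ∧ stepAct (phaseAct H) st ψ -
        stepAct (phaseAct (Function.update H x false)) st ψ =
        c0 • stepAct (phaseAct (Function.update H x false)) st (projQ x ψ) := by
      cases st with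
      | gate g => exact ⟨0, by simp, by simp [stepAct]⟩
      | query =>
        refine ⟨-2, by simp, ?_⟩
        funext s
        simp only [stepAct, phaseAct, projQ, Pi.sub_apply, Pi.smul_apply, smul_eq_mul]
        by_cases h1 : (fun i => s (.x i)) = x
        · cases he : s .e <;> simp [h1, hx]; ring
        · simp [h1]
    refine ⟨fun j => Nat.casesOn j c0 c, fun j => by cases j <;> simp [hc0, hc], ?_⟩
    rw [List.length_cons, Finset.sum_range_succ']
    simp only [List.drop_succ_cons, List.take_succ_cons, List.drop_zero, List.take_zero,
      evolveLin_cons, evolveLin_nil]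
    have h0' := congrArg (evolveLin (Function.update H x false) L) h0
    rw [map_sub, map_smul] at h0'
    rw [← h]
    show _ = _ + c0 • _
    rw [← h0']
    abel

/-- The weight on first querying `x`, and later (in a run where the value at `x` is erased) `x'`. -/
def hit (L : List (Step (PWire n m κ a))) (ψ : (PWire n m κ a → Bool) → ℂ) (i j : ℕ)
    (H : Bits n → Bool) (x x' : Bits n) : ℝ :=
  ∑ s, ‖projQ x' (evolveLin (Function.update H x false) ((L.take i).drop j)
    (projQ x (evolveLin H (L.take j) ψ))) s‖ ^ 2

lemma hit_nonneg (L : List (Step (PWire n m κ a))) (ψ : (PWire n m κ a → Bool) → ℂ) (i j : ℕ)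
    (H : Bits n → Bool) (x x' : Bits n) : 0 ≤ hit L ψ i j H x x' :=
  Finset.sum_nonneg fun _ _ => by positivity

lemma stNorm_projQ_sub_le {x : Bits n} {H : Bits n → Bool} (hx : H x = true) (x' : Bits n)
    (L : List (Step (PWire n m κ a))) (ψ : (PWire n m κ a → Bool) → ℂ) {i : ℕ} (hi : i < L.length) :
    stNorm (projQ x' (evolveLin H (L.take i) ψ - evolveLin (Function.update H x false) (L.take i) ψ))
      ≤ ∑ j ∈ Finset.range L.length, 2 * √(hit L ψ i j H x x') := by
  obtain ⟨c, hc, h⟩ := exists_evolve_sub_eq hx (L.take i) ψ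
  rw [h, projQ_sum]
  refine (stNorm_sum_le _ _).trans ?_
  rw [List.length_take_of_le hi.le]
  -- Only j < i occurs; nonnegative terms are added so that the pairs (i, j) later range over a full
  -- square.
  refine (Finset.sum_le_sum (g := fun j => 2 * √(hit L ψ i j H x x')) fun j hj => ?_).trans
    (Finset.sum_le_sum_of_subset_of_nonneg ?_ fun _ _ _ => by positivity)
  · rw [projQ_smul, stNorm_smul, List.take_take, min_eq_left (Finset.mem_range.1 hj).le]
    refine mul_le_mul (hc j) ?_ (stNorm_nonneg _) (by norm_num)
    rw [hit, ← stNorm_sq, Real.sqrt_sq (stNorm_nonneg _)]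
  · intro j hj
    simp only [Finset.mem_range] at *; omega

/-- The mixed second difference of a run in the values of the oracle at two points. -/
def mixedDiff (L : List (Step (PWire n m κ a))) (ψ : (PWire n m κ a → Bool) → ℂ)
    (H : Bits n → Bool) (x₀ x₁ : Bits n) : (PWire n m κ a → Bool) → ℂ :=
  evolveLin H L ψ - evolveLin (Function.update H x₀ false) L ψ
    - evolveLin (Function.update H x₁ false) L ψ
    + evolveLin (Function.update (Function.update H x₀ false) x₁ false) L ψ

/-- The last step, run with both values erased, preserves the norm of the earlier mixed difference.
A query adds -2 times a first difference in one point, projected on querying the other point; this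
is how both points come to be queried. -/
lemma stNorm_mixedDiff_le {x₀ x₁ : Bits n} (hne : x₀ ≠ x₁) {H : Bits n → Bool} (h0 : H x₀ = true)
    (h1 : H x₁ = true) (L : List (Step (PWire n m κ a))) (ψ : (PWire n m κ a → Bool) → ℂ) :
    stNorm (mixedDiff L ψ H x₀ x₁) ≤ ∑ i ∈ Finset.range L.length,
      (2 * stNorm (projQ x₀ (evolveLin H (L.take i) ψ -
          evolveLin (Function.update H x₁ false) (L.take i) ψ)) +
        2 * stNorm (projQ x₁ (evolveLin H (L.take i) ψ -
          evolveLin (Function.update H x₀ false) (L.take i) ψ))) := by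
  induction L using List.reverseRecOn with
  | nil => simp [mixedDiff, stNorm_zero]
  | append_singleton L st ih =>
    rw [List.length_append, List.length_singleton, Finset.sum_range_succ]
    have e1 : ∀ i ∈ Finset.range L.length, (L ++ [st]).take i = L.take i := fun i hi =>
      List.take_append_of_le_length (Finset.mem_range.1 hi).le
    rw [Finset.sum_congr rfl fun i hi => by rw [e1 i hi], List.take_left]
    have key : ∃ c : ℂ, ‖c‖ ≤ 2 ∧ mixedDiff (L ++ [st]) ψ H x₀ x₁ =
        stepAct (phaseAct (Function.update (Function.update H x₀ false) x₁ false)) st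
          (mixedDiff L ψ H x₀ x₁) +
        (c • projQ x₀ (evolveLin H L ψ - evolveLin (Function.update H x₁ false) L ψ) +
         c • projQ x₁ (evolveLin H L ψ - evolveLin (Function.update H x₀ false) L ψ)) := by
      simp only [mixedDiff, evolveLin_append_singleton]
      cases st with
      | gate g =>
        refine ⟨0, by simp, ?_⟩
        funext s
        simp [stepAct, Gate.apply, mul_add, mul_sub, Finset.sum_add_distrib]
      | query =>
        refine ⟨-2, by simp, ?_⟩
        funext s
        simp only [stepAct, phaseAct, projQ, Pi.sub_apply, Pi.smul_apply, smul_eq_mul, Pi.add_apply]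
        by_cases hx0 : (fun i => s (.x i)) = x₀
        · cases he : s .e <;> simp [hx0, h0, hne]; ring
        by_cases hx1 : (fun i => s (.x i)) = x₁
        · cases he : s .e <;> simp [hx1, h1, hne.symm]; ring
        · simp [hx0, hx1]; ring
    obtain ⟨c, hc, hk⟩ := key
    rw [hk]
    refine (stNorm_add_le _ _).trans (add_le_add ?_ ((stNorm_add_le _ _).trans (add_le_add ?_ ?_)))
    · rw [stNorm_congr (stepAct_norm_sq _ _ _)]; exact ih
    · rw [stNorm_smul]; exact mul_le_mul_of_nonneg_right hc (stNorm_nonneg _)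
    · rw [stNorm_smul]; exact mul_le_mul_of_nonneg_right hc (stNorm_nonneg _)

theorem norm_sq_mixedDiff_le {x₀ x₁ : Bits n} (hne : x₀ ≠ x₁) {H : Bits n → Bool}
    (h0 : H x₀ = true) (h1 : H x₁ = true) (L : List (Step (PWire n m κ a)))
    (ψ : (PWire n m κ a → Bool) → ℂ) :
    ∑ s, ‖mixedDiff L ψ H x₀ x₁ s‖ ^ 2 ≤ 32 * (L.length : ℝ) ^ 2 *
      ∑ i ∈ Finset.range L.length, ∑ j ∈ Finset.range L.length,
        (hit L ψ i j H x₀ x₁ + hit L ψ i j H x₁ x₀) := by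
  set R := Finset.range L.length with hR
  have b1 : stNorm (mixedDiff L ψ H x₀ x₁) ≤ ∑ i ∈ R, ∑ j ∈ R,
      (4 * √(hit L ψ i j H x₀ x₁) + 4 * √(hit L ψ i j H x₁ x₀)) := by
    refine (stNorm_mixedDiff_le hne h0 h1 L ψ).trans (Finset.sum_le_sum fun i hi => ?_)
    have i0 := stNorm_projQ_sub_le h1 x₀ L ψ (Finset.mem_range.1 hi)
    have i1 := stNorm_projQ_sub_le h0 x₁ L ψ (Finset.mem_range.1 hi)
    rw [Finset.sum_add_distrib]
    have e : ∀ f : ℕ → ℝ, ∑ j ∈ R, 4 * f j = 2 * ∑ j ∈ R, 2 * f j := by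
      intro f; rw [Finset.mul_sum]; exact Finset.sum_congr rfl fun j _ => by ring
    rw [e, e]; linarith
  rw [← stNorm_sq]
  calc stNorm (mixedDiff L ψ H x₀ x₁) ^ 2
      ≤ (∑ i ∈ R, ∑ j ∈ R,
        (4 * √(hit L ψ i j H x₀ x₁) + 4 * √(hit L ψ i j H x₁ x₀))) ^ 2 :=
        pow_le_pow_left₀ (stNorm_nonneg _) b1 2
    _ ≤ (L.length : ℝ) ^ 2 * ∑ i ∈ R, ∑ j ∈ R,
        (4 * √(hit L ψ i j H x₀ x₁) + 4 * √(hit L ψ i j H x₁ x₀)) ^ 2 := by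
        rw [← Finset.sum_product', ← Finset.sum_product']
        -- Cauchy–Schwarz over the T² pairs of steps; then (4√u + 4√v)² ≤ 32(u + v).
        refine sq_sum_le_card_mul_sum_sq.trans (le_of_eq ?_)
        simp [hR, sq]
    _ ≤ _ := by
        have hAB : ∑ i ∈ R, ∑ j ∈ R,
            (4 * √(hit L ψ i j H x₀ x₁) + 4 * √(hit L ψ i j H x₁ x₀)) ^ 2 ≤
            32 * ∑ i ∈ R, ∑ j ∈ R, (hit L ψ i j H x₀ x₁ + hit L ψ i j H x₁ x₀) := by
          rw [Finset.mul_sum]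
          refine Finset.sum_le_sum fun i _ => ?_
          rw [Finset.mul_sum]
          refine Finset.sum_le_sum fun j _ => ?_
          have s0 := Real.sq_sqrt (hit_nonneg L ψ i j H x₀ x₁)
          have s1 := Real.sq_sqrt (hit_nonneg L ψ i j H x₁ x₀)
          nlinarith [sq_nonneg (√(hit L ψ i j H x₀ x₁) - √(hit L ψ i j H x₁ x₀))]
        refine (mul_le_mul_of_nonneg_left hAB (by positivity)).trans (le_of_eq ?_)
        ring

/-- The average weight of the database states with both points is bounded by hitting weights. -/
theorem sum_avg_norm_sq_le {x₀ x₁ : Bits n} (hne : x₀ ≠ x₁) (L : List (Step (PWire n m κ a)))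
    (ψ : (PWire n m κ a → Bool) → ℂ) :
    ∑ s, (∑ H, ‖(∑ a, ∑ b, (sgn a * sgn b) * evolve (phaseAct (set2 x₀ x₁ H a b)) L ψ s) / 4‖ ^ 2) /
        (Fintype.card (Bits n → Bool) : ℝ) ≤
      8 * (L.length : ℝ) ^ 2 *
      ∑ i ∈ Finset.range L.length, ∑ j ∈ Finset.range L.length,
        (∑ H, (hit L ψ i j H x₀ x₁ + hit L ψ i j H x₁ x₀)) /
          (Fintype.card (Bits n → Bool) : ℝ) := by
  have hM : (0 : ℝ) < Fintype.card (Bits n → Bool) := by exact_mod_cast Fintype.card_pos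
  simp only [← Finset.sum_div]
  rw [← mul_div_assoc]
  refine div_le_div_of_nonneg_right ?_ hM.le
  have e2 : ∑ i ∈ Finset.range L.length, ∑ j ∈ Finset.range L.length, ∑ H,
      (hit L ψ i j H x₀ x₁ + hit L ψ i j H x₁ x₀) =
      ∑ H, ∑ i ∈ Finset.range L.length, ∑ j ∈ Finset.range L.length,
      (hit L ψ i j H x₀ x₁ + hit L ψ i j H x₁ x₀) := by
    symm
    rw [Finset.sum_comm]
    exact Finset.sum_congr rfl fun i _ => Finset.sum_comm
  rw [e2, Finset.sum_comm]
  set G : (Bits n → Bool) → ℝ := fun H => ∑ i ∈ Finset.range L.length,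
    ∑ j ∈ Finset.range L.length, (hit L ψ i j H x₀ x₁ + hit L ψ i j H x₁ x₀) with hG
  have hG0 : ∀ H, 0 ≤ G H := fun H => Finset.sum_nonneg fun i _ => Finset.sum_nonneg fun j _ =>
    add_nonneg (hit_nonneg _ _ _ _ _ _ _) (hit_nonneg _ _ _ _ _ _ _)
  -- The hybrid bound needs the value `true` at both points; this is one of four nonnegative terms
  -- of each orbit. The constant 8 is 32 · 4 / 4².
  have h4 : ∑ H, G (set2 x₀ x₁ H true true) ≤ 4 * ∑ H, G H := by
    have := sum_set2 x₀ x₁ G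
    rw [nsmul_eq_mul] at this
    rw [show (4 : ℝ) = ((4 : ℕ) : ℝ) by norm_num, ← this]
    refine Finset.sum_le_sum fun H _ => ?_
    simp only [Fintype.sum_bool]
    linarith [hG0 (set2 x₀ x₁ H true false), hG0 (set2 x₀ x₁ H false true),
      hG0 (set2 x₀ x₁ H false false)]
  have h5 : ∀ H, ∑ s, ‖(∑ a, ∑ b, (sgn a * sgn b) *
      evolve (phaseAct (set2 x₀ x₁ H a b)) L ψ s) / 4‖ ^ 2 ≤
      2 * (L.length : ℝ) ^ 2 * G (set2 x₀ x₁ H true true) := by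
    intro H
    have := norm_sq_mixedDiff_le hne (set2_left hne H true true) (set2_right x₀ x₁ H true true) L ψ
    have u0 : Function.update (set2 x₀ x₁ H true true) x₀ false = set2 x₀ x₁ H false true := by
      unfold set2
      rw [Function.update_comm (β := fun _ => Bool) hne.symm, Function.update_idem]
    have u1 : ∀ a, Function.update (set2 x₀ x₁ H a true) x₁ false = set2 x₀ x₁ H a false := by
      intro a; unfold set2; rw [Function.update_idem]
    have e3 : ∀ s, ‖(∑ a, ∑ b, (sgn a * sgn b) *
        evolve (phaseAct (set2 x₀ x₁ H a b)) L ψ s) / 4‖ ^ 2 =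
        ‖mixedDiff L ψ (set2 x₀ x₁ H true true) x₀ x₁ s‖ ^ 2 / 16 := by
      intro s
      rw [norm_div, div_pow]
      simp only [mixedDiff, u0, u1, Fintype.sum_bool, sgn_true, sgn_false, Pi.add_apply,
        Pi.sub_apply]
      congr 1
      · congr 2
        show _ = evolve _ _ _ s - evolve _ _ _ s - evolve _ _ _ s + evolve _ _ _ s
        ring
      · norm_num
    simp only [e3, ← Finset.sum_div]
    simp only [hG]
    linarith
  refine (Finset.sum_le_sum fun H _ => h5 H).trans ?_
  rw [← Finset.mul_sum]
  have : (0 : ℝ) ≤ 2 * (L.length : ℝ) ^ 2 := by positivity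
  nlinarith [mul_le_mul_of_nonneg_left h4 this]

end Hybrid

/-! ### Functions of low degree and limited independence -/

section LowDeg

variable {n : ℕ}

/-- The span of the functions of the oracle that depend on at most `d` of its values. -/
def lowDeg (n d : ℕ) : Submodule ℂ ((Bits n → Bool) → ℂ) :=
  Submodule.span ℂ {f | ∃ T : Finset (Bits n), T.card ≤ d ∧
    ∀ H H', (∀ x ∈ T, H x = H' x) → f H = f H'}

lemma lowDeg_mono {d d' : ℕ} (h : d ≤ d') : lowDeg n d ≤ lowDeg n d' :=
  Submodule.span_mono fun _ ⟨T, hT, hf⟩ => ⟨T, hT.trans h, hf⟩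

lemma const_mem_lowDeg (c : ℂ) (d : ℕ) : (fun _ => c) ∈ lowDeg n d :=
  Submodule.subset_span ⟨∅, by simp, fun _ _ _ => rfl⟩

lemma smul_mem_lowDeg {d : ℕ} (c : ℂ) {f : (Bits n → Bool) → ℂ} (hf : f ∈ lowDeg n d) :
    (fun H => c * f H) ∈ lowDeg n d := Submodule.smul_mem _ c hf

lemma add_mem_lowDeg {d : ℕ} {f g : (Bits n → Bool) → ℂ} (hf : f ∈ lowDeg n d)
    (hg : g ∈ lowDeg n d) : (fun H => f H + g H) ∈ lowDeg n d := Submodule.add_mem _ hf hg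

lemma mul_mem_lowDeg {d d' : ℕ} {f g : (Bits n → Bool) → ℂ} (hf : f ∈ lowDeg n d)
    (hg : g ∈ lowDeg n d') : (fun H => f H * g H) ∈ lowDeg n (d + d') := by
  induction hf using Submodule.span_induction with
  | mem f hf =>
    obtain ⟨T, hT, hf⟩ := hf
    induction hg using Submodule.span_induction with
    | mem g hg =>
      obtain ⟨T', hT', hg⟩ := hg
      refine Submodule.subset_span ⟨T ∪ T', (Finset.card_union_le _ _).trans (by omega), ?_⟩
      intro H H' h
      dsimp only
      rw [hf H H' fun x hx => h x (Finset.mem_union_left _ hx),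
        hg H H' fun x hx => h x (Finset.mem_union_right _ hx)]
    | zero => simpa using const_mem_lowDeg 0 _
    | add g g' _ _ h h' => simpa [mul_add] using add_mem_lowDeg h h'
    | smul c g _ h => simpa [mul_left_comm] using smul_mem_lowDeg c h
  | zero => simpa using const_mem_lowDeg 0 _
  | add f f' _ _ h h' => simpa [add_mul] using add_mem_lowDeg h h'
  | smul c f _ h => simpa [mul_assoc] using smul_mem_lowDeg c h

lemma conj_mem_lowDeg {d : ℕ} {f : (Bits n → Bool) → ℂ} (hf : f ∈ lowDeg n d) :
    (fun H => (starRingEnd ℂ) (f H)) ∈ lowDeg n d := by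
  induction hf using Submodule.span_induction with
  | mem f hf =>
    obtain ⟨T, hT, hf⟩ := hf
    exact Submodule.subset_span ⟨T, hT, fun H H' h => by dsimp only; rw [hf H H' h]⟩
  | zero => simpa using const_mem_lowDeg 0 _
  | add f f' _ _ h h' => simpa using add_mem_lowDeg h h'
  | smul c f _ h => simpa using smul_mem_lowDeg ((starRingEnd ℂ) c) h

lemma sum_mem_lowDeg {ι : Type*} {d : ℕ} (S : Finset ι) {f : ι → (Bits n → Bool) → ℂ}
    (hf : ∀ i ∈ S, f i ∈ lowDeg n d) : (fun H => ∑ i ∈ S, f i H) ∈ lowDeg n d := by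
  have := Submodule.sum_mem _ hf
  convert this using 1
  funext H; simp


variable {m κ a : ℕ}

/-- A query multiplies each amplitude by a function of a single oracle value, and a gate only takes
linear combinations, so a step raises the degree by at most one. The map `φ` admits the oracle with
an erased value. -/
lemma evolve_mem_lowDeg (φ : (Bits n → Bool) → Bits n → Bool)
    (hφ : ∀ H H' x, H x = H' x → φ H x = φ H' x) (L : List (Step (PWire n m κ a))) {d : ℕ}
    (ψ : (Bits n → Bool) → (PWire n m κ a → Bool) → ℂ)
    (hψ : ∀ s, (fun H => ψ H s) ∈ lowDeg n d) (s : PWire n m κ a → Bool) :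
    (fun H => evolve (phaseAct (φ H)) L (ψ H) s) ∈ lowDeg n (d + L.length) := by
  induction L generalizing ψ d s with
  | nil => exact hψ s
  | cons st L ih =>
    have := ih (d := d + 1) (fun H => stepAct (phaseAct (φ H)) st (ψ H)) (fun s => ?_) s
    · simpa [add_assoc, add_comm 1] using this
    cases st with
    | gate g =>
      exact lowDeg_mono (Nat.le_succ d)
        (sum_mem_lowDeg Finset.univ fun u _ => smul_mem_lowDeg _ (hψ _))
    | query =>
      rw [add_comm]
      refine mul_mem_lowDeg (Submodule.subset_span ⟨{fun i => s (.x i)}, by simp, ?_⟩) (hψ s)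
      intro H H' h
      simp only [Finset.mem_singleton, forall_eq] at h
      dsimp only
      rw [hφ H H' _ h]

lemma hit_mem_lowDeg (L : List (Step (PWire n m κ a))) (ψ : (PWire n m κ a → Bool) → ℂ) (i j : ℕ)
    (x x' : Bits n) : (fun H => (hit L ψ i j H x x' : ℂ)) ∈ lowDeg n (4 * L.length) := by
  have hP : ∀ {d : ℕ} (x : Bits n) (ψ : (Bits n → Bool) → (PWire n m κ a → Bool) → ℂ),
      (∀ s, (fun H => ψ H s) ∈ lowDeg n d) → ∀ s, (fun H => projQ x (ψ H) s) ∈ lowDeg n d := by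
    intro d x ψ h s
    simp only [projQ]
    split_ifs
    · exact h s
    · exact const_mem_lowDeg 0 d
  have h1 := evolve_mem_lowDeg (fun H => H) (fun _ _ _ h => h) (L.take j) (d := 0)
    (fun _ => ψ) (fun s => const_mem_lowDeg _ _)
  have h2 := evolve_mem_lowDeg (fun H => Function.update H x false)
    (fun H H' y h => by simp [Function.update_apply, h]) ((L.take i).drop j) _ (hP x _ h1)
  have h3 := hP x' _ h2
  -- For j > i the second segment is empty, so this holds for all i and j; squaring the modulus
  -- doubles the degree to 4T.
  have hle : 0 + (L.take j).length + ((L.take i).drop j).length ≤ 2 * L.length := by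
    simp only [List.length_take, List.length_drop]; omega
  have h4 : (fun H => (hit L ψ i j H x x' : ℂ)) = fun H => ∑ s,
      (projQ x' (evolve (phaseAct (Function.update H x false)) ((L.take i).drop j)
        (projQ x (evolve (phaseAct H) (L.take j) ψ))) s) *
      (starRingEnd ℂ) (projQ x' (evolve (phaseAct (Function.update H x false)) ((L.take i).drop j)
        (projQ x (evolve (phaseAct H) (L.take j) ψ))) s) := by
    funext H
    rw [hit]; push_cast
    exact Finset.sum_congr rfl fun s _ => (Complex.mul_conj' _).symm
  rw [h4]
  refine sum_mem_lowDeg _ fun s _ => ?_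
  have h5 := lowDeg_mono hle (h3 s)
  have h6 := mul_mem_lowDeg h5 (conj_mem_lowDeg h5)
  rwa [show 2 * L.length + 2 * L.length = 4 * L.length by ring] at h6

/-- A surjective homomorphism of finite groups carries the uniform distribution to the uniform one;
translation invariance replaces counting fibres. -/
lemma sum_comp_addHom {G K E : Type*} [AddGroup G] [AddGroup K] [Fintype G] [Fintype K]
    [AddCommMonoid E] (Φ : G →+ K) (hΦ : Function.Surjective Φ) (f : K → E) :
    Fintype.card K • ∑ g, f (Φ g) = Fintype.card G • ∑ k, f k := by
  have h1 : ∀ k, ∑ g, f (Φ g + k) = ∑ g, f (Φ g) := by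
    intro k
    obtain ⟨h, rfl⟩ := hΦ k
    simp only [← map_add]
    exact Fintype.sum_equiv (Equiv.addRight h) _ _ fun g => rfl
  have h2 : ∀ g, ∑ k, f (Φ g + k) = ∑ k, f k := fun g =>
    Fintype.sum_equiv (Equiv.addLeft (Φ g)) _ _ fun k => rfl
  calc Fintype.card K • ∑ g, f (Φ g) = ∑ k, ∑ g, f (Φ g + k) := by simp [h1]
    _ = ∑ g, ∑ k, f (Φ g + k) := Finset.sum_comm
    _ = _ := by simp [h2]

/-- The bit of an element of `ℤ/2`. -/
def bitOf (z : ZMod 2) : Bool := decide (z = 1)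

lemma bitOf_add (u v : ZMod 2) : bitOf (u + v) = xor (bitOf u) (bitOf v) := by
  revert u v; decide

lemma bitOf_mul (u v : ZMod 2) : bitOf (u * v) = (bitOf u && bitOf v) := by
  revert u v; decide

/-- The element of `ℤ/2` of a bit. -/
def ofBit (b : Bool) : ZMod 2 := if b then 1 else 0

@[simp] lemma bitOf_ofBit (b : Bool) : bitOf (ofBit b) = b := by revert b; decide

@[simp] lemma ofBit_bitOf (z : ZMod 2) : ofBit (bitOf z) = z := by revert z; decide

/-- Polynomial hashing: the first coordinate of the value of a polynomial over a finite field. -/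
def polyHash {F : Type*} [Field F] [Algebra (ZMod 2) F] {t : ℕ} (ℓ : F →ₗ[ZMod 2] ZMod 2)
    (pt : Bits n → F) (c : Fin t → F) (x : Bits n) : Bool :=
  bitOf (ℓ (∑ i, c i * pt x ^ (i : ℕ)))

lemma polyHash_surjective {F : Type*} [Field F] [Algebra (ZMod 2) F] {t : ℕ}
    {ℓ : F →ₗ[ZMod 2] ZMod 2} (hℓ : Function.Surjective ℓ) {pt : Bits n → F}
    (hpt : Function.Injective pt) {T : Finset (Bits n)} (hT : T.card ≤ t) (r : T → ZMod 2) :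
    ∃ c : Fin t → F, ∀ x : T, ℓ (∑ i, c i * pt x ^ (i : ℕ)) = r x := by
  classical
  choose u hu using fun x : T => hℓ (r x)
  let v : Bits n → F := fun x => if h : x ∈ T then u ⟨x, h⟩ else 0
  let p := Lagrange.interpolate T pt v
  have hp : p ∈ Polynomial.degreeLT F t := by
    rw [Polynomial.mem_degreeLT]
    refine (Lagrange.degree_interpolate_lt v hpt.injOn).trans_le ?_
    exact_mod_cast hT
  refine ⟨Polynomial.degreeLTEquiv F t ⟨p, hp⟩, fun x => ?_⟩
  rw [← Polynomial.eval_eq_sum_degreeLTEquiv hp,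
    Lagrange.eval_interpolate_at_node v hpt.injOn x.2, ← hu x]
  simp [v]

/-- By linearity `f` depends on the values on a set T of at most t points. Restriction to T is a
surjective homomorphism both from coefficient vectors (Lagrange interpolation) and from all
functions, so both averages equal the average over values on T. -/
theorem polyHash_avg {F : Type*} [Field F] [Fintype F] [Algebra (ZMod 2) F] {t : ℕ}
    {ℓ : F →ₗ[ZMod 2] ZMod 2} (hℓ : Function.Surjective ℓ) {pt : Bits n → F}
    (hpt : Function.Injective pt) {f : (Bits n → Bool) → ℂ} (hf : f ∈ lowDeg n t) :
    (Fintype.card (Fin t → F) : ℂ) * ∑ H, f H =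
      (Fintype.card (Bits n → Bool) : ℂ) * ∑ c, f (polyHash ℓ pt (t := t) c) := by
  classical
  induction hf using Submodule.span_induction with
  | mem f hf =>
    obtain ⟨T, hT, hf⟩ := hf
    let f' : (T → ZMod 2) → ℂ := fun r => f fun x => if h : x ∈ T then bitOf (r ⟨x, h⟩) else false
    let Φ : (Fin t → F) →+ (T → ZMod 2) :=
      { toFun := fun c x => ℓ (∑ i, c i * pt x ^ (i : ℕ))
        map_zero' := by funext x; simp
        map_add' := fun c c' => by funext x; simp [add_mul, Finset.sum_add_distrib] }
    let Ψ : (Bits n → ZMod 2) →+ (T → ZMod 2) :=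
      { toFun := fun g x => g x
        map_zero' := rfl
        map_add' := fun c c' => rfl }
    have hΦ : Function.Surjective Φ := fun r => by
      obtain ⟨c, hc⟩ := polyHash_surjective hℓ hpt hT r
      exact ⟨c, funext hc⟩
    have hΨ : Function.Surjective Ψ := fun r =>
      ⟨fun x => if h : x ∈ T then r ⟨x, h⟩ else 0, by funext x; simp [Ψ]⟩
    have e1 := sum_comp_addHom Φ hΦ f'
    have e2 := sum_comp_addHom Ψ hΨ f'
    have e3 : ∑ c, f' (Φ c) = ∑ c, f (polyHash ℓ pt (t := t) c) := by
      refine Finset.sum_congr rfl fun c _ => hf _ _ fun x hx => ?_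
      simp [hx, Φ, polyHash]
    let eqv : (Bits n → ZMod 2) ≃ (Bits n → Bool) :=
      Equiv.piCongrRight fun _ => ⟨bitOf, ofBit, ofBit_bitOf, bitOf_ofBit⟩
    have e4 : ∑ g, f' (Ψ g) = ∑ H, f H := by
      refine Fintype.sum_equiv eqv _ _ fun g => hf _ _ fun x hx => ?_
      simp [hx, Ψ, eqv]
    have e5 : Fintype.card (Bits n → ZMod 2) = Fintype.card (Bits n → Bool) :=
      Fintype.card_congr eqv
    rw [e3] at e1
    rw [e4, e5] at e2
    simp only [nsmul_eq_mul] at e1 e2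
    have hK : (Fintype.card (T → ZMod 2) : ℂ) ≠ 0 := by exact_mod_cast Fintype.card_ne_zero
    apply mul_left_cancel₀ hK
    linear_combination (Fintype.card (Fin t → F) : ℂ) * e2 - (Fintype.card (Bits n → Bool) : ℂ) * e1
  | zero => simp
  | add f g _ _ h h' => simp only [Pi.add_apply, Finset.sum_add_distrib, mul_add, h, h']
  | smul c f _ h =>
    simp only [Pi.smul_apply, smul_eq_mul, ← Finset.mul_sum]
    rw [mul_left_comm, h, mul_left_comm]

end LowDeg

/-! ### Straight-line programs -/

section Circ

variable {ι : Type}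

/-- An input bit, or a function that is already computed. -/
def Avail (L : List ((ι → Bool) → Bool)) (f : (ι → Bool) → Bool) : Prop :=
  (∃ i, f = fun s => s i) ∨ f ∈ L

/-- The Boolean functions computed by the instructions of a straight-line program (last one
first), with arbitrary binary gates. -/
inductive Circ : List ((ι → Bool) → Bool) → Prop
  | nil : Circ []
  | cons {L : List ((ι → Bool) → Bool)} {u v : (ι → Bool) → Bool} (h : Bool → Bool → Bool) :
      Circ L → Avail L u → Avail L v → Circ ((fun s => h (u s) (v s)) :: L)

lemma Avail.mono {L L' : List ((ι → Bool) → Bool)} (h : L ⊆ L') {f : (ι → Bool) → Bool}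
    (hf : Avail L f) : Avail L' f := hf.imp_right fun hf => h hf

lemma avail_input (L : List ((ι → Bool) → Bool)) (i : ι) : Avail L fun s => s i := Or.inl ⟨i, rfl⟩

/-- `L'` extends `L` by at most `k` instructions. -/
def Extends (L L' : List ((ι → Bool) → Bool)) (k : ℕ) : Prop :=
  Circ L' ∧ L ⊆ L' ∧ L'.length ≤ L.length + k

lemma Extends.refl {L : List ((ι → Bool) → Bool)} (h : Circ L) : Extends L L 0 :=
  ⟨h, List.Subset.refl L, le_rfl⟩

lemma Extends.trans {L L' L'' : List ((ι → Bool) → Bool)} {k k' : ℕ} (h : Extends L L' k)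
    (h' : Extends L' L'' k') : Extends L L'' (k + k') :=
  ⟨h'.1, List.Subset.trans h.2.1 h'.2.1, by have := h.2.2; have := h'.2.2; omega⟩

lemma Extends.mono {L L' : List ((ι → Bool) → Bool)} {k k' : ℕ} (h : Extends L L' k)
    (hk : k ≤ k') : Extends L L' k' := ⟨h.1, h.2.1, h.2.2.trans (by omega)⟩

lemma Circ.step {L : List ((ι → Bool) → Bool)} (hL : Circ L) (h : Bool → Bool → Bool)
    {u v : (ι → Bool) → Bool} (hu : Avail L u) (hv : Avail L v) :
    ∃ L', Extends L L' 1 ∧ Avail L' fun s => h (u s) (v s) :=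
  ⟨_, ⟨hL.cons h hu hv, List.subset_cons_self _ _, by simp⟩, Or.inr (by simp)⟩

lemma Circ.exists_sum [Inhabited ι] {L : List ((ι → Bool) → Bool)} (hL : Circ L) {J : Type*}
    (S : Finset J) (c : ZMod 2) (γ : J → ZMod 2) (u v : J → (ι → Bool) → ZMod 2)
    (hu : ∀ j, Avail L fun s => bitOf (u j s)) (hv : ∀ j, Avail L fun s => bitOf (v j s)) :
    ∃ L', Extends L L' (1 + 2 * S.card) ∧
      Avail L' fun s => bitOf (c + ∑ j ∈ S, γ j * (u j s * v j s)) := by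
  classical
  induction S using Finset.induction_on with
  | empty =>
    obtain ⟨L', h1, h2⟩ := hL.step (fun _ _ => bitOf c) (avail_input L default)
      (avail_input L default)
    exact ⟨L', h1, by simpa using h2⟩
  | insert j S hj ih =>
    obtain ⟨L₁, h1, h1'⟩ := ih
    obtain ⟨L₂, h2, h2'⟩ := h1.1.step (fun a b => bitOf (γ j) && (a && b))
      ((hu j).mono h1.2.1) ((hv j).mono h1.2.1)
    obtain ⟨L₃, h3, h3'⟩ := h2.1.step xor (h1'.mono h2.2.1) h2'
    refine ⟨L₃, ((h1.trans h2).trans h3).mono ?_, ?_⟩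
    · rw [Finset.card_insert_of_notMem hj]; omega
    · convert h3' using 2 with s
      rw [Finset.sum_insert hj, ← bitOf_mul, ← bitOf_mul, ← bitOf_add]
      congr 1; ring

lemma Circ.exists_forall {L : List ((ι → Bool) → Bool)} (hL : Circ L) {J : Type*} (S : Finset J)
    (k : ℕ) (f : J → (ι → Bool) → Bool)
    (h : ∀ j L', Circ L' → L ⊆ L' → ∃ L'', Extends L' L'' k ∧ Avail L'' (f j)) :
    ∃ L', Extends L L' (S.card * k) ∧ ∀ j ∈ S, Avail L' (f j) := by
  classical
  induction S using Finset.induction_on with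
  | empty => exact ⟨L, (Extends.refl hL).mono (Nat.zero_le _), by simp⟩
  | insert j S hj ih =>
    obtain ⟨L₁, h1, h1'⟩ := ih
    obtain ⟨L₂, h2, h2'⟩ := h j L₁ h1.1 h1.2.1
    refine ⟨L₂, (h1.trans h2).mono ?_, ?_⟩
    · rw [Finset.card_insert_of_notMem hj]; linarith
    · intro i hi
      rcases Finset.mem_insert.1 hi with rfl | hi
      · exact h2'
      · exact (h1' i hi).mono h2.2.1

variable {F : Type} [Field F] [Algebra (ZMod 2) F] {N : ℕ} (bas : Module.Basis (Fin N) (ZMod 2) F)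

/-- In coordinates over ℤ/2, multiplication in F is bilinear with fixed structure constants, so each
of the N output bits is a sum of at most N² products of bits. -/
lemma Circ.exists_horner [Inhabited ι] {L : List ((ι → Bool) → Bool)} (hL : Circ L) (c : F)
    (X Y : (ι → Bool) → F) (hX : ∀ r, Avail L fun s => bitOf (bas.repr (X s) r))
    (hY : ∀ r, Avail L fun s => bitOf (bas.repr (Y s) r)) :
    ∃ L', Extends L L' (N * (1 + 2 * (N * N))) ∧
      ∀ r, Avail L' fun s => bitOf (bas.repr (c + X s * Y s) r) := by
  have key : ∀ r s, bas.repr (c + X s * Y s) r = bas.repr c r + ∑ p : Fin N × Fin N,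
      bas.repr (bas p.1 * bas p.2) r * (bas.repr (X s) p.1 * bas.repr (Y s) p.2) := by
    intro r s
    have hXY : X s * Y s = ∑ p : Fin N × Fin N,
        (bas.repr (X s) p.1 * bas.repr (Y s) p.2) • (bas p.1 * bas p.2) := by
      conv_lhs => rw [← bas.sum_repr (X s), ← bas.sum_repr (Y s), Finset.sum_mul_sum]
      rw [Fintype.sum_prod_type]
      refine Finset.sum_congr rfl fun i _ => Finset.sum_congr rfl fun j _ => ?_
      rw [smul_mul_smul_comm]
    rw [map_add, Finsupp.add_apply, hXY, map_sum, Finsupp.finsetSum_apply]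
    congr 1
    refine Finset.sum_congr rfl fun p _ => ?_
    rw [map_smul, Finsupp.smul_apply, smul_eq_mul, mul_comm]
  obtain ⟨L', h1, h2⟩ := hL.exists_forall (Finset.univ : Finset (Fin N)) (1 + 2 * (N * N))
    (fun r s => bitOf (bas.repr (c + X s * Y s) r)) (by
      intro r L' hL' hLL'
      simp only [key]
      simpa using hL'.exists_sum (Finset.univ : Finset (Fin N × Fin N)) (bas.repr c r)
        (fun p => bas.repr (bas p.1 * bas p.2) r)
        (fun p s => bas.repr (X s) p.1) (fun p s => bas.repr (Y s) p.2)
        (fun p => (hX _).mono hLL') (fun p => (hY _).mono hLL'))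
  exact ⟨L', by simpa using h1, fun r => h2 r (Finset.mem_univ r)⟩

lemma Circ.exists_poly [Inhabited ι] {L : List ((ι → Bool) → Bool)} (hL : Circ L) {t : ℕ}
    (c : Fin t → F) (X : (ι → Bool) → F) (hX : ∀ r, Avail L fun s => bitOf (bas.repr (X s) r))
    (h0 : Avail L fun _ => false) :
    ∃ L', Extends L L' (t * (N * (1 + 2 * (N * N)))) ∧
      ∀ r, Avail L' fun s => bitOf (bas.repr (∑ i, c i * X s ^ (i : ℕ)) r) := by
  induction t with
  | zero => exact ⟨L, (Extends.refl hL).mono (Nat.zero_le _), fun r => by simpa [bitOf] using h0⟩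
  | succ t ih =>
    obtain ⟨L₁, h1, h1'⟩ := ih fun i => c i.succ
    obtain ⟨L₂, h2, h2'⟩ := h1.1.exists_horner bas (c 0) X _ (fun r => (hX r).mono h1.2.1) h1'
    refine ⟨L₂, (h1.trans h2).mono (by linarith), fun r => ?_⟩
    convert h2' r using 4 with s
    rw [Fin.sum_univ_succ, Finset.mul_sum]
    simp only [Fin.val_zero, pow_zero, mul_one, Fin.val_succ]
    congr 2
    exact Finset.sum_congr rfl fun i _ => by ring

/-- The embedding of bit strings into a field with a basis of one more element. -/
def fieldPt {n : ℕ} (bas : Module.Basis (Fin (n + 1)) (ZMod 2) F) (x : Bits n) : F :=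
  bas.equivFun.symm (Fin.snoc (α := fun _ => ZMod 2) (fun i => ofBit (x i)) 0)

lemma fieldPt_injective {n : ℕ} (bas : Module.Basis (Fin (n + 1)) (ZMod 2) F) :
    Function.Injective (fieldPt bas) := by
  intro x y h
  have h1 := bas.equivFun.symm.injective h
  funext i
  have h2 := congrFun h1 i.castSucc
  simp only [Fin.snoc_castSucc] at h2
  rw [← bitOf_ofBit (x i), h2, bitOf_ofBit]

/-- The phase of the simulated queries: the hash of `x`, unless `x` is the recorded point. -/
def maskedHash {n t : ℕ} (bas : Module.Basis (Fin (n + 1)) (ZMod 2) F) (c : Fin t → F)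
    (x o : Bits n) (ef : Bool) : Bool :=
  polyHash (bas.coord 0) (fieldPt bas) c x && !(ef && decide (x = o))

/-- A bound for the length of a program for `maskedHash`. -/
def scratchBound (n t : ℕ) : ℕ := t * ((n + 1) * (1 + 2 * ((n + 1) * (n + 1)))) + 2 * n + 4

theorem exists_circ_maskedHash [Inhabited ι] {n t : ℕ}
    (bas : Module.Basis (Fin (n + 1)) (ZMod 2) F) (c : Fin t → F) (xw ow : Fin n → ι) (ef : ι) :
    ∃ L : List ((ι → Bool) → Bool), Circ L ∧
      L.length ≤ scratchBound n t ∧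
      (fun s => maskedHash bas c (fun i => s (xw i)) (fun i => s (ow i)) (s ef)) ∈ L := by
  classical
  -- The constant `false` serves as the padding coordinate of the field point, as the start of
  -- Horner's scheme and as the empty disjunction.
  obtain ⟨L₁, h1, h1'⟩ := (Circ.nil (ι := ι)).step (fun _ _ => false) (avail_input _ default)
    (avail_input _ default)
  have hX : ∀ r, Avail L₁ fun s => bitOf (bas.repr (fieldPt bas fun i => s (xw i)) r) := by
    intro r
    have e : ∀ s : ι → Bool, bas.repr (fieldPt bas fun i => s (xw i)) r =
        Fin.snoc (α := fun _ => ZMod 2) (fun i => ofBit (s (xw i))) 0 r := by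
      intro s
      rw [← bas.equivFun_apply, fieldPt, LinearEquiv.apply_symm_apply]
    simp only [e]
    induction r using Fin.lastCases with
    | last => simpa [bitOf] using h1'
    | cast i => simpa using avail_input L₁ (xw i)
  obtain ⟨L₂, h2, h2'⟩ := h1.1.exists_poly bas c (fun s => fieldPt bas fun i => s (xw i)) hX h1'
  obtain ⟨L₃, h3, h3'⟩ : ∃ L₃, Extends L₂ L₃ (2 * n) ∧
      Avail L₃ fun s => decide (∃ i, s (xw i) ≠ s (ow i)) := by
    have : ∀ S : Finset (Fin n), ∃ L₃, Extends L₂ L₃ (2 * S.card) ∧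
      Avail L₃ fun s => decide (∃ i ∈ S, s (xw i) ≠ s (ow i)) := by
      intro S
      induction S using Finset.induction_on with
      | empty => exact ⟨L₂, Extends.refl h2.1, by simpa using h1'.mono h2.2.1⟩
      | insert j S hj ih =>
        obtain ⟨A, hA, hA'⟩ := ih
        obtain ⟨B, hB, hB'⟩ := hA.1.step xor (avail_input A (xw j)) (avail_input A (ow j))
        obtain ⟨C, hC, hC'⟩ := hB.1.step or hB' (hA'.mono hB.2.1)
        refine ⟨C, ((hA.trans hB).trans hC).mono ?_, ?_⟩
        · rw [Finset.card_insert_of_notMem hj]; omega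
        · convert hC' using 2 with s
          rw [Bool.eq_iff_iff, decide_eq_true_iff, Finset.exists_mem_insert, Bool.or_eq_true,
            decide_eq_true_iff]
          cases s (xw j) <;> cases s (ow j) <;> simp
    simpa using this Finset.univ
  obtain ⟨L₄, h4, h4'⟩ := h3.1.step (fun a b => !(a && !b)) (avail_input L₃ ef) h3'
  have hv := ((h2' 0).mono h3.2.1).mono h4.2.1
  refine ⟨_, h4.1.cons and hv h4', ?_, ?_⟩
  · have := ((h1.trans h2).trans h3).trans h4
    have := this.2.2
    unfold scratchBound
    simp only [List.length_nil, List.length_cons] at *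
    omega
  · convert List.mem_cons_self using 2 with s
    rw [maskedHash]
    congr 2
    congr 1
    rw [← decide_not]
    congr 1
    simp [funext_iff]

end Circ

/-! ### Reversible computation by gates -/

section Gates

variable {ι : Type}

/-- For an involution the permutation is its own inverse, so the direction in which it acts on
amplitudes does not matter. -/
lemma exists_perm_gate {r : ℕ} (hr : r ≤ 3) (w : Fin r ↪ ι) (π : Bits r → Bits r)
    (hπ : Function.Involutive π) :
    ∃ g : Gate ι, ∀ (ψ : (ι → Bool) → ℂ) s, g.apply ψ s = ψ (Function.extend w (π (s ∘ w)) s) := by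
  let A : Matrix (Bits r) (Bits r) ℂ := Matrix.of fun v u => if u = π v then 1 else 0
  have hA : A ∈ Matrix.unitaryGroup (Bits r) ℂ := by
    rw [Matrix.mem_unitaryGroup_iff]
    ext v v'
    rw [Matrix.mul_apply, Matrix.one_apply]
    simp only [Matrix.star_apply, A, Matrix.of_apply, ite_mul, one_mul, zero_mul,
      Finset.sum_ite_eq', Finset.mem_univ, if_true, hπ.injective.eq_iff]
    split_ifs <;> simp
  refine ⟨⟨r, hr, w, ⟨A, hA⟩⟩, fun ψ s => ?_⟩
  simp [Gate.apply, A]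

lemma exists_diag_gate {r : ℕ} (hr : r ≤ 3) (w : Fin r ↪ ι) (d : Bits r → Bool) :
    ∃ g : Gate ι, ∀ (ψ : (ι → Bool) → ℂ) s, g.apply ψ s = sgn (d (s ∘ w)) * ψ s := by
  let A : Matrix (Bits r) (Bits r) ℂ := Matrix.diagonal fun v => sgn (d v)
  have hA : A ∈ Matrix.unitaryGroup (Bits r) ℂ := by
    rw [Matrix.mem_unitaryGroup_iff, Matrix.star_eq_conjTranspose, Matrix.diagonal_conjTranspose,
      Matrix.diagonal_mul_diagonal, ← Matrix.diagonal_one]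
    congr 1; funext v
    simpa using sgn_mul_self (d v)
  refine ⟨⟨r, hr, w, ⟨A, hA⟩⟩, fun ψ s => ?_⟩
  simp only [Gate.apply, A, Matrix.diagonal_apply, smul_eq_mul, ite_mul, zero_mul]
  rw [Finset.sum_ite_eq]
  simp [extend_self]

/-- The action of a list of gates. -/
def runGates (gs : List (Gate ι)) (ψ : (ι → Bool) → ℂ) : (ι → Bool) → ℂ :=
  gs.foldl (fun ψ g => g.apply ψ) ψ

lemma runGates_append (gs gs' : List (Gate ι)) (ψ : (ι → Bool) → ℂ) :
    runGates (gs ++ gs') ψ = runGates gs' (runGates gs ψ) := by simp [runGates]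

variable [DecidableEq ι]

lemma extend_update {r : ℕ} (w : Fin r ↪ ι) (s : ι → Bool) (j : Fin r) (b : Bool) :
    Function.extend w (Function.update (s ∘ w) j b) s = Function.update s (w j) b := by
  funext i
  by_cases h : ∃ j, w j = i
  · obtain ⟨j', rfl⟩ := h
    simp [w.injective.extend_apply, Function.update_apply]
  · rw [Function.extend_apply' _ _ _ h, Function.update_of_ne]
    rintro rfl; exact h ⟨j, rfl⟩

lemma exists_flip_gate_aux {r : ℕ} (hr : r ≤ 3) (w : Fin r ↪ ι) (j : Fin r) (c : Bits r → Bool)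
    (hc : ∀ b v, c (Function.update b j v) = c b) :
    ∃ g : Gate ι, ∀ (ψ : (ι → Bool) → ℂ) s,
      g.apply ψ s = ψ (Function.update s (w j) (xor (s (w j)) (c (s ∘ w)))) := by
  obtain ⟨g, hg⟩ := exists_perm_gate hr w (fun b => Function.update b j (xor (b j) (c b)))
    (fun b => by simp [hc])
  refine ⟨g, fun ψ s => ?_⟩
  rw [hg, extend_update]; rfl

/-- A reversible instruction: the wire `t` is flipped if `h` holds for the wires `u` and `v`. -/
structure RevOp (ι : Type) where
  t : ι
  u : ι
  v : ι
  h : Bool → Bool → Bool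
  htu : t ≠ u
  htv : t ≠ v

/-- The effect of an instruction on a basis string. -/
def RevOp.eval (o : RevOp ι) (s : ι → Bool) : ι → Bool :=
  Function.update s o.t (xor (s o.t) (o.h (s o.u) (s o.v)))

lemma RevOp.eval_eval (o : RevOp ι) (s : ι → Bool) : o.eval (o.eval s) = s := by
  simp [RevOp.eval, o.htu.symm, o.htv.symm]

lemma RevOp.exists_gate (o : RevOp ι) :
    ∃ g : Gate ι, ∀ (ψ : (ι → Bool) → ℂ) s, g.apply ψ s = ψ (o.eval s) := by
  -- A gate sits on distinct wires, so coinciding control wires need a gate on two qubits instead of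
  -- three.
  by_cases huv : o.u = o.v
  · let w : Fin 2 ↪ ι := ⟨![o.u, o.t], by
      intro a b h
      have h1 := o.htu
      fin_cases a <;> fin_cases b <;> first | rfl | exact absurd h h1 | exact absurd h.symm h1⟩
    obtain ⟨g, hg⟩ := exists_flip_gate_aux (by norm_num) w 1 (fun b => o.h (b 0) (b 0))
      (fun b v => by simp)
    exact ⟨g, fun ψ s => by rw [hg, RevOp.eval, ← huv]; rfl⟩
  · let w : Fin 3 ↪ ι := ⟨![o.u, o.v, o.t], by
      intro a b h
      have h1 := o.htu; have h2 := o.htv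
      fin_cases a <;> fin_cases b <;> simp_all [eq_comm]⟩
    obtain ⟨g, hg⟩ := exists_flip_gate_aux le_rfl w 2 (fun b => o.h (b 0) (b 1))
      (fun b v => by simp)
    exact ⟨g, fun ψ s => by rw [hg, RevOp.eval]; rfl⟩

/-- The gate of a reversible instruction. -/
def RevOp.toGate (o : RevOp ι) : Gate ι := o.exists_gate.choose

lemma RevOp.toGate_apply (o : RevOp ι) (ψ : (ι → Bool) → ℂ) (s : ι → Bool) :
    o.toGate.apply ψ s = ψ (o.eval s) := o.exists_gate.choose_spec ψ s

/-- Amplitudes are pulled back, so the instructions act on the basis string in reverse order. -/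
lemma runGates_ops (ops : List (RevOp ι)) (ψ : (ι → Bool) → ℂ) (s : ι → Bool) :
    runGates (ops.map RevOp.toGate) ψ s = ψ (ops.foldr RevOp.eval s) := by
  induction ops generalizing ψ with
  | nil => rfl
  | cons o ops ih =>
    show runGates (ops.map RevOp.toGate) (o.toGate.apply ψ) s = _
    rw [ih, o.toGate_apply]; rfl

lemma foldr_foldl_eval (ops : List (RevOp ι)) (s : ι → Bool) :
    ops.foldr RevOp.eval (ops.foldl (fun s o => o.eval s) s) = s := by
  induction ops generalizing s with
  | nil => rfl
  | cons o ops ih => rw [List.foldl_cons, List.foldr_cons, ih, o.eval_eval]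

/-- Compute, apply a phase, uncompute. -/
lemma exists_phase_block (ops : List (RevOp ι)) {e t : ι} (het : e ≠ t) :
    ∃ gs : List (Gate ι), gs.length = 2 * ops.length + 1 ∧ ∀ ψ s, runGates gs ψ s =
      sgn ((ops.foldl (fun s o => o.eval s) s) e && (ops.foldl (fun s o => o.eval s) s) t) * ψ s := by
  let w : Fin 2 ↪ ι := ⟨![e, t], by
    intro a b h
    fin_cases a <;> fin_cases b <;> simp_all [eq_comm]⟩
  obtain ⟨g, hg⟩ := exists_diag_gate (by norm_num) w fun b => b 0 && b 1
  refine ⟨ops.map RevOp.toGate ++ ([g] ++ ops.reverse.map RevOp.toGate), by simp; ring,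
    fun ψ s => ?_⟩
  rw [runGates_append, runGates_append, runGates_ops]
  show g.apply _ _ = _
  rw [hg, runGates_ops, List.foldr_reverse, foldr_foldl_eval]
  rfl

end Gates

/-! ### Straight-line programs on scratch wires, and relabelling of wires. -/

section Compile

variable {ι : Type} [DecidableEq ι]

/-- Each instruction writes to its own scratch wire, numbered by its position from the start of the
program; input wires are never changed. -/
theorem Circ.exists_ops {L : List ((ι → Bool) → Bool)} (hL : Circ L) {S : ℕ} (hS : L.length ≤ S) :
    ∃ (ops : List (RevOp (ι ⊕ Fin S))) (val : (ι → Bool) → Fin S → Bool),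
      ops.length = L.length ∧
      (∀ s, ops.foldl (fun s o => o.eval s) (Sum.elim s fun _ => false) = Sum.elim s (val s)) ∧
      (∀ f ∈ L, ∃ k : Fin S, k.1 < L.length ∧ ∀ s, val s k = f s) ∧
      ∀ s k, L.length ≤ k.1 → val s k = false := by
  induction hL with
  | nil => exact ⟨[], fun _ _ => false, rfl, fun _ => rfl, by simp, by simp⟩
  | @cons L u v h hL hu hv ih =>
    rw [List.length_cons] at hS
    obtain ⟨ops, val, h1, h2, h3, h4⟩ := ih (by omega)
    have wire : ∀ f, Avail L f → ∃ x : ι ⊕ Fin S, x ≠ Sum.inr ⟨L.length, by omega⟩ ∧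
        ∀ s, Sum.elim s (val s) x = f s := by
      rintro f (⟨i, rfl⟩ | hf)
      · exact ⟨Sum.inl i, by simp, fun s => rfl⟩
      · obtain ⟨k, hk, hk'⟩ := h3 f hf
        refine ⟨Sum.inr k, ?_, hk'⟩
        simp only [ne_eq, Sum.inr.injEq, Fin.ext_iff]
        omega
    obtain ⟨xu, hxu, hxu'⟩ := wire u hu
    obtain ⟨xv, hxv, hxv'⟩ := wire v hv
    refine ⟨ops ++ [⟨Sum.inr ⟨L.length, by omega⟩, xu, xv, h, hxu.symm, hxv.symm⟩],
      fun s => Function.update (val s) ⟨L.length, by omega⟩ (h (u s) (v s)), by simp [h1], ?_, ?_, ?_⟩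
    · intro s
      rw [List.foldl_append, h2]
      simp only [List.foldl_cons, List.foldl_nil, RevOp.eval, hxu', hxv', Sum.elim_inr]
      -- The target wire is still `false`, so flipping it by the value writes the value.
      rw [h4 s _ le_rfl, Bool.false_xor, Sum.elim_update_right]
    · intro f hf
      rcases List.mem_cons.1 hf with rfl | hf
      · exact ⟨⟨L.length, by omega⟩, by simp, fun s => by simp⟩
      · obtain ⟨k, hk, hk'⟩ := h3 f hf
        refine ⟨k, by simp; omega, fun s => ?_⟩
        dsimp only
        rw [Function.update_of_ne, hk']
        intro h; rw [h] at hk; simp at hk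
    · intro s k hk
      rw [List.length_cons] at hk
      dsimp only
      rw [Function.update_of_ne, h4 s k (by omega)]
      intro h; rw [h] at hk; simp at hk

/-- Relabelling of the wires of a gate. -/
def Gate.map {ι ι' : Type} (f : ι ↪ ι') (g : Gate ι) : Gate ι' :=
  ⟨g.arity, g.arity_le, g.wires.trans f, g.mat⟩

lemma extend_trans {ι ι' : Type} {r : ℕ} (f : ι ↪ ι') (w : Fin r ↪ ι) (u : Bits r)
    (c : ι' → Bool) :
    Function.extend (w.trans f) u c = Function.extend f (Function.extend w u (c ∘ f)) c := by
  funext i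
  by_cases h : ∃ j, f j = i
  · obtain ⟨j, rfl⟩ := h
    rw [f.injective.extend_apply]
    by_cases h' : ∃ l, w l = j
    · obtain ⟨l, rfl⟩ := h'
      rw [w.injective.extend_apply]
      exact (w.trans f).injective.extend_apply _ _ l
    · rw [Function.extend_apply' _ _ _ h', Function.extend_apply']
      · rfl
      · rintro ⟨l, hl⟩; exact h' ⟨l, f.injective hl⟩
  · rw [Function.extend_apply' _ _ _ h, Function.extend_apply']
    rintro ⟨l, hl⟩; exact h ⟨w l, hl⟩

lemma Gate.map_apply {ι ι' : Type} (f : ι ↪ ι') (g : Gate ι) (ψ : (ι' → Bool) → ℂ)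
    (s : ι' → Bool) :
    (g.map f).apply ψ s = g.apply (fun u => ψ (Function.extend f u s)) (s ∘ f) := by
  unfold Gate.apply Gate.map
  refine Finset.sum_congr rfl fun u _ => ?_
  dsimp only
  rw [extend_trans]
  rfl

end Compile

/-! ### The claw finder -/

section Adversary

variable {n m κ a S : ℕ}

/-- The record of a claw finder: two points and a flag. -/
abbrev Rec (n : ℕ) : Type := (Fin n ⊕ Fin n) ⊕ Unit

/-- The wires of a claw finder: those of the prover, the record, and `S` scratch wires. -/
abbrev FinderWire (n m κ a S : ℕ) : Type := (PWire n m κ a ⊕ Rec n) ⊕ Fin S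

/-- The part of a state with record `ρ` and empty scratch wires. -/
def slice (Ψ : (FinderWire n m κ a S → Bool) → ℂ) (ρ : Rec n → Bool) :
    (PWire n m κ a → Bool) → ℂ :=
  fun s => Ψ (Sum.elim (Sum.elim s ρ) fun _ => false)

lemma slice_gate (g : Gate (PWire n m κ a)) (Ψ : (FinderWire n m κ a S → Bool) → ℂ)
    (ρ : Rec n → Bool) :
    slice ((g.map (Function.Embedding.inl.trans Function.Embedding.inl)).apply Ψ) ρ =
      g.apply (slice Ψ ρ) := by
  funext s
  rw [slice, Gate.map_apply]
  congr 1
  funext u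
  rw [slice]
  congr 1
  set f : PWire n m κ a ↪ FinderWire n m κ a S :=
    Function.Embedding.inl.trans Function.Embedding.inl
  funext w
  rcases w with (w | w) | w
  · exact f.injective.extend_apply u _ w
  · exact Function.extend_apply' _ _ _ (by rintro ⟨v, hv⟩; simp [f] at hv)
  · exact Function.extend_apply' _ _ _ (by rintro ⟨v, hv⟩; simp [f] at hv)

/-- The gates that simulate a list of steps; `blk` simulates a query. -/
def compile (blk : List (Gate (FinderWire n m κ a S))) :
    List (Step (PWire n m κ a)) → List (Gate (FinderWire n m κ a S))
  | [] => []
  | .gate g :: L => g.map (Function.Embedding.inl.trans Function.Embedding.inl) :: compile blk L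
  | .query :: L => blk ++ compile blk L

lemma length_compile_le (blk : List (Gate (FinderWire n m κ a S)))
    (L : List (Step (PWire n m κ a))) :
    (compile blk L).length ≤ L.length * (blk.length + 1) := by
  induction L with
  | nil => simp [compile]
  | cons st L ih => cases st <;> simp only [compile, List.length_cons, List.length_append] <;> nlinarith

/-- The simulated steps leave the record unchanged and restore the scratch wires, so each slice
evolves separately, under an oracle that may depend on its record. -/
lemma slice_compile {blk : List (Gate (FinderWire n m κ a S))}
    {G : (Rec n → Bool) → Bits n → Bool}
    (hblk : ∀ Ψ ρ s, slice (runGates blk Ψ) ρ s = sgn (s .e && G ρ fun i => s (.x i)) * slice Ψ ρ s)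
    (L : List (Step (PWire n m κ a))) (Ψ : (FinderWire n m κ a S → Bool) → ℂ) (ρ : Rec n → Bool) :
    slice (runGates (compile blk L) Ψ) ρ = evolve (phaseAct (G ρ)) L (slice Ψ ρ) := by
  induction L generalizing Ψ with
  | nil => rfl
  | cons st L ih =>
    rw [evolve_cons]
    cases st with
    | gate g =>
      show slice (runGates (compile blk L) (Gate.apply _ Ψ)) ρ = _
      rw [ih, slice_gate]; rfl
    | query =>
      rw [compile, runGates_append, ih]
      congr 1
      funext s
      exact hblk Ψ ρ s

/-- Copy the wire `src j` of the prover to the wire `tgt j` of the record. -/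
def copyOp {J : Type} (src : J → PWire n m κ a) (tgt : J → Rec n) (j : J) :
    RevOp (FinderWire n m κ a S) :=
  ⟨Sum.inl (Sum.inr (tgt j)), Sum.inl (Sum.inl (src j)), Sum.inl (Sum.inl (src j)), fun b _ => b,
    by simp, by simp⟩

lemma foldr_copyOp {J : Type} (src : J → PWire n m κ a) {tgt : J → Rec n}
    (htgt : Function.Injective tgt) (l : List J) (hl : l.Nodup) (s : PWire n m κ a → Bool)
    (ρ : Rec n → Bool) :
    ∃ ρ' : Rec n → Bool, (l.map (copyOp src tgt)).foldr RevOp.eval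
        (Sum.elim (Sum.elim s ρ) fun _ : Fin S => false) =
          Sum.elim (Sum.elim s ρ') (fun _ => false) ∧
      (∀ j ∈ l, ρ' (tgt j) = xor (ρ (tgt j)) (s (src j))) ∧
      ∀ o, (∀ j ∈ l, tgt j ≠ o) → ρ' o = ρ o := by
  induction l with
  | nil => exact ⟨ρ, rfl, by simp, by simp⟩
  | cons j l ih =>
    rw [List.nodup_cons] at hl
    obtain ⟨ρ', h1, h2, h3⟩ := ih hl.2
    have hj : ∀ i ∈ l, tgt i ≠ tgt j := fun i hi h => hl.1 (htgt h ▸ hi)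
    refine ⟨Function.update ρ' (tgt j) (xor (ρ' (tgt j)) (s (src j))), ?_, ?_, ?_⟩
    · rw [List.map_cons, List.foldr_cons, h1]
      simp only [RevOp.eval, copyOp, Sum.elim_inl, Sum.elim_inr, Sum.update_elim_inl,
        Sum.update_elim_inr]
    · intro i hi
      rcases List.mem_cons.1 hi with rfl | hi
      · rw [Function.update_self, h3 _ hj]
      · rw [Function.update_of_ne (hj i hi), h2 i hi]
    · intro o ho
      rw [Function.update_of_ne (ho j (by simp)).symm]
      exact h3 o fun i hi => ho i (by simp [hi])

lemma slice_copy {J : Type} [Fintype J] (src : J → PWire n m κ a) {tgt : J → Rec n}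
    (htgt : Function.Injective tgt) (Ψ : (FinderWire n m κ a S → Bool) → ℂ) (ρ : Rec n → Bool)
    (s : PWire n m κ a → Bool) :
    ∃ ρ' : Rec n → Bool,
      slice (runGates (((Finset.univ : Finset J).toList.map (copyOp src tgt)).map RevOp.toGate) Ψ)
        ρ s = slice Ψ ρ' s ∧
      (∀ j, ρ' (tgt j) = xor (ρ (tgt j)) (s (src j))) ∧
      ∀ o, (∀ j, tgt j ≠ o) → ρ' o = ρ o := by
  obtain ⟨ρ', h1, h2, h3⟩ := foldr_copyOp (S := S) src htgt Finset.univ.toList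
    (Finset.nodup_toList _) s ρ
  refine ⟨ρ', ?_, fun j => h2 j (by simp), fun o ho => h3 o fun j _ => ho j⟩
  rw [slice, runGates_ops, h1]; rfl

/-- The gates of a claw finder: run to step `j`, record the query, run on to step `i`, record the
query. -/
def finderGates (blk : List (Gate (FinderWire n m κ a S))) (L : List (Step (PWire n m κ a)))
    (i j : ℕ) : List (Gate (FinderWire n m κ a S)) :=
  compile blk (L.take j) ++
    (((Finset.univ : Finset (Fin n ⊕ Unit)).toList.map (copyOp (Sum.elim .x fun _ => .e)
      (Sum.map Sum.inl id))).map RevOp.toGate ++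
    (compile blk ((L.take i).drop j) ++
      ((Finset.univ : Finset (Fin n)).toList.map (copyOp .x
        (Sum.inl ∘ Sum.inr))).map RevOp.toGate))

lemma length_finderGates_le (blk : List (Gate (FinderWire n m κ a S)))
    (L : List (Step (PWire n m κ a))) (i j : ℕ) :
    (finderGates blk L i j).length ≤ 2 * L.length * (blk.length + 1) + 2 * n + 1 := by
  have h1 := length_compile_le blk (L.take j)
  have h2 := length_compile_le blk ((L.take i).drop j)
  have h3 : (L.take j).length * (blk.length + 1) ≤ L.length * (blk.length + 1) :=
    Nat.mul_le_mul_right _ (by simp)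
  have h4 : ((L.take i).drop j).length * (blk.length + 1) ≤ L.length * (blk.length + 1) :=
    Nat.mul_le_mul_right _ (by simp only [List.length_drop, List.length_take]; omega)
  simp only [finderGates, List.length_append, List.length_map, Finset.length_toList,
    Finset.card_univ, Fintype.card_sum, Fintype.card_fin, Fintype.card_unit]
  linarith

/-- Copying a query into an empty record is a deferred measurement: the slice with record (x, flag
set) is the projection on querying `x` with e = 1. The flag then makes the same block simulate the
oracle with the value at `x` erased, as `hit` demands. -/
lemma slice_finderGates {blk : List (Gate (FinderWire n m κ a S))}
    {G : (Rec n → Bool) → Bits n → Bool} {H : Bits n → Bool}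
    (hblk : ∀ Ψ ρ s, slice (runGates blk Ψ) ρ s = sgn (s .e && G ρ fun i => s (.x i)) * slice Ψ ρ s)
    (hG0 : G (fun _ => false) = H)
    (hG1 : ∀ x, G (Sum.elim (Sum.elim x fun _ => false) fun _ => true) = Function.update H x false)
    (L : List (Step (PWire n m κ a))) (i j : ℕ) (Ψ : (FinderWire n m κ a S → Bool) → ℂ)
    (hΨ : ∀ ρ, ρ ≠ (fun _ => false) → slice Ψ ρ = 0) (x x' : Bits n) (s : PWire n m κ a → Bool)
    (hs : (fun i => s (.x i)) = x') :
    slice (runGates (finderGates blk L i j) Ψ) (Sum.elim (Sum.elim x x') fun _ => true) s =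
      evolveLin (Function.update H x false) ((L.take i).drop j)
        (projQ x (evolveLin H (L.take j) (slice Ψ fun _ => false))) s := by
  subst hs
  simp only [finderGates, runGates_append]
  obtain ⟨ρ₃, h3, h3', h3''⟩ := slice_copy (S := S) (.x : Fin n → PWire n m κ a)
    (tgt := Sum.inl ∘ Sum.inr) (Sum.inl_injective.comp Sum.inr_injective)
    (runGates (compile blk ((L.take i).drop j))
      (runGates (((Finset.univ : Finset (Fin n ⊕ Unit)).toList.map (copyOp (Sum.elim .x fun _ => .e)
        (Sum.map Sum.inl id))).map RevOp.toGate) (runGates (compile blk (L.take j)) Ψ)))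
    (Sum.elim (Sum.elim x fun i => s (.x i)) fun _ => true) s
  rw [h3]
  have hρ₃ : ρ₃ = Sum.elim (Sum.elim x fun _ => false) fun _ => true := by
    funext o
    rcases o with (o | o) | o
    · rw [h3'' _ (by simp)]; rfl
    · have := h3' o
      simpa using this
    · rw [h3'' _ (by simp)]; rfl
  rw [hρ₃, slice_compile hblk, hG1]
  show _ = evolve _ _ _ s
  congr 1
  funext s
  obtain ⟨ρ₁, h1, h1', h1''⟩ := slice_copy (S := S)
    (Sum.elim .x fun _ => .e : Fin n ⊕ Unit → PWire n m κ a)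
    (tgt := Sum.map Sum.inl id) (Sum.map_injective.2 ⟨Sum.inl_injective, Function.injective_id⟩)
    (runGates (compile blk (L.take j)) Ψ)
    (Sum.elim (Sum.elim x fun _ => false) fun _ => true) s
  rw [h1, slice_compile hblk]
  have e1 : ∀ q, ρ₁ (Sum.inl (Sum.inl q)) = xor (x q) (s (.x q)) := fun q => h1' (Sum.inl q)
  have e2 : ρ₁ (Sum.inr ()) = xor true (s .e) := h1' (Sum.inr ())
  have e3 : ∀ q, ρ₁ (Sum.inl (Sum.inr q)) = false := fun q => h1'' _ (by simp)
  -- Before the copy only the empty record carries amplitude, and it leads to the record (x, flag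
  -- set) exactly when this query is made.
  by_cases hc : (fun i => s (.x i)) = x ∧ s .e = true
  · have hρ₁ : ρ₁ = fun _ => false := by
      funext o
      rcases o with (o | o) | o
      · rw [e1, ← hc.1]; simp
      · rw [e3]
      · rw [e2, hc.2]; rfl
    rw [projQ, if_pos hc, hρ₁, hG0]; rfl
  · have hρ₁ : ρ₁ ≠ fun _ => false := by
      rintro rfl
      refine hc ⟨?_, ?_⟩
      · funext q
        have := e1 q
        revert this
        show _ → s (.x q) = x q
        cases x q <;> cases s (.x q) <;> simp
      · simpa using e2
    rw [projQ, if_neg hc, hΨ _ hρ₁]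
    exact congrFun (map_zero (evolveLin (G ρ₁) (L.take j))) s

/-- The wires of a prover other than the key, and the remaining wires of a finder. -/
abbrev RestWire (n m a S : ℕ) : Type :=
  ((Unit ⊕ Unit) ⊕ ((Fin n ⊕ Fin n) ⊕ (Fin m ⊕ Fin a))) ⊕ (Unit ⊕ Fin S)

/-- Splitting the wires of a finder into input, output and work wires. -/
def finderEquiv (n m κ a S : ℕ) :
    FinderWire n m κ a S ≃ Fin κ ⊕ (Fin n ⊕ Fin n) ⊕ RestWire n m a S where
  toFun
    | .inl (.inl .z) => .inr (.inr (.inl (.inl (.inl ()))))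
    | .inl (.inl .e) => .inr (.inr (.inl (.inl (.inr ()))))
    | .inl (.inl (.d i)) => .inr (.inr (.inl (.inr (.inl (.inl i)))))
    | .inl (.inl (.x i)) => .inr (.inr (.inl (.inr (.inl (.inr i)))))
    | .inl (.inl (.y i)) => .inr (.inr (.inl (.inr (.inr (.inl i)))))
    | .inl (.inl (.work i)) => .inr (.inr (.inl (.inr (.inr (.inr i)))))
    | .inl (.inl (.key i)) => .inl i
    | .inl (.inr (.inl o)) => .inr (.inl o)
    | .inl (.inr (.inr ())) => .inr (.inr (.inr (.inl ())))
    | .inr k => .inr (.inr (.inr (.inr k)))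
  invFun
    | .inr (.inr (.inl (.inl (.inl ())))) => .inl (.inl .z)
    | .inr (.inr (.inl (.inl (.inr ())))) => .inl (.inl .e)
    | .inr (.inr (.inl (.inr (.inl (.inl i))))) => .inl (.inl (.d i))
    | .inr (.inr (.inl (.inr (.inl (.inr i))))) => .inl (.inl (.x i))
    | .inr (.inr (.inl (.inr (.inr (.inl i))))) => .inl (.inl (.y i))
    | .inr (.inr (.inl (.inr (.inr (.inr i))))) => .inl (.inl (.work i))
    | .inl i => .inl (.inl (.key i))
    | .inr (.inl o) => .inl (.inr (.inl o))
    | .inr (.inr (.inr (.inl ()))) => .inl (.inr (.inr ()))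
    | .inr (.inr (.inr (.inr k))) => .inr k
  left_inv := by rintro (((_ | _ | _ | _ | _ | _ | _) | (_ | _)) | _) <;> rfl
  right_inv := by
    rintro (_ | _ | (((_ | _) | ((_ | _) | (_ | _))) | (_ | _))) <;> rfl

lemma foldl_map_equiv {ι ι' : Type} (e : ι ≃ ι') (gs : List (Gate ι)) (Ψ : (ι' → Bool) → ℂ)
    (s : ι' → Bool) :
    (gs.map (Gate.map e.toEmbedding)).foldl (fun ψ g => g.apply ψ) Ψ s =
      runGates gs (fun u => Ψ (u ∘ e.symm)) (s ∘ e) := by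
  induction gs generalizing Ψ with
  | nil => simp [runGates, Function.comp_assoc]
  | cons g gs ih =>
    rw [List.map_cons, List.foldl_cons, ih]
    show runGates gs _ _ = runGates gs _ _
    congr 1
    funext u
    rw [Gate.map_apply]
    have h1 : (u ∘ e.symm) ∘ e.toEmbedding = u := by funext i; simp
    rw [h1]
    congr 1
    funext v
    congr 1
    funext i
    obtain ⟨i, rfl⟩ := e.surjective i
    simp [e.injective.extend_apply]

/-- The initial state of the simulated prover, with empty record. -/
def finderStart (P : Prover n m κ) (S : ℕ) (k : Bits κ) :
    (FinderWire n m κ P.anc S → Bool) → ℂ :=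
  Pi.single (Sum.elim (Sum.elim (P.startBasis k) fun _ => false) fun _ => false) 1

lemma slice_finderStart_zero (P : Prover n m κ) (S : ℕ) (k : Bits κ) :
    slice (finderStart P S k) (fun _ => false) = Pi.single (P.startBasis k) 1 := by
  funext s
  rw [slice, finderStart, Pi.single_apply, Pi.single_apply]
  congr 1
  simp [Sum.elim_eq_iff]

lemma slice_finderStart_of_ne (P : Prover n m κ) (S : ℕ) (k : Bits κ) {ρ : Rec n → Bool}
    (hρ : ρ ≠ fun _ => false) : slice (finderStart P S k) ρ = 0 := by
  funext s
  rw [slice, finderStart, Pi.single_apply, if_neg]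
  · rfl
  · simp [Sum.elim_eq_iff, hρ]

/-- The strings of a slice are among those whose output register shows the record; all others only
add probability. -/
lemma sum_slice_le_outProb (P : Prover n m κ) (sw : Fin n ⊕ Fin n ≃ Fin n ⊕ Fin n)
    (gs : List (Gate (FinderWire n m κ P.anc S))) (C : QCircuit (Fin κ) (Fin n ⊕ Fin n))
    (e : FinderWire n m κ P.anc S ≃ Fin κ ⊕ (Fin n ⊕ Fin n) ⊕ Fin C.anc)
    (hC : C.gates = gs.map (Gate.map e.toEmbedding))
    (hin : ∀ k : Bits κ, (Sum.elim k fun _ => false : Fin κ ⊕ (Fin n ⊕ Fin n) ⊕ Fin C.anc → Bool) ∘ e =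
      Sum.elim (Sum.elim (P.startBasis k) fun _ => false) fun _ => false)
    (hout : ∀ q, e (Sum.inl (Sum.inr (Sum.inl q))) = Sum.inr (Sum.inl (sw q)))
    (k : Bits κ) (o : Fin n ⊕ Fin n → Bool) (b : Bool) :
    ∑ s, ‖slice (runGates gs (finderStart P S k)) (Sum.elim o fun _ => b) s‖ ^ 2 ≤
      C.outProb k (o ∘ sw.symm) := by
  have hrun : ∀ s', C.run k s' = runGates gs (finderStart P S k) (s' ∘ e) := by
    intro s'
    unfold QCircuit.run
    rw [hC, foldl_map_equiv]
    congr 1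
    funext u
    rw [finderStart, Pi.single_apply, Pi.single_apply, ← hin k]
    congr 1
    rw [eq_iff_iff]
    constructor
    · intro h; rw [← h]; funext i; simp
    · rintro rfl; funext i; simp
  let inj : (PWire n m κ P.anc → Bool) ↪ (Fin κ ⊕ (Fin n ⊕ Fin n) ⊕ Fin C.anc → Bool) :=
    ⟨fun s => (Sum.elim (Sum.elim s (Sum.elim o fun _ => b)) fun _ => false) ∘ e.symm, by
      intro s s' h
      have h2 := e.symm.surjective.injective_comp_right h
      funext w
      exact congrFun h2 (Sum.inl (Sum.inl w))⟩
  have hinj : ∀ s, inj s = (Sum.elim (Sum.elim s (Sum.elim o fun _ => b)) fun _ => false) ∘ e.symm :=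
    fun s => rfl
  have hout : ∀ s, (fun q => inj s (Sum.inr (Sum.inl q))) = o ∘ sw.symm := by
    intro s; funext q
    obtain ⟨q, rfl⟩ := sw.surjective q
    rw [hinj, ← hout]
    simp
  unfold QCircuit.outProb
  refine le_trans (le_of_eq ?_) (Finset.sum_le_univ_sum_of_nonneg (s := Finset.univ.map inj) ?_)
  · rw [Finset.sum_map]
    refine Finset.sum_congr rfl fun s _ => ?_
    rw [if_pos (hout s), hrun, hinj]
    simp [slice, Function.comp_assoc]
  · intro s; split_ifs <;> positivity

variable {F : Type} [Field F] [Algebra (ZMod 2) F] {t : ℕ}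

/-- The permutation `sw` allows the two recorded points to be output in either order, as either
pre-image may be queried first. The first summand of the size counts work wires, the second gates.
-/
theorem exists_claw_finder (P : Prover n m κ) (bas : Module.Basis (Fin (n + 1)) (ZMod 2) F)
    (c : Fin t → F) (i j : ℕ) (sw : Fin n ⊕ Fin n ≃ Fin n ⊕ Fin n) :
    ∃ C : QCircuit (Fin κ) (Fin n ⊕ Fin n),
      C.size ≤ (2 + 2 * n + m + P.anc + 1 + scratchBound n t) +
        (2 * P.steps.length * (2 * scratchBound n t + 2) + 2 * n + 1) ∧
      ∀ (k : Bits κ) (x x' : Bits n),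
        hit P.steps (Pi.single (P.startBasis k) 1) i j (polyHash (bas.coord 0) (fieldPt bas) c) x x' ≤
          C.outProb k (Sum.elim x x' ∘ sw.symm) := by
  have : Inhabited (PWire n m κ P.anc ⊕ Rec n) := ⟨Sum.inl .z⟩
  obtain ⟨Lc, hL, hlen, hmem⟩ := exists_circ_maskedHash bas c
    (fun i => (Sum.inl (.x i) : PWire n m κ P.anc ⊕ Rec n))
    (fun i => Sum.inr (Sum.inl (Sum.inl i))) (Sum.inr (Sum.inr ()))
  generalize scratchBound n t = S at hlen ⊢
  obtain ⟨ops, val, ho1, ho2, ho3, -⟩ := hL.exists_ops hlen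
  obtain ⟨kt, -, hkt⟩ := ho3 _ hmem
  obtain ⟨blk, hb1, hb2⟩ := exists_phase_block ops
    (show (Sum.inl (Sum.inl .e) : FinderWire n m κ P.anc S) ≠ Sum.inr kt by simp)
  let G : (Rec n → Bool) → Bits n → Bool := fun ρ x =>
    maskedHash bas c x (fun i => ρ (Sum.inl (Sum.inl i))) (ρ (Sum.inr ()))
  have hblk : ∀ (Ψ : (FinderWire n m κ P.anc S → Bool) → ℂ) ρ s, slice (runGates blk Ψ) ρ s =
      sgn (s .e && G ρ fun i => s (.x i)) * slice Ψ ρ s := by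
    intro Ψ ρ s
    rw [slice, hb2, ho2, Sum.elim_inr, hkt]; rfl
  set H := polyHash (bas.coord 0) (fieldPt bas) c with hH
  have hG0 : G (fun _ => false) = H := by
    funext x; simp [G, maskedHash, hH]
  have hG1 : ∀ x, G (Sum.elim (Sum.elim x fun _ => false) fun _ => true) =
      Function.update H x false := by
    intro x; funext y
    by_cases hxy : y = x
    · simp [G, maskedHash, hxy]
    · simp [G, maskedHash, hH, hxy]
  let e : FinderWire n m κ P.anc S ≃
      Fin κ ⊕ (Fin n ⊕ Fin n) ⊕ Fin (Fintype.card (RestWire n m P.anc S)) :=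
    (finderEquiv n m κ P.anc S).trans (Equiv.sumCongr (Equiv.refl _)
      (Equiv.sumCongr sw (Fintype.equivFin (RestWire n m P.anc S))))
  let C : QCircuit (Fin κ) (Fin n ⊕ Fin n) :=
    ⟨Fintype.card (RestWire n m P.anc S),
      (finderGates blk P.steps i j).map (Gate.map e.toEmbedding)⟩
  refine ⟨C, ?_, fun k x x' => ?_⟩
  · have h1 := length_finderGates_le blk P.steps i j
    have h2 : blk.length + 1 ≤ 2 * S + 2 := by
      omega
    have h3 : 2 * P.steps.length * (blk.length + 1) ≤ 2 * P.steps.length * (2 * S + 2) :=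
      Nat.mul_le_mul_left _ h2
    show Fintype.card (RestWire n m P.anc S) + (List.map _ _).length ≤ _
    rw [List.length_map]
    simp only [Fintype.card_sum, Fintype.card_fin, Fintype.card_unit]
    linarith
  · refine le_trans ?_ (sum_slice_le_outProb P sw (finderGates blk P.steps i j) C e rfl ?_ ?_ k
      (Sum.elim x x') true)
    · refine Finset.sum_le_sum fun s _ => ?_
      by_cases hs : (fun i => s (.x i)) = x'
      · rw [slice_finderGates hblk hG0 hG1 _ _ _ _ (fun ρ hρ => slice_finderStart_of_ne P S k hρ)
          x x' s hs, slice_finderStart_zero]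
        -- The second copy records the point but not e, so the circuit may only gain compared with
        -- the projection in `hit`.
        rw [projQ]
        split_ifs
        · exact le_rfl
        · simp
      · simp [projQ, hs]
    · intro k
      funext w
      rcases w with ((_ | _ | _ | _ | _ | _ | _) | (_ | _)) | _ <;> rfl
    · intro q; rfl

end Adversary

/-! ### The weight on both pre-images is bounded by the success of a claw finder -/

section Weight

variable {n m κ : ℕ} (P : Prover n m κ) (cl : Bits m → Option (Bits n × Bits n))

/-- The pair attached to y is replaced by the sum over all matched pairs, which only adds
nonnegative terms. This removes y, so that finding any matched pair suffices. -/
theorem weightBoth_le_hit {A : Type} [Fintype A] (p q : A → Bits n)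
    (hcl : ∀ y x₀ x₁, cl y = some (x₀, x₁) → x₀ ≠ x₁ ∧ ∃ a, x₀ = p a ∧ x₁ = q a) (k : Bits κ) :
    weightBoth P cl (betaOf P cl k) ≤ 8 * (P.steps.length : ℝ) ^ 2 *
      ∑ i ∈ Finset.range P.steps.length, ∑ j ∈ Finset.range P.steps.length,
        (∑ H, ∑ a, (hit P.steps (Pi.single (P.startBasis k) 1) i j H (p a) (q a) +
          hit P.steps (Pi.single (P.startBasis k) 1) i j H (q a) (p a))) /
          (Fintype.card (Bits n → Bool) : ℝ) := by
  classical
  set ψ : P.Basis → ℂ := Pi.single (P.startBasis k) 1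
  let W : P.Basis → Bits n → Bits n → ℝ := fun s x₀ x₁ =>
    (∑ H, ‖(∑ a, ∑ b, (sgn a * sgn b) * evolve (phaseAct (set2 x₀ x₁ H a b)) P.steps ψ s) / 4‖ ^ 2) /
      (Fintype.card (Bits n → Bool) : ℝ)
  have hW0 : ∀ s x₀ x₁, 0 ≤ W s x₀ x₁ := fun s x₀ x₁ =>
    div_nonneg (Finset.sum_nonneg fun _ _ => by positivity) (by positivity)
  have h1 : weightBoth P cl (betaOf P cl k) ≤
      ∑ s, ∑ a, if p a ≠ q a then W s (p a) (q a) else 0 := by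
    refine Finset.sum_le_sum fun s _ => ?_
    have hnn : ∀ a, 0 ≤ if p a ≠ q a then W s (p a) (q a) else 0 := fun a => by
      split_ifs
      · exact hW0 _ _ _
      · exact le_rfl
    rcases hs : cl (P.yReg s) with _ | ⟨x₀, x₁⟩
    · exact Finset.sum_nonneg fun a _ => hnn a
    · obtain ⟨hne, a, rfl, rfl⟩ := hcl _ _ _ hs
      refine le_trans (le_of_eq ?_) (Finset.single_le_sum (fun a _ => hnn a) (Finset.mem_univ a))
      rw [if_pos hne]
      simp only [betaOf, hs]
      rw [sum_norm_sq_coefBoth hne]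
      simp only [runPhase_eq_evolve]
      rfl
  refine h1.trans ?_
  rw [Finset.sum_comm]
  have h2 : ∀ a, (∑ s, if p a ≠ q a then W s (p a) (q a) else 0) ≤ 8 * (P.steps.length : ℝ) ^ 2 *
      ∑ i ∈ Finset.range P.steps.length, ∑ j ∈ Finset.range P.steps.length,
        (∑ H, (hit P.steps ψ i j H (p a) (q a) + hit P.steps ψ i j H (q a) (p a))) /
          (Fintype.card (Bits n → Bool) : ℝ) := by
    intro a
    by_cases hne : p a ≠ q a
    · simp only [if_pos hne]
      exact sum_avg_norm_sq_le hne P.steps ψ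
    · simp only [if_neg hne, Finset.sum_const_zero]
      refine mul_nonneg (by positivity) (Finset.sum_nonneg fun i _ => Finset.sum_nonneg fun j _ =>
        div_nonneg (Finset.sum_nonneg fun H _ => add_nonneg ?_ ?_) (by positivity)) <;>
        exact hit_nonneg _ _ _ _ _ _ _
  refine (Finset.sum_le_sum fun a _ => h2 a).trans (le_of_eq ?_)
  rw [← Finset.mul_sum, Finset.sum_comm]
  congr 1
  refine Finset.sum_congr rfl fun i _ => ?_
  rw [Finset.sum_comm]
  refine Finset.sum_congr rfl fun j _ => ?_
  rw [← Finset.sum_div, Finset.sum_comm]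

end Weight

/-! ### Derandomizing the oracle and choosing the best claw finder. -/

lemma exists_basis (n : ℕ) : ∃ (F : Type) (_ : Field F) (_ : Fintype F) (_ : Algebra (ZMod 2) F),
    Nonempty (Module.Basis (Fin (n + 1)) (ZMod 2) F) :=
  -- Degree n + 1 instead of n keeps the degree positive when n = 0.
  ⟨GaloisField 2 (n + 1), inferInstance, Fintype.ofFinite _, inferInstance,
    ⟨Module.finBasisOfFinrankEq _ _ (GaloisField.finrank 2 (Nat.succ_ne_zero n))⟩⟩

lemma exists_polyHash_ge {n t : ℕ} {F : Type} [Field F] [Fintype F] [Algebra (ZMod 2) F]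
    (bas : Module.Basis (Fin (n + 1)) (ZMod 2) F) {f : (Bits n → Bool) → ℝ}
    (hf : (fun H => (f H : ℂ)) ∈ lowDeg n t) :
    ∃ c : Fin t → F, (∑ H, f H) / (Fintype.card (Bits n → Bool) : ℝ) ≤
      f (polyHash (bas.coord 0) (fieldPt bas) c) := by
  have hs : Function.Surjective (bas.coord 0) := fun z => ⟨z • bas 0, by simp⟩
  have h1 := polyHash_avg hs (fieldPt_injective bas) hf
  have h2 : (Fintype.card (Fin t → F) : ℝ) * ∑ H, f H = (Fintype.card (Bits n → Bool) : ℝ) *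
      ∑ c, f (polyHash (bas.coord 0) (fieldPt bas) (t := t) c) := by exact_mod_cast h1
  have hM : (0 : ℝ) < Fintype.card (Bits n → Bool) := by exact_mod_cast Fintype.card_pos
  obtain ⟨c, -, hc⟩ := Finset.exists_le_of_sum_le (s := (Finset.univ : Finset (Fin t → F)))
    (f := fun _ => (∑ H, f H) / (Fintype.card (Bits n → Bool) : ℝ))
    (g := fun c => f (polyHash (bas.coord 0) (fieldPt bas) c)) Finset.univ_nonempty (by
      rw [Finset.sum_const, nsmul_eq_mul, Finset.card_univ, ← mul_div_assoc, h2]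
      rw [mul_div_cancel_left₀ _ hM.ne'])
  exact ⟨c, hc⟩

section Expect

variable {A : Type} [Fintype A] (p : PMF A)

lemma sum_toReal_eq_one : ∑ a, (p a).toReal = 1 := by
  rw [← ENNReal.toReal_sum fun a _ => p.apply_ne_top a, ← tsum_fintype (L := .unconditional _),
    p.tsum_coe, ENNReal.toReal_one]

lemma expect_mono {f g : A → ℝ} (h : ∀ a, f a ≤ g a) : expect p f ≤ expect p g :=
  Finset.sum_le_sum fun a _ => mul_le_mul_of_nonneg_left (h a) ENNReal.toReal_nonneg

lemma expect_nonneg {f : A → ℝ} (h : ∀ a, 0 ≤ f a) : 0 ≤ expect p f :=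
  Finset.sum_nonneg fun a _ => mul_nonneg ENNReal.toReal_nonneg (h a)

lemma expect_add (f g : A → ℝ) : expect p (fun a => f a + g a) = expect p f + expect p g := by
  simp [expect, mul_add, Finset.sum_add_distrib]

lemma expect_mul_left (c : ℝ) (f : A → ℝ) : expect p (fun a => c * f a) = c * expect p f := by
  simp only [expect, Finset.mul_sum]
  exact Finset.sum_congr rfl fun a _ => by ring

lemma expect_div (c : ℝ) (f : A → ℝ) : expect p (fun a => f a / c) = expect p f / c := by
  simp only [expect, Finset.sum_div, mul_div_assoc]

lemma expect_const (c : ℝ) : expect p (fun _ => c) = c := by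
  rw [expect, ← Finset.sum_mul, sum_toReal_eq_one, one_mul]

lemma expect_sum {J : Type*} (S : Finset J) (f : J → A → ℝ) :
    expect p (fun a => ∑ j ∈ S, f j a) = ∑ j ∈ S, expect p (f j) := by
  simp only [expect, Finset.mul_sum]
  exact Finset.sum_comm

end Expect

/-- The probability that a circuit finds a claw. -/
def clawProb (F : NTCF) (l : ℕ) (C : QCircuit (Fin (F.keyLen l)) (Fin (F.n l) ⊕ Fin (F.n l))) : ℝ :=
  expect (F.gen l) fun kt => ∑ x₀ : F.X l, C.outProb kt.1.1 (Sum.elim x₀.1 (F.R l kt.1 x₀).1)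

lemma claw_spec (F : NTCF) (l : ℕ) (k : F.K l) (y : Bits (F.m l)) (x₀ x₁ : Bits (F.n l))
    (h : F.claw l k y = some (x₀, x₁)) :
    x₀ ≠ x₁ ∧ ∃ a : F.X l, x₀ = a.1 ∧ x₁ = (F.R l k a).1 := by
  unfold NTCF.claw at h
  split_ifs at h with hp
  obtain ⟨h1, h2, -⟩ := hp.choose_spec
  simp only [Option.some.injEq, Prod.mk.injEq] at h
  obtain ⟨rfl, rfl⟩ := h
  exact ⟨fun he => h2 (Subtype.ext he), _, rfl, by rw [h1]⟩

/-- The size of the claw finders. -/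
def finderSize (n m a T : ℕ) : ℕ :=
  (2 + 2 * n + m + a + 1 + scratchBound n (4 * T)) +
    (2 * T * (2 * scratchBound n (4 * T) + 2) + 2 * n + 1)

/-- The hash coefficients are fixed after averaging over keys and matched pairs, a sum that is still
of low degree in H, so one circuit serves all keys. -/
theorem exists_claw_finder_ge (F : NTCF) (l : ℕ) (P : Prover (F.n l) (F.m l) (F.keyLen l))
    (i j : ℕ) (b : Bool) :
    ∃ C : QCircuit (Fin (F.keyLen l)) (Fin (F.n l) ⊕ Fin (F.n l)),
      C.size ≤ finderSize (F.n l) (F.m l) P.anc P.steps.length ∧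
      (∑ H, expect (F.gen l) fun kt => ∑ a : F.X l,
        hit P.steps (Pi.single (P.startBasis kt.1.1) 1) i j H
          (bif b then (F.R l kt.1 a).1 else a.1) (bif b then a.1 else (F.R l kt.1 a).1)) /
        (Fintype.card (Bits (F.n l) → Bool) : ℝ) ≤ clawProb F l C := by
  obtain ⟨K, _, _, _, ⟨bas⟩⟩ := exists_basis (F.n l)
  obtain ⟨c, hc⟩ := exists_polyHash_ge (t := 4 * P.steps.length) bas
    (f := fun H => expect (F.gen l) fun kt => ∑ a : F.X l,
        hit P.steps (Pi.single (P.startBasis kt.1.1) 1) i j H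
          (bif b then (F.R l kt.1 a).1 else a.1) (bif b then a.1 else (F.R l kt.1 a).1)) (by
    simp only [expect]
    push_cast
    exact sum_mem_lowDeg _ fun kt _ => smul_mem_lowDeg _
      (sum_mem_lowDeg _ fun a _ => hit_mem_lowDeg _ _ _ _ _ _))
  obtain ⟨C, hC, h⟩ := exists_claw_finder P bas c i j
    (bif b then Equiv.sumComm _ _ else Equiv.refl _)
  refine ⟨C, hC, hc.trans (expect_mono _ fun kt => Finset.sum_le_sum fun a _ => ?_)⟩
  refine (h _ _ _).trans (le_of_eq ?_)
  congr 1
  cases b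
  · rfl
  · funext q; rcases q with q | q <;> rfl

/-- The factor 16 T⁴ is the hybrid loss 8T² times T² pairs of steps times two orders of the points;
every term is bounded by the best finder. -/
theorem exists_claw_finder_bound (F : NTCF) (l : ℕ) (P : Prover (F.n l) (F.m l) (F.keyLen l)) :
    ∃ C : QCircuit (Fin (F.keyLen l)) (Fin (F.n l) ⊕ Fin (F.n l)),
      C.size ≤ finderSize (F.n l) (F.m l) P.anc P.steps.length ∧
      F.keyExp l (fun k => weightBoth P (F.claw l k) (betaOf P (F.claw l k) k.1)) ≤
        16 * (P.steps.length : ℝ) ^ 4 * clawProb F l C := by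
  choose C hC hC' using exists_claw_finder_ge F l P
  set T := P.steps.length with hT
  -- The range T + 1 keeps the index set nonempty for a prover without steps.
  obtain ⟨⟨i₀, j₀, b₀⟩, -, hmax⟩ := Finset.exists_max_image
    (Finset.range (T + 1) ×ˢ Finset.range (T + 1) ×ˢ (Finset.univ : Finset Bool))
    (fun q => clawProb F l (C q.1 q.2.1 q.2.2)) ⟨(0, 0, false), by simp⟩
  refine ⟨C i₀ j₀ b₀, hC _ _ _, ?_⟩
  have h1 : ∀ i ∈ Finset.range T, ∀ j ∈ Finset.range T, ∀ b,
      clawProb F l (C i j b) ≤ clawProb F l (C i₀ j₀ b₀) := by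
    intro i hi j hj b
    refine hmax (i, j, b) ?_
    rw [Finset.mem_range] at hi hj
    simp only [Finset.mem_range, Finset.mem_product, Finset.mem_univ, and_true]
    omega
  have h2 := expect_mono (F.gen l) fun kt => weightBoth_le_hit P (F.claw l kt.1)
    (fun a : F.X l => a.1) (fun a => (F.R l kt.1 a).1) (claw_spec F l kt.1) kt.1.1
  refine h2.trans ?_
  rw [expect_mul_left, expect_sum]
  have h3 : ∀ i ∈ Finset.range T, ∀ j ∈ Finset.range T,
      expect (F.gen l) (fun kt => (∑ H, ∑ a : F.X l,
        (hit P.steps (Pi.single (P.startBasis kt.1.1) 1) i j H a.1 (F.R l kt.1 a).1 +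
          hit P.steps (Pi.single (P.startBasis kt.1.1) 1) i j H (F.R l kt.1 a).1 a.1)) /
          (Fintype.card (Bits (F.n l) → Bool) : ℝ)) ≤ 2 * clawProb F l (C i₀ j₀ b₀) := by
    intro i hi j hj
    have e0 := (hC' i j false).trans (h1 i hi j hj false)
    have e1 := (hC' i j true).trans (h1 i hi j hj true)
    simp only [cond_false, cond_true] at e0 e1
    rw [expect_div, expect_sum]
    simp only [Finset.sum_add_distrib, expect_add, add_div]
    linarith
  have h4 : ∑ i ∈ Finset.range T, expect (F.gen l) (fun kt => ∑ j ∈ Finset.range T,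
      (∑ H, ∑ a : F.X l,
        (hit P.steps (Pi.single (P.startBasis kt.1.1) 1) i j H a.1 (F.R l kt.1 a).1 +
          hit P.steps (Pi.single (P.startBasis kt.1.1) 1) i j H (F.R l kt.1 a).1 a.1)) /
          (Fintype.card (Bits (F.n l) → Bool) : ℝ)) ≤
      ∑ i ∈ Finset.range T, ∑ j ∈ Finset.range T, 2 * clawProb F l (C i₀ j₀ b₀) := by
    refine Finset.sum_le_sum fun i hi => ?_
    rw [expect_sum]
    exact Finset.sum_le_sum fun j hj => h3 i hi j hj
  refine (mul_le_mul_of_nonneg_left h4 (by positivity)).trans (le_of_eq ?_)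
  simp only [Finset.sum_const, Finset.card_range, nsmul_eq_mul]
  ring

/-! ### Polynomial bounds and negligible functions -/

lemma IsPoly.const (c : ℕ) : IsPoly fun _ => c := ⟨Polynomial.C c, fun l => by simp⟩

lemma IsPoly.add {p q : ℕ → ℕ} (hp : IsPoly p) (hq : IsPoly q) : IsPoly fun l => p l + q l := by
  obtain ⟨P, hP⟩ := hp
  obtain ⟨Q, hQ⟩ := hq
  exact ⟨P + Q, fun l => by rw [Polynomial.eval_add]; exact add_le_add (hP l) (hQ l)⟩

lemma IsPoly.mul {p q : ℕ → ℕ} (hp : IsPoly p) (hq : IsPoly q) : IsPoly fun l => p l * q l := by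
  obtain ⟨P, hP⟩ := hp
  obtain ⟨Q, hQ⟩ := hq
  exact ⟨P * Q, fun l => by rw [Polynomial.eval_mul]; exact Nat.mul_le_mul (hP l) (hQ l)⟩

lemma IsPoly.mono {p q : ℕ → ℕ} (hq : IsPoly q) (h : ∀ l, p l ≤ q l) : IsPoly p := by
  obtain ⟨Q, hQ⟩ := hq
  exact ⟨Q, fun l => (h l).trans (hQ l)⟩

lemma isPoly_scratchBound {n t : ℕ → ℕ} (hn : IsPoly n) (ht : IsPoly t) :
    IsPoly fun l => scratchBound (n l) (t l) := by
  have h1 := hn.add (IsPoly.const 1)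
  exact ((ht.mul (h1.mul ((IsPoly.const 1).add ((IsPoly.const 2).mul (h1.mul h1))))).add
    ((IsPoly.const 2).mul hn)).add (IsPoly.const 4)

lemma isPoly_finderSize {n m a T : ℕ → ℕ} (hn : IsPoly n) (hm : IsPoly m) (ha : IsPoly a)
    (hT : IsPoly T) : IsPoly fun l => finderSize (n l) (m l) (a l) (T l) := by
  have hS := isPoly_scratchBound hn ((IsPoly.const 4).mul hT)
  have h2n := (IsPoly.const 2).mul hn
  exact ((((((IsPoly.const 2).add h2n).add hm).add ha).add (IsPoly.const 1)).add hS).add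
    (((((IsPoly.const 2).mul hT).mul (((IsPoly.const 2).mul hS).add (IsPoly.const 2))).add
      h2n).add (IsPoly.const 1))

lemma Negligible.of_le {f g : ℕ → ℝ} (hg : Negligible g) (h0 : ∀ l, 0 ≤ f l) (h : ∀ l, f l ≤ g l) :
    Negligible f :=
  Asymptotics.SuperpolynomialDecay.trans_abs_le hg fun l => by
    show |f l| ≤ |g l|
    rw [abs_of_nonneg (h0 l)]
    exact (h l).trans (le_abs_self _)

lemma Negligible.poly_mul {f : ℕ → ℝ} (hf : Negligible f) (h0 : ∀ l, 0 ≤ f l) {p : ℕ → ℕ}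
    (hp : IsPoly p) : Negligible fun l => (p l : ℝ) * f l := by
  obtain ⟨Q, hQ⟩ := hp
  have h1 : Negligible fun l => (Q.map (Nat.castRingHom ℝ)).eval (l : ℝ) * f l :=
    Asymptotics.SuperpolynomialDecay.polynomial_mul hf _
  refine h1.of_le (fun l => mul_nonneg (Nat.cast_nonneg _) (h0 l)) fun l => ?_
  refine mul_le_mul_of_nonneg_right ?_ (h0 l)
  have : (Q.map (Nat.castRingHom ℝ)).eval (l : ℝ) = ((Q.eval l : ℕ) : ℝ) := by
    rw [← Nat.coe_castRingHom, Polynomial.eval_map_apply]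
  rw [this]
  exact_mod_cast hQ l

/-- Decay of f against the power 2k gives decay of its root against the power k. -/
lemma Negligible.sqrt {f : ℕ → ℝ} (hf : Negligible f) : Negligible fun l => √(f l) := by
  intro k
  have h := (hf (2 * k)).sqrt
  rw [Real.sqrt_zero] at h
  refine h.congr fun l => ?_
  show √((l : ℝ) ^ (2 * k) * f l) = (l : ℝ) ^ k * √(f l)
  rw [Real.sqrt_mul (by positivity), mul_comm 2 k, pow_mul, Real.sqrt_sq (by positivity)]

/-- The optimal choice is ε = √w; for w = 0 it is not positive and a limit replaces it. -/
lemma le_add_two_sqrt {x y w : ℝ} (hw : 0 ≤ w) (h : ∀ ε > 0, x ≤ y + ε + w / ε) :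
    x ≤ y + 2 * √w := by
  rcases hw.eq_or_lt with rfl | hw
  · simp only [zero_div, add_zero] at h
    simpa using le_of_forall_pos_le_add h
  · have h1 := h (√w) (Real.sqrt_pos.2 hw)
    rw [Real.div_sqrt] at h1
    linarith

lemma weightBoth_nonneg {n m κ : ℕ} (P : Prover n m κ) (cl : Bits m → Option (Bits n × Bits n))
    (β : P.Basis → DB n → ℂ) : 0 ≤ weightBoth P cl β := by
  refine Finset.sum_nonneg fun s _ => ?_
  rcases cl (P.yReg s) with _ | ⟨x₀, x₁⟩
  · exact le_rfl
  · exact Finset.sum_nonneg fun _ _ => by positivity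

lemma misalignment_nonneg {n m κ : ℕ} (P : Prover n m κ) (cl : Bits m → Option (Bits n × Bits n))
    (α : P.Basis → DB n → Bool → ℂ) : 0 ≤ misalignment P cl α := by
  refine Finset.sum_nonneg fun s _ => ?_
  rcases cl (P.yReg s) with _ | ⟨x₀, x₁⟩
  · exact le_rfl
  · exact Finset.sum_nonneg fun _ _ => by positivity

lemma clawProb_nonneg (F : NTCF) (l : ℕ)
    (C : QCircuit (Fin (F.keyLen l)) (Fin (F.n l) ⊕ Fin (F.n l))) : 0 ≤ clawProb F l C :=
  expect_nonneg _ fun _ => Finset.sum_nonneg fun _ _ => Finset.sum_nonneg fun _ _ => by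
    split_ifs <;> positivity

/-- The expected weight on both pre-images. -/
def expBoth (F : NTCF) (P : ∀ l, Prover (F.n l) (F.m l) (F.keyLen l)) (l : ℕ) : ℝ :=
  F.keyExp l fun k => weightBoth (P l) (F.claw l k) (betaOf (P l) (F.claw l k) k.1)

lemma expBoth_nonneg (F : NTCF) (P : ∀ l, Prover (F.n l) (F.m l) (F.keyLen l)) (l : ℕ) :
    0 ≤ expBoth F P l := expect_nonneg _ fun _ => weightBoth_nonneg _ _ _

theorem negligible_expBoth (F : NTCF) (P : ∀ l, Prover (F.n l) (F.m l) (F.keyLen l))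
    (hP : IsPoly fun l => (P l).size) : Negligible (expBoth F P) := by
  choose C hC hC' using fun l => exists_claw_finder_bound F l (P l)
  have hT : IsPoly fun l => (P l).steps.length := hP.mono fun l => Nat.le_add_left _ _
  have ha : IsPoly fun l => (P l).anc := hP.mono fun l => Nat.le_add_right _ _
  have h1 : Negligible fun l => clawProb F l (C l) :=
    F.claw_free C ((isPoly_finderSize F.n_poly F.m_poly ha hT).mono hC)
  have h2 := h1.poly_mul (fun l => clawProb_nonneg F l (C l))
    ((IsPoly.const 16).mul ((hT.mul hT).mul (hT.mul hT)))
  refine h2.of_le (expBoth_nonneg F P) fun l => (hC' l).trans (le_of_eq ?_)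
  push_cast; ring

end NTCFLemma

end

/-! ### Conclusion: the form of the state and the three bounds. -/

theorem mainTheorem7 (F : NTCFLemma.NTCF)
    (P : ∀ l, NTCFLemma.Prover (F.n l) (F.m l) (F.keyLen l))
    (hP : NTCFLemma.IsPoly fun l => (P l).size)
    (δ : ℕ → ℝ)
    (hδ : ∀ l, F.keyExp l (fun k => NTCFLemma.winProb (P l) (F.claw l k) k.1) ≥ 1 / 2 + δ l) :
    (∀ l (k : F.K l), ∃ α β γ,
      NTCFLemma.HasCoeffs (P l) (F.claw l k) ((P l).runCompressed k.1) α β γ) ∧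
    ∃ negl : ℕ → ℝ, NTCFLemma.Negligible negl ∧
      ∀ (l : ℕ)
        (α : F.K l → (P l).Basis → NTCFLemma.DB (F.n l) → Bool → ℂ)
        (β γ : F.K l → (P l).Basis → NTCFLemma.DB (F.n l) → ℂ),
        (∀ k : F.K l, NTCFLemma.HasCoeffs (P l) (F.claw l k) ((P l).runCompressed k.1)
          (α k) (β k) (γ k)) →
        F.keyExp l (fun k => NTCFLemma.weightBoth (P l) (F.claw l k) (β k)) ≤ negl l ∧
        F.keyExp l (fun k => NTCFLemma.weightOne (P l) (F.claw l k) (α k))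
          ≥ 2 * δ l - negl l ∧
        F.keyExp l (fun k => NTCFLemma.misalignment (P l) (F.claw l k) (α k))
          ≤ F.keyExp l (fun k => NTCFLemma.weightOne (P l) (F.claw l k) (α k))
            - 2 * δ l + negl l := by
  open NTCFLemma in
  have hcl : ∀ l (k : F.K l) y x₀ x₁, F.claw l k y = some (x₀, x₁) → x₀ ≠ x₁ :=
    fun l k y x₀ x₁ h => (claw_spec F l k y x₀ x₁ h).1
  refine ⟨fun l k => ⟨_, _, _, hasCoeffs_canonical (P l) _ (hcl l k) k.1⟩, ?_⟩
  have hB := negligible_expBoth F P hP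
  -- The first summand serves (i), the second is the loss in (ii) and (iii).
  refine ⟨fun l => expBoth F P l + 2 * √(expBoth F P l), hB.add (hB.sqrt.const_mul 2), ?_⟩
  intro l α β γ hco
  -- Coefficients are determined wherever the sums in the bounds see them, so arbitrary ones may be
  -- replaced by the canonical ones.
  have hβ : ∀ k, weightBoth (P l) (F.claw l k) (β k) =
      weightBoth (P l) (F.claw l k) (betaOf (P l) (F.claw l k) k.1) := fun k =>
    branchSum_congr _ _ fun s x₀ x₁ hs D hD => by
      rw [(hasCoeffs_unique (P l) _ (hcl l k) k.1 (hco k) hs hD).2]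
  have hα : ∀ k, weightOne (P l) (F.claw l k) (α k) =
      weightOne (P l) (F.claw l k) (alphaOf (P l) (F.claw l k) k.1) := fun k =>
    branchSum_congr _ _ fun s x₀ x₁ hs D hD => by
      simp only [(hasCoeffs_unique (P l) _ (hcl l k) k.1 (hco k) hs hD).1]
  have hμ : ∀ k, misalignment (P l) (F.claw l k) (α k) =
      misalignment (P l) (F.claw l k) (alphaOf (P l) (F.claw l k) k.1) := fun k =>
    branchSum_congr _ _ fun s x₀ x₁ hs D hD => by
      simp only [(hasCoeffs_unique (P l) _ (hcl l k) k.1 (hco k) hs hD).1]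
  simp only [hβ, hα, hμ]
  have h0 := expBoth_nonneg F P l
  have hs := Real.sqrt_nonneg (expBoth F P l)
  have hmis : F.keyExp l (fun k => misalignment (P l) (F.claw l k)
      (alphaOf (P l) (F.claw l k) k.1)) ≤
      (F.keyExp l (fun k => weightOne (P l) (F.claw l k) (alphaOf (P l) (F.claw l k) k.1))
        - 2 * δ l) + 2 * √(expBoth F P l) := by
    -- The same ε is used for all keys, so it is optimized only after taking the expectation.
    refine le_add_two_sqrt h0 fun ε hε => ?_
    have h1 := expect_mono (F.gen l) fun kt =>
      win_bound (P l) (F.claw l kt.1) (hcl l kt.1) kt.1.1 hε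
    simp only [expect_add, expect_mul_left, expect_div, expect_const] at h1
    have h2 := hδ l
    simp only [NTCF.keyExp, expBoth] at h2 ⊢
    linarith
  have hpos : 0 ≤ F.keyExp l (fun k => misalignment (P l) (F.claw l k)
      (alphaOf (P l) (F.claw l k) k.1)) := expect_nonneg _ fun _ => misalignment_nonneg _ _ _
  refine ⟨?_, ?_, ?_⟩
  · show expBoth F P l ≤ _
    linarith
  · linarith
  · linarith
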